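/- **Setting.** $N$ clients have local objectives $f_i(x)=\mathbb E_{\xi\sim\mathcal D_i}[F_i(x;\xi)]$ on $\mathbb R^d$, and $f=\frac1N\sum_{i=1}^N f_i$. Assume $f(x_0)-\inf f\le\Delta$, each $f_i$ is $L$-smooth ($\|\nabla f_i(x)-\nabla f_i(y)\|\le L\|x-y\|$), and $\mathbb E_{\xi\sim\mathcal D_i}\|\nabla F_i(x;\xi)-\nabla f_i(x)\|^2\le\sigma^2$ for all $i$ and $x$. No bound on the heterogeneity of the $f_i$ is assumed. **Cyclic participation.** The clients are partitioned into $\bar K$ groups of equal size $N/\bar K$. At round $r$, $S$ clients ($1\le S\le N/\bar K$) are drawn uniformly without replacement from group $r \bmod \bar K$, independently across rounds and of the stochastic gradients. Sampled clients get weight $q_r^i=1/S$, all others $q_r^i=0$. **Algorithm (Amplified SCAFFOLD with parameters $\eta,\gamma,P,I,R$).** Start with $\bar x_0=x_0$ and control variates $G_0^i$ equal to the average of $I$ independent stochastic gradients of client $i$ at $x_0$. In each round $r$ of a window $r_0,\dots,r_0+P-1$ (with $P\mid r_0$), every client sets $x_{r,0}^i=\bar x_r$ and makes $I$ local steps $x_{r,k+1}^i=x_{r,k}^i-\eta\,(\nabla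 F_i(x_{r,k}^i;\xi_{r,k}^i)-G_{r_0}^i+G_{r_0})$, where $G_{r_0}=\frac1N\sum_i G_{r_0}^i$ and $\xi_{r,k}^i\sim\mathcal D_i$ are independent fresh samples. Put $u_r=\sum_i q_r^i(x_{r,I}^i-\bar x_r)$ and $\bar x_{r+1}=\bar x_r+u_r$. At the end of the window this last model is replaced by $\bar x_{r_0+P}=\bar x_{r_0}+\gamma\sum_{r=r_0}^{r_0+P-1}u_r$. With $\bar q_{r_0}^i=\frac1P\sum_{r=r_0}^{r_0+P-1}q_r^i$, set $G_{r_0+P}^i=\frac{1}{P\bar q_{r_0}^i I}\sum_{r=r_0}^{r_0+P-1}q_r^i\sum_{k=0}^{I-1}\nabla F_i(x_{r,k}^i;\xi_{r,k}^i)$ if $\bar q_{r_0}^i>0$, and $G_{r_0+P}^i=G_{r_0}^i$ otherwise. The output is $\hat x=\bar x_{mP}$ with $m$ uniform on $\{0,\dots,R/P-1\}$, independent of everything else. **Corollary (Cyclic Participation).** (i) Let $P=\bar K$, $v_{r_0}^i=\bar q_{r_0}^i-\frac1N$ and $$w_{r_0}^i=\frac1N\sum_{j=1}^N\frac{\mathbf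 1\{\bar q_{r_0}^j>0\}}{P\bar q_{r_0}^j}\sum_{s=r_0}^{r_0+P-1}q_s^iq_s^j,\qquad \Lambda_{r_0}^i=\frac{\frac1P\sum_s (z_s^i)^2}{\left(\frac1P\sum_s z_s^i\right)^2},$$ where $(z_s^i)_{r_0-P\le s<r_0}$ are the weights of client $i$ in the last window before $r_0$ in which it participated (if there is none, a single weight $1/S$ in the round of its own group and $0$ in the others). Let $\mathcal Q_{:r_0}$ be the $\sigma$-algebra of the participation weights of the rounds before $r_0$. Then for every $r_0$ that starts a window and every $i$, $$\mathbb E[w_{r_0}^i\mid\mathcal Q_{:r_0}]=\mathbb E[w_{r_0}^i]=\frac{S\bar K}{N^2}\le\frac{P^2}{N},\qquad \mathbb E[\bar q_{r_0}^i]=\frac1N,\qquad \mathrm{Var}(\bar q_{r_0}^i)=\frac1{SN\bar K}\Big(1-\frac{S\bar K}{N}\Big),$$ $$\mathbb E\Big[\sum_{i=1}^N (v_{r_0}^i)^2\Lambda_{r_0}^i\Big]=\frac1S\Big(1-\frac{S\bar K}{N}\Big)\le\frac1S=\rho^2 .$$ (ii) There is an absolute constant $C>0$ such that for all $N,\bar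 K,S\geq 1$ with $S\bar K\le N$, all $\Delta,L,\sigma\ge0$ and all $\epsilon>0$ there are $\eta,\gamma>0$, $P=\bar K$ and integers $I,R\ge1$ with $P\mid R$, depending only on $N,\bar K,S,\Delta,L,\sigma,\epsilon$, such that for every problem and every run as above $$\mathbb E\big[\|\nabla f(\hat x)\|^2\big]\le C\epsilon^2,$$ $$R\le C\max\Big\{\bar K,\frac{\Delta L\bar K N}{S\epsilon^2}\Big\},\qquad RI\le C\max\Big\{\bar K,\frac{\Delta L\bar K N}{S\epsilon^2},\frac{\Delta L\sigma^2}{S\epsilon^4}\Big\}.$$ In particular $R\le C\,\frac{\Delta L\bar K N}{S\epsilon^2}$ whenever $\epsilon^2\le\Delta LN/S$, and if moreover $\epsilon^2\le\sigma^2/(\bar KN)$, then $RI\le C\,\frac{\Delta L\sigma^2}{S\epsilon^4}$: the iteration complexity has linear speedup in $S$, the number of rounds is $O(\epsilon^{-2})$, and neither depends on the data heterogeneity. -/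

import Mathlib

open MeasureTheory ProbabilityTheory

noncomputable section

namespace FedPeriodic

/-! ### The federated stochastic optimization problem -/

/-- The parameter space `ℝ^d` with its Euclidean norm. -/
abbrev Vec (d : ℕ) : Type := EuclideanSpace ℝ (Fin d)

/-- `N` clients; client `i` has data distribution `D i` on `Ξ` and loss `F i x ξ`. -/
structure Problem (N d : ℕ) (Ξ : Type*) [MeasurableSpace Ξ] where
  D : Fin N → Measure Ξ
  F : Fin N → Vec d → Ξ → ℝ

namespace Problem

variable {N d : ℕ} {Ξ : Type*} [MeasurableSpace Ξ]

/-- Local objective `f_i(x) = E_{ξ ∼ D_i} [F_i(x; ξ)]`. -/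
def localObj (p : Problem N d Ξ) (i : Fin N) (x : Vec d) : ℝ := ∫ ξ, p.F i x ξ ∂(p.D i)

/-- Global objective `f = (1/N) ∑ f_i`. -/
def obj (p : Problem N d Ξ) (x : Vec d) : ℝ := (1 / (N : ℝ)) * ∑ i, p.localObj i x

/-- Stochastic gradient `∇F_i(x; ξ)` (gradient in `x`). -/
def stochGrad (p : Problem N d Ξ) (i : Fin N) (x : Vec d) (ξ : Ξ) : Vec d :=
  gradient (fun y => p.F i y ξ) x

/-- The assumptions on the objectives: `f(x₀) - inf f ≤ Δ`, each `f_i` is `L`-smooth, and the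
stochastic gradients have variance at most `σ²`; together with the regularity which makes these
notions meaningful. -/
structure Admissible (p : Problem N d Ξ) (x₀ : Vec d) (Δ L σ : ℝ) : Prop where
  prob : ∀ i, IsProbabilityMeasure (p.D i)
  integrable_loss : ∀ i x, Integrable (p.F i x) (p.D i)
  differentiable_loss : ∀ i ξ, Differentiable ℝ (fun x => p.F i x ξ)
  measurable_stochGrad : ∀ i, Measurable (fun z : Vec d × Ξ => p.stochGrad i z.1 z.2)
  differentiable_localObj : ∀ i, Differentiable ℝ (p.localObj i)
  gap : ∀ x, p.obj x₀ - p.obj x ≤ Δ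
  smooth : ∀ i x y,
    ‖gradient (p.localObj i) x - gradient (p.localObj i) y‖ ≤ L * ‖x - y‖
  variance_le : ∀ i x,
    ∫⁻ ξ, ‖p.stochGrad i x ξ - gradient (p.localObj i) x‖ₑ ^ 2 ∂(p.D i) ≤ ENNReal.ofReal (σ ^ 2)

end Problem

/-! ### Amplified SCAFFOLD -/

section Algorithm

variable {N d : ℕ} {Ξ : Type*}

/-- What the server holds at the start of a round `r` of the window starting at round `r₀`. -/
structure State (N d : ℕ) where
  /-- the current model `x̄_r` -/
  x : Vec d
  /-- the model `x̄_{r₀}` at the start of the current window -/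
  anchor : Vec d
  /-- accumulated weighted local updates `u` of the current window -/
  u : Vec d
  /-- control variates `G_{r₀}^i` -/
  G : Fin N → Vec d
  /-- `∑_{s = r₀}^{r - 1} q_s^i` -/
  qSum : Fin N → ℝ
  /-- `∑_{s = r₀}^{r - 1} q_s^i (1/I) ∑_k ∇F_i(x_{s,k}^i; ξ_{s,k}^i)` -/
  gSum : Fin N → Vec d

/-- The global control variate `G_{r₀} = (1/N) ∑ G_{r₀}^i`. -/
def State.meanG (s : State N d) : Vec d := (1 / (N : ℝ)) • ∑ i, s.G i

/-- Local iterates of a client within a round, started at `x`, with stochastic gradient oracle `g`,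
correction `c` and samples `ξ 0, ξ 1, …`:
`x_{k+1} = x_k - η (g(x_k; ξ_k) + c)`. -/
def localIterate (g : Vec d → Ξ → Vec d) (η : ℝ) (c x : Vec d) (ξ : ℕ → Ξ) : ℕ → Vec d
  | 0 => x
  | k + 1 =>
      localIterate g η c x ξ k - η • (g (localIterate g η c x ξ k) (ξ k) + c)

/-- Local iterate `x_{r,k}^i` of client `i` when the server is in state `s`: each local step uses
the direction `∇F_i(x; ξ) - G_{r₀}^i + G_{r₀}`. -/
def clientIterate (g : Fin N → Vec d → Ξ → Vec d) (η : ℝ) (s : State N d)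
    (ξ : ℕ → Fin N → Ξ) (i : Fin N) (k : ℕ) : Vec d :=
  localIterate (g i) η (s.meanG - s.G i) s.x (fun l => ξ l i) k

/-- One communication round `r`, before the end-of-window operations. `q` are the participation
weights of the round and `ξ k i` the sample of client `i` at local step `k`. -/
def roundUpdate (g : Fin N → Vec d → Ξ → Vec d) (η : ℝ) (I : ℕ)
    (q : Fin N → ℝ) (ξ : ℕ → Fin N → Ξ) (s : State N d) : State N d where
  x := s.x + ∑ i, q i • (clientIterate g η s ξ i I - s.x)
  anchor := s.anchor
  u := s.u + ∑ i, q i • (clientIterate g η s ξ i I - s.x)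
  G := s.G
  qSum := fun i => s.qSum i + q i
  gSum := fun i => s.gSum i +
    q i • ((1 / (I : ℝ)) • ∑ k ∈ Finset.range I, g i (clientIterate g η s ξ i k) (ξ k i))

/-- The operations at the end of a window: the amplified update `x̄_{r₀+P} = x̄_{r₀} + γ u`, and
the new control variate of each client that participated in the window, namely the average of its
stochastic gradients over the window, weighted by participation. -/
def windowUpdate (γ : ℝ) (s : State N d) : State N d where
  x := s.anchor + γ • s.u
  anchor := s.anchor + γ • s.u
  u := 0
  G := fun i => if 0 < s.qSum i then (1 / s.qSum i) • s.gSum i else s.G i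
  qSum := 0
  gSum := 0

/-- Initial state: the model is `x₀`, and the control variate of client `i` is the average of `I`
stochastic gradients of client `i` at `x₀`. -/
def initState (g : Fin N → Vec d → Ξ → Vec d) (I : ℕ) (x₀ : Vec d) (ξ₀ : ℕ → Fin N → Ξ) :
    State N d where
  x := x₀
  anchor := x₀
  u := 0
  G := fun i => (1 / (I : ℝ)) • ∑ k ∈ Finset.range I, g i x₀ (ξ₀ k i)
  qSum := 0
  gSum := 0

/-- Amplified SCAFFOLD with local step size `η`, amplification factor `γ`, window length `P` and
`I` local steps per round: the server state at the start of round `r`, for given participation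
weights `q r i` and samples `ξ r k i`. -/
def amplifiedScaffold (g : Fin N → Vec d → Ξ → Vec d) (η γ : ℝ) (P I : ℕ) (x₀ : Vec d)
    (q : ℕ → Fin N → ℝ) (ξ₀ : ℕ → Fin N → Ξ) (ξ : ℕ → ℕ → Fin N → Ξ) : ℕ → State N d
  | 0 => initState g I x₀ ξ₀
  | r + 1 =>
      let s := roundUpdate g η I (q r) (ξ r) (amplifiedScaffold g η γ P I x₀ q ξ₀ ξ r)
      if P ∣ r + 1 then windowUpdate γ s else s

end Algorithm

/-! ### Cyclic participation -/

section Participation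

variable {N K : ℕ}

/-- The clients that are available at round `r`: those of group `r mod K`. -/
def available (group : Fin N → Fin K) (r : ℕ) : Finset (Fin N) :=
  Finset.univ.filter fun i => (group i : ℕ) = r % K

/-- `group` partitions the `N` clients into `K` subsets of equal size `N / K`. -/
def IsEqualPartition (group : Fin N → Fin K) : Prop :=
  ∀ a : Fin K, (Finset.univ.filter fun i => group i = a).card * K = N

/-- Participation weight: `1/S` for the sampled clients and `0` for the others. -/
def weight (S : ℕ) (A : Finset (Fin N)) (i : Fin N) : ℝ := if i ∈ A then 1 / (S : ℝ) else 0

/-- Cyclic participation for `R` rounds: the set `A r` of clients sampled at round `r < R` is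
uniform among the `S`-element subsets of the available group, independently across rounds. -/
structure IsCyclic {Ω : Type*} [MeasurableSpace Ω] (μ : Measure Ω) (group : Fin N → Fin K)
    (S R : ℕ) (A : ℕ → Ω → Finset (Fin N)) : Prop where
  measurable : ∀ r < R, ∀ T, MeasurableSet (A r ⁻¹' {T})
  law : ∀ r < R, ∀ T ∈ (available group r).powersetCard S,
    μ.real (A r ⁻¹' {T}) = 1 / (((available group r).powersetCard S).card : ℝ)
  indep : iIndep (fun r : Fin R => MeasurableSpace.comap (A r) ⊤) μ

/-- `q̄_{mP}^i`: average weight of client `i` over the window of rounds `mP, …, (m+1)P - 1`. -/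
def qBar (q : ℕ → Fin N → ℝ) (P m : ℕ) (i : Fin N) : ℝ :=
  (1 / (P : ℝ)) * ∑ s ∈ Finset.range P, q (m * P + s) i

/-- `w_{r₀}^i = (1/N) ∑_j (1{q̄^j > 0} / (P q̄^j)) ∑_s q_s^i q_s^j`, for `r₀ = mP`. -/
def wCoef (q : ℕ → Fin N → ℝ) (P m : ℕ) (i : Fin N) : ℝ :=
  (1 / (N : ℝ)) * ∑ j, (if 0 < qBar q P m j then 1 / ((P : ℝ) * qBar q P m j) else 0) *
    ∑ s ∈ Finset.range P, q (m * P + s) i * q (m * P + s) j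

/-- `zWindow q P z₀ m i s` is `z_{(m-1)P+s}^i`: the weights of client `i` in the last window before
round `mP` in which it participated, and `z₀ i` if there is none. -/
def zWindow (q : ℕ → Fin N → ℝ) (P : ℕ) (z₀ : Fin N → ℕ → ℝ) : ℕ → Fin N → ℕ → ℝ
  | 0, i => z₀ i
  | m + 1, i => if 0 < qBar q P m i then fun s => q (m * P + s) i else zWindow q P z₀ m i

/-- The initial control variate of client `i` counts as one virtual participation, with weight
`1/S`, in the round of client `i`'s group. -/
def zInit (group : Fin N → Fin K) (S : ℕ) (i : Fin N) (s : ℕ) : ℝ :=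
  if (group i : ℕ) = s then 1 / (S : ℝ) else 0

/-- `Λ_{r₀}^i = ((1/P) ∑_s (z_s^i)²) / ((1/P) ∑_s z_s^i)²`, for `r₀ = mP`. -/
def lamCoef (q : ℕ → Fin N → ℝ) (P : ℕ) (z₀ : Fin N → ℕ → ℝ) (m : ℕ) (i : Fin N) : ℝ :=
  ((1 / (P : ℝ)) * ∑ s ∈ Finset.range P, zWindow q P z₀ m i s ^ 2) /
    ((1 / (P : ℝ)) * ∑ s ∈ Finset.range P, zWindow q P z₀ m i s) ^ 2

/-- The σ-algebra `𝒬_{:r}` generated by the participation weights of the rounds before `r`. -/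
abbrev pastQ {Ω : Type*} (q : Ω → ℕ → Fin N → ℝ) (r : ℕ) : MeasurableSpace Ω :=
  ⨆ s : Fin r, MeasurableSpace.comap (fun ω => q ω s) inferInstance

end Participation

/-! ### The randomness of a run, and its output -/

/-- All random quantities of a run. -/
structure Draws (Ω Ξ : Type*) (N : ℕ) where
  /-- the set of clients sampled at each round -/
  clients : ℕ → Ω → Finset (Fin N)
  /-- samples used for the initial control variates: step, client -/
  initSample : ℕ → Fin N → Ω → Ξ
  /-- samples `ξ_{r,k}^i`: round, step, client -/
  sample : ℕ → ℕ → Fin N → Ω → Ξ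
  /-- the window index `m` that determines the output `x̂ = x̄_{mP}` -/
  index : Ω → ℕ

/-- The joint law of the draws of a run with `R` rounds, `I` local steps and window length `P`:
cyclic participation, samples of client `i` distributed as `D i`, output index uniform on
`{0, …, R/P - 1}`, everything mutually independent. -/
structure Draws.IsRun {Ω Ξ : Type*} [MeasurableSpace Ω] [MeasurableSpace Ξ] {N K : ℕ}
    (μ : Measure Ω) (D : Fin N → Measure Ξ) (group : Fin N → Fin K) (S P I R : ℕ)
    (X : Draws Ω Ξ N) : Prop where
  cyclic : IsCyclic μ group S R X.clients
  measurable_initSample : ∀ k < I, ∀ i, Measurable (X.initSample k i)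
  law_initSample : ∀ k < I, ∀ i, μ.map (X.initSample k i) = D i
  measurable_sample : ∀ r < R, ∀ k < I, ∀ i, Measurable (X.sample r k i)
  law_sample : ∀ r < R, ∀ k < I, ∀ i, μ.map (X.sample r k i) = D i
  measurable_index : Measurable X.index
  law_index : ∀ m < R / P, μ.real (X.index ⁻¹' {m}) = 1 / ((R / P : ℕ) : ℝ)
  indep : iIndep
    (Sum.elim (fun _ : Unit => MeasurableSpace.comap X.index inferInstance)
      (Sum.elim (fun r : Fin R => MeasurableSpace.comap (X.clients r) ⊤)
        (Sum.elim
          (fun j : Fin I × Fin N => MeasurableSpace.comap (X.initSample j.1 j.2) inferInstance)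
          (fun j : Fin R × Fin I × Fin N =>
            MeasurableSpace.comap (X.sample j.1 j.2.1 j.2.2) inferInstance)))) μ

/-- The output `x̂ = x̄_{mP}` of Amplified SCAFFOLD. -/
def output {Ω Ξ : Type*} [MeasurableSpace Ξ] {N d : ℕ} (p : Problem N d Ξ) (S : ℕ) (η γ : ℝ)
    (P I : ℕ) (x₀ : Vec d) (X : Draws Ω Ξ N) (ω : Ω) : Vec d :=
  (amplifiedScaffold p.stochGrad η γ P I x₀ (fun r => weight S (X.clients r ω))
    (fun k i => X.initSample k i ω) (fun r k i => X.sample r k i ω) (X.index ω * P)).x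

end FedPeriodic

end

/-! With window length `K`, every client is available in exactly one round of a window. The
participation quantities of the first part are therefore functions of the indicators `sampled`,
written χ: the average weight is χ/(SK), the coefficient `wCoef` is χ/N, and `lamCoef` is the
constant K. The moments of χ for a uniform S-subset of a group of N/K clients give the stated
values, and independence across rounds makes the conditional expectation constant.

For the complexity bound, a whole window is read as one step of a variance-reduced gradient method
with step size γηKI. The weights of a window sum to one, so `model_succ` can write the update
direction as the full gradient plus `errPart`, `noisePart` and `driftPart`. Only the errors ∇f_i −
G_i of the control variates enter, never differences between clients, and the first control variates
are sampled at the starting point; this is why no bound on heterogeneity is needed.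

The coefficients of `errPart` are centred, independent of the past, and negatively correlated within
a group, so its second moment is at most the mean squared error A divided by SK
(`integral_errPart_sq_le`). The noises of distinct local steps are orthogonal and each is active
with probability p = SK/N, which gives σ²/(SKI) for `noisePart`. Orthogonality needs unbiased
stochastic gradients; unbiasedness is not assumed but derived in `integral_stochGrad_sub` from the
definition of the local objectives and the variance bound. The drift is harmless because γ decouples
the window step from η, so η can be taken as small as desired.

A client renews its control variate with probability p, hence A contracts by 1 − p/2 up to noise,
drift and movement of the model (`errSq_succ_le`). `sum_le_of_recursion` adds a multiple of A to the
objective as a Lyapunov function. With γηKI = S/(16NL) the mean squared gradient over M windows is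
of order ΔLN/(SM) + σ²/(NKI), plus an initial error term absorbed when M is at least of order N/S.
Taking M of order ΔLN/(Sε²) and I of order σ²/(KNε²) + 1 balances the terms. If 2ΔL ≤ ε², the
starting point is already good enough and one window suffices. -/

noncomputable section

namespace FedPeriodic

open Filter Topology
open scoped ENNReal NNReal RealInnerProductSpace

/-! ### Smooth functions -/

section Smooth

variable {E : Type*} [NormedAddCommGroup E] [InnerProductSpace ℝ E] [CompleteSpace E]

/-- The quadratic upper bound for a function with Lipschitz gradient. -/
theorem le_quadratic_of_lipschitz_gradient {f : E → ℝ} {L : ℝ} (hf : Differentiable ℝ f)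
    (hL : ∀ x y, ‖gradient f x - gradient f y‖ ≤ L * ‖x - y‖) (x v : E) :
    f (x + v) ≤ f x + ⟪gradient f x, v⟫ + L / 2 * ‖v‖ ^ 2 := by
  -- The function minus its claimed upper bound, along the segment from `x` to `x + v`. Its
  -- derivative is at most L t ‖v‖² − L t ‖v‖² = 0 for t in (0, 1).
  have hd : ∀ t : ℝ, HasDerivAt
      (fun t : ℝ => f (x + t • v) - t * ⟪gradient f x, v⟫ - L / 2 * ‖v‖ ^ 2 * t ^ 2)
      (⟪gradient f (x + t • v), v⟫ - ⟪gradient f x, v⟫ - L / 2 * ‖v‖ ^ 2 * (2 * t)) t := by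
    intro t
    have h1 : HasDerivAt (fun t : ℝ => x + t • v) v t := by
      simpa using ((hasDerivAt_id t).smul_const v).const_add x
    have h2 : HasDerivAt (fun t : ℝ => f (x + t • v)) ⟪gradient f (x + t • v), v⟫ t := by
      have := (hf (x + t • v)).hasFDerivAt.comp_hasDerivAt t h1
      rwa [← inner_gradient_left] at this
    have h3 : HasDerivAt (fun t : ℝ => t * ⟪gradient f x, v⟫) ⟪gradient f x, v⟫ t := by
      simpa using (hasDerivAt_id t).mul_const ⟪gradient f x, v⟫
    have h4 : HasDerivAt (fun t : ℝ => L / 2 * ‖v‖ ^ 2 * t ^ 2) (L / 2 * ‖v‖ ^ 2 * (2 * t)) t := by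
      simpa using (hasDerivAt_pow 2 t).const_mul (L / 2 * ‖v‖ ^ 2)
    exact (h2.sub h3).sub h4
  have hanti : AntitoneOn
      (fun t : ℝ => f (x + t • v) - t * ⟪gradient f x, v⟫ - L / 2 * ‖v‖ ^ 2 * t ^ 2)
      (Set.Icc 0 1) := by
    refine antitoneOn_of_deriv_nonpos (convex_Icc 0 1)
      (fun t _ => (hd t).continuousAt.continuousWithinAt)
      (fun t _ => (hd t).differentiableAt.differentiableWithinAt) (fun t ht => ?_)
    rw [interior_Icc] at ht
    rw [(hd t).deriv, ← inner_sub_left]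
    have h1 := real_inner_le_norm (gradient f (x + t • v) - gradient f x) v
    have h2 := hL (x + t • v) x
    rw [add_sub_cancel_left, norm_smul, Real.norm_of_nonneg ht.1.le] at h2
    have h3 := mul_le_mul_of_nonneg_right h2 (norm_nonneg v)
    nlinarith
  have := hanti (Set.left_mem_Icc.2 zero_le_one) (Set.right_mem_Icc.2 zero_le_one) zero_le_one
  simp only [one_smul, zero_smul, add_zero] at this
  linarith

/-- The squared gradient at an almost minimizer. -/
theorem norm_gradient_sq_le {f : E → ℝ} {L Δ : ℝ} (hf : Differentiable ℝ f) (hL0 : 0 ≤ L)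
    (hL : ∀ x y, ‖gradient f x - gradient f y‖ ≤ L * ‖x - y‖) (x : E)
    (hgap : ∀ y, f x - f y ≤ Δ) : ‖gradient f x‖ ^ 2 ≤ 2 * (Δ * L) := by
  have key : ∀ t : ℝ, t * ‖gradient f x‖ ^ 2 - L / 2 * t ^ 2 * ‖gradient f x‖ ^ 2 ≤ Δ := by
    intro t
    have h1 := le_quadratic_of_lipschitz_gradient hf hL x (-t • gradient f x)
    have h2 := hgap (x + -t • gradient f x)
    rw [inner_smul_right, real_inner_self_eq_norm_sq, norm_smul, mul_pow, Real.norm_eq_abs,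
      sq_abs] at h1
    nlinarith
  -- For L = 0 the optimal step 1/L is unavailable, but arbitrarily long steps are allowed: a
  -- nonzero gradient would force Δ + 1 ≤ Δ.
  rcases hL0.eq_or_lt with rfl | hL0
  · by_contra! h
    rw [mul_zero, mul_zero] at h
    have h1 := key ((Δ + 1) / ‖gradient f x‖ ^ 2)
    rw [zero_div, zero_mul, zero_mul, sub_zero, div_mul_cancel₀ _ h.ne'] at h1
    linarith
  · have h1 := key (1 / L)
    have h2 : 1 / L * ‖gradient f x‖ ^ 2 - L / 2 * (1 / L) ^ 2 * ‖gradient f x‖ ^ 2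
        = ‖gradient f x‖ ^ 2 / (2 * L) := by
      field_simp; ring
    rw [h2, div_le_iff₀ (by positivity)] at h1
    linarith

end Smooth

/-! ### Auxiliary facts on Lipschitz maps and inner products. -/

theorem continuous_of_norm_sub_le {E E' : Type*} [NormedAddCommGroup E] [NormedAddCommGroup E']
    {G : E → E'} {L : ℝ} (hG : ∀ x y, ‖G x - G y‖ ≤ L * ‖x - y‖) : Continuous G := by
  refine (LipschitzWith.of_dist_le_mul (K := L.toNNReal) fun x y => ?_).continuous
  rw [dist_eq_norm, dist_eq_norm]
  exact (hG x y).trans (by gcongr; exact Real.le_coe_toNNReal L)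

theorem integrable_inner_of_memLp {Ω E : Type*} [MeasurableSpace Ω] [NormedAddCommGroup E]
    [InnerProductSpace ℝ E] {μ : Measure Ω} {u v : Ω → E} (hu : MemLp u 2 μ) (hv : MemLp v 2 μ) :
    Integrable (fun ω => ⟪u ω, v ω⟫) μ := by
  refine (hu.norm.integrable_mul hv.norm).mono' (hu.1.inner hv.1) (.of_forall fun ω => ?_)
  exact norm_inner_le_norm _ _

/-! ### Differentiation under the integral with square-integrable derivatives -/

section Unbiased

variable {Ξ : Type*} [MeasurableSpace Ξ]

/-- Difference quotients are bounded in `L²` by the derivatives. -/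
theorem lintegral_sub_sq_le {D : Measure Ξ} [IsProbabilityMeasure D] {H h : ℝ → Ξ → ℝ}
    (hd : ∀ ξ t, HasDerivAt (fun t => H t ξ) (h t ξ) t)
    (hm : Measurable (fun z : ℝ × Ξ => h z.1 z.2)) {V : ℝ≥0}
    (hV : ∀ t, ∫⁻ ξ, ‖h t ξ‖ₑ ^ 2 ∂D ≤ V) {t : ℝ} (ht : 0 ≤ t) :
    ∫⁻ ξ, ‖H t ξ - H 0 ξ‖ₑ ^ 2 ∂D ≤ ENNReal.ofReal t ^ 2 * V := by
  have hpt : ∀ ξ, ‖H t ξ - H 0 ξ‖ₑ ^ 2 ≤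
      ENNReal.ofReal t * ∫⁻ s in Set.Ioc 0 t, ‖h s ξ‖ₑ ^ 2 := by
    intro ξ
    have hms : Measurable (fun s => h s ξ) := hm.comp measurable_prodMk_right
    have h1 : ‖H t ξ - H 0 ξ‖ₑ ≤ ∫⁻ s in Set.Ioc 0 t, ‖h s ξ‖ₑ := by
      -- If the derivative is not integrable on the segment the right side is infinite, so the
      -- fundamental theorem of calculus is only needed in the integrable case.
      by_cases htop : ∫⁻ s in Set.Ioc 0 t, ‖h s ξ‖ₑ = ⊤
      · simp [htop]
      · have hi : IntegrableOn (fun s => h s ξ) (Set.Ioc 0 t) :=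
          ⟨hms.aestronglyMeasurable, lt_top_iff_ne_top.2 htop⟩
        rw [← intervalIntegral.integral_eq_sub_of_hasDerivAt (fun s _ => hd ξ s)
          ((intervalIntegrable_iff_integrableOn_Ioc_of_le ht).2 hi),
          intervalIntegral.integral_of_le ht]
        exact enorm_integral_le_lintegral_enorm _
    have h2 : (∫⁻ s in Set.Ioc 0 t, ‖h s ξ‖ₑ) ^ 2 ≤
        ENNReal.ofReal t * ∫⁻ s in Set.Ioc 0 t, ‖h s ξ‖ₑ ^ 2 := by
      have := ENNReal.lintegral_mul_le_Lp_mul_Lq (volume.restrict (Set.Ioc 0 t))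
        Real.HolderConjugate.two_two (f := fun _ => 1) (g := fun s => ‖h s ξ‖ₑ)
        aemeasurable_const hms.enorm.aemeasurable
      have h3 := pow_le_pow_left₀ zero_le this 2
      simp only [Pi.mul_apply, one_mul, ENNReal.one_rpow, lintegral_const, mul_pow,
        Measure.restrict_apply_univ, Real.volume_Ioc, sub_zero, ← ENNReal.rpow_natCast,
        ← ENNReal.rpow_mul] at h3
      simpa using h3
    calc _ ≤ _ := pow_le_pow_left₀ zero_le h1 2
      _ ≤ _ := h2
  calc ∫⁻ ξ, ‖H t ξ - H 0 ξ‖ₑ ^ 2 ∂D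
      ≤ ∫⁻ ξ, (ENNReal.ofReal t * ∫⁻ s in Set.Ioc 0 t, ‖h s ξ‖ₑ ^ 2) ∂D := lintegral_mono hpt
    _ = ENNReal.ofReal t * ∫⁻ ξ, (∫⁻ s in Set.Ioc 0 t, ‖h s ξ‖ₑ ^ 2) ∂D := by
        refine lintegral_const_mul' _ _ ENNReal.ofReal_ne_top
    _ = ENNReal.ofReal t * ∫⁻ s in Set.Ioc 0 t, ∫⁻ ξ, ‖h s ξ‖ₑ ^ 2 ∂D := by
        rw [lintegral_lintegral_swap]
        exact ((hm.comp measurable_swap).enorm.pow_const 2).aemeasurable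
    _ ≤ ENNReal.ofReal t * ∫⁻ _ in Set.Ioc 0 t, V := by
        gcongr with s; exact hV s
    _ = ENNReal.ofReal t ^ 2 * V := by
        rw [lintegral_const]
        simp only [Measure.restrict_apply_univ, Real.volume_Ioc, sub_zero]
        ring

/-- If the centred integrable functions `H t` are differentiable in `t` with derivatives bounded in
`L²`, the derivatives are centred. -/
theorem integral_deriv_eq_zero {D : Measure Ξ} [IsProbabilityMeasure D] {H h : ℝ → Ξ → ℝ}
    (hd : ∀ ξ t, HasDerivAt (fun t => H t ξ) (h t ξ) t)
    (hm : Measurable (fun z : ℝ × Ξ => h z.1 z.2))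
    (hint : ∀ t, Integrable (H t) D) (h0 : ∀ t, ∫ ξ, H t ξ ∂D = 0) {V : ℝ≥0}
    (hV : ∀ t, ∫⁻ ξ, ‖h t ξ‖ₑ ^ 2 ∂D ≤ V) :
    ∫ ξ, h 0 ξ ∂D = 0 := by
  -- The difference quotients along τ are centred, converge pointwise to `h 0`, and are bounded in
  -- L². The last fact makes them uniformly integrable, so their means converge to the mean of `h
  -- 0`.
  set τ : ℕ → ℝ := fun n => 1 / ((n : ℝ) + 1) with hτ
  have hτpos : ∀ n, 0 < τ n := fun n => Nat.one_div_pos_of_nat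
  have hτ0 : Tendsto τ atTop (𝓝[>] 0) :=
    tendsto_nhdsWithin_iff.2 ⟨tendsto_one_div_add_atTop_nhds_zero_nat, .of_forall hτpos⟩
  set q : ℕ → Ξ → ℝ := fun n ξ => (τ n)⁻¹ * (H (τ n) ξ - H 0 ξ) with hq
  have hqint : ∀ n, Integrable (q n) D := fun n => ((hint _).sub (hint _)).const_mul _
  have hq0 : ∀ n, ∫ ξ, q n ξ ∂D = 0 := by
    intro n
    simp only [hq]
    rw [integral_const_mul, integral_sub (hint _) (hint _), h0, h0]; simp
  have hlim : ∀ ξ, Tendsto (fun n => q n ξ) atTop (𝓝 (h 0 ξ)) := by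
    intro ξ
    have h1 := ((hd ξ 0).tendsto_slope_zero_right).comp hτ0
    simpa [hq, Function.comp_def] using h1
  have hmt : ∀ t, Measurable (h t) := fun t => hm.comp measurable_prodMk_left
  have hh2 : MemLp (h 0) 2 D := by
    refine ⟨(hmt 0).aestronglyMeasurable, ?_⟩
    rw [eLpNorm_lt_top_iff_lintegral_rpow_enorm_lt_top two_ne_zero ENNReal.ofNat_ne_top]
    simpa using (hV 0).trans_lt ENNReal.coe_lt_top
  have hqV : ∀ n, ∫⁻ ξ, ‖q n ξ‖ₑ ^ 2 ∂D ≤ V := by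
    intro n
    have h1 := lintegral_sub_sq_le hd hm hV (hτpos n).le
    simp only [hq, enorm_mul, mul_pow]
    rw [lintegral_const_mul' _ _ (by simp)]
    calc _ ≤ ‖(τ n)⁻¹‖ₑ ^ 2 * (ENNReal.ofReal (τ n) ^ 2 * V) := by gcongr
      _ = V := by
        rw [← mul_assoc, ← mul_pow, Real.enorm_eq_ofReal (inv_pos.2 (hτpos n)).le,
          ← ENNReal.ofReal_mul (inv_pos.2 (hτpos n)).le, inv_mul_cancel₀ (hτpos n).ne']
        simp
  have hq2 : ∀ n, MemLp (q n) 2 D := by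
    intro n
    refine ⟨(hqint n).aestronglyMeasurable, ?_⟩
    rw [eLpNorm_lt_top_iff_lintegral_rpow_enorm_lt_top two_ne_zero ENNReal.ofNat_ne_top]
    simpa using (hqV n).trans_lt ENNReal.coe_lt_top
  have hreal : ∀ u : Ξ → ℝ, MemLp u 2 D → ∫⁻ ξ, ‖u ξ‖ₑ ^ 2 ∂D ≤ V → ∫ ξ, u ξ ^ 2 ∂D ≤ V := by
    intro u hu huV
    rw [integral_eq_lintegral_of_nonneg_ae (.of_forall fun _ => sq_nonneg _)
      hu.integrable_sq.aestronglyMeasurable]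
    refine ENNReal.toReal_le_of_le_ofReal V.2 ?_
    refine (lintegral_congr fun ξ => ?_).trans_le (huV.trans_eq (by simp))
    rw [Real.enorm_eq_ofReal_abs, ← ENNReal.ofReal_pow (abs_nonneg _), sq_abs]
  -- Uniform integrability by hand: |h − q_n| is at most its truncation at c plus (2h² + 2q_n²)/c.
  -- The truncated part tends to 0 by dominated convergence, the rest integrates to at most 4V/c,
  -- and c is sent to infinity afterwards.
  have hbound : ∀ c : ℝ, 0 < c → |∫ ξ, h 0 ξ ∂D| ≤ 4 * V / c := by
    intro c hc
    have hmin : Tendsto (fun n => ∫ ξ, min |h 0 ξ - q n ξ| c ∂D) atTop (𝓝 (∫ _, (0 : ℝ) ∂D)) := by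
      refine tendsto_integral_of_dominated_convergence (fun _ => c)
        (fun n => ?_) (integrable_const c) (fun n => .of_forall fun ξ => ?_)
        (.of_forall fun ξ => ?_)
      · exact (((hmt 0).aestronglyMeasurable.sub (hqint n).aestronglyMeasurable).norm.inf
          aestronglyMeasurable_const)
      · rw [Real.norm_of_nonneg (le_min (abs_nonneg _) hc.le)]
        exact min_le_right _ _
      · have h1 : Tendsto (fun n => |h 0 ξ - q n ξ|) atTop (𝓝 0) := by
          simpa using ((hlim ξ).const_sub (h 0 ξ)).abs
        simpa [hc.le] using h1.min (tendsto_const_nhds (x := c))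
    rw [integral_zero] at hmin
    have hle : ∀ n, |∫ ξ, h 0 ξ ∂D| ≤ ∫ ξ, min |h 0 ξ - q n ξ| c ∂D + 4 * V / c := by
      intro n
      have he2 : MemLp (fun ξ => h 0 ξ - q n ξ) 2 D := hh2.sub (hq2 n)
      have hI1 : Integrable (fun ξ => min |h 0 ξ - q n ξ| c) D := by
        refine (he2.integrable one_le_two).abs.mono'
          (((hmt 0).aestronglyMeasurable.sub (hqint n).aestronglyMeasurable).norm.inf
          aestronglyMeasurable_const) (.of_forall fun ξ => ?_)
        rw [Real.norm_of_nonneg (le_min (abs_nonneg _) hc.le)]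
        exact min_le_left _ _
      have hI2 : Integrable (fun ξ => (2 * h 0 ξ ^ 2 + 2 * q n ξ ^ 2) / c) D :=
        ((hh2.integrable_sq.const_mul 2).add ((hq2 n).integrable_sq.const_mul 2)).div_const c
      have h1 : ∫ ξ, h 0 ξ ∂D = ∫ ξ, (h 0 ξ - q n ξ) ∂D := by
        rw [integral_sub (hh2.integrable one_le_two) (hqint n), hq0, sub_zero]
      rw [h1]
      calc |∫ ξ, (h 0 ξ - q n ξ) ∂D| ≤ ∫ ξ, |h 0 ξ - q n ξ| ∂D := abs_integral_le_integral_abs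
        _ ≤ ∫ ξ, (min |h 0 ξ - q n ξ| c + (2 * h 0 ξ ^ 2 + 2 * q n ξ ^ 2) / c) ∂D := by
          refine integral_mono (he2.integrable one_le_two).abs
            (hI1.add hI2) fun ξ => ?_
          rcases le_total |h 0 ξ - q n ξ| c with hle | hle
          · simp only [min_eq_left hle]
            have : 0 ≤ (2 * h 0 ξ ^ 2 + 2 * q n ξ ^ 2) / c := by positivity
            linarith
          · simp only [min_eq_right hle]
            have : |h 0 ξ - q n ξ| ≤ (2 * h 0 ξ ^ 2 + 2 * q n ξ ^ 2) / c := by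
              rw [le_div_iff₀ hc]
              have h3 := mul_le_mul_of_nonneg_left hle (abs_nonneg (h 0 ξ - q n ξ))
              have h4 := sq_abs (h 0 ξ - q n ξ)
              nlinarith [sq_nonneg (h 0 ξ + q n ξ)]
            linarith
        _ = ∫ ξ, min |h 0 ξ - q n ξ| c ∂D
            + (2 * ∫ ξ, h 0 ξ ^ 2 ∂D + 2 * ∫ ξ, q n ξ ^ 2 ∂D) / c := by
          rw [integral_add hI1 hI2, integral_div,
            integral_add (hh2.integrable_sq.const_mul 2) ((hq2 n).integrable_sq.const_mul 2),
            integral_const_mul, integral_const_mul]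
        _ ≤ _ := by
          have h5 := hreal _ hh2 (hV 0)
          have h6 := hreal _ (hq2 n) (hqV n)
          gcongr
          linarith
    have := ge_of_tendsto' (hmin.add_const (4 * (V : ℝ) / c)) hle
    simpa using this
  have h2 : Tendsto (fun c : ℝ => 4 * (V : ℝ) / c) atTop (𝓝 0) :=
    tendsto_const_nhds.div_atTop tendsto_id
  have h3 := ge_of_tendsto h2 ((eventually_gt_atTop 0).mono hbound)
  exact abs_eq_zero.1 (le_antisymm h3 (abs_nonneg _))

/-- Stochastic gradients are unbiased. -/
theorem Problem.Admissible.integral_stochGrad_sub {N d : ℕ} {p : Problem N d Ξ} {x₀ : Vec d}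
    {Δ L σ : ℝ} (h : p.Admissible x₀ Δ L σ) (i : Fin N) (x : Vec d) :
    Integrable (fun ξ => p.stochGrad i x ξ - gradient (p.localObj i) x) (p.D i) ∧
      ∫ ξ, (p.stochGrad i x ξ - gradient (p.localObj i) x) ∂(p.D i) = 0 := by
  have := h.prob i
  have hmg : Measurable (fun z : Vec d × Ξ =>
      p.stochGrad i z.1 z.2 - gradient (p.localObj i) z.1) := by
    exact (h.measurable_stochGrad i).sub
      ((continuous_of_norm_sub_le (h.smooth i)).measurable.comp measurable_fst)
  have hint : ∀ x, Integrable (fun ξ => p.stochGrad i x ξ - gradient (p.localObj i) x) (p.D i) := by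
    intro x
    have : MemLp (fun ξ => p.stochGrad i x ξ - gradient (p.localObj i) x) 2 (p.D i) := by
      refine ⟨(hmg.comp measurable_prodMk_left).aestronglyMeasurable, ?_⟩
      rw [eLpNorm_lt_top_iff_lintegral_rpow_enorm_lt_top two_ne_zero ENNReal.ofNat_ne_top]
      simpa using (h.variance_le i x).trans_lt ENNReal.ofReal_lt_top
    exact this.integrable one_le_two
  refine ⟨hint x, ?_⟩
  refine ext_inner_left ℝ fun v => ?_
  rw [inner_zero_right, ← integral_inner (hint x)]
  -- Tested against a direction v, the claim concerns the loss minus its mean along the line x + t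
  -- v, which is centred by definition of `localObj`. The bound `V` is Cauchy–Schwarz applied to the
  -- variance assumption.
  have key := integral_deriv_eq_zero (D := p.D i)
    (H := fun t ξ => p.F i (x + t • v) ξ - p.localObj i (x + t • v))
    (h := fun t ξ => ⟪v, p.stochGrad i (x + t • v) ξ - gradient (p.localObj i) (x + t • v)⟫)
    (V := ‖v‖₊ ^ 2 * (σ ^ 2).toNNReal) ?_ ?_ ?_ ?_ ?_
  · simpa using key
  · intro ξ t
    have h1 : HasDerivAt (fun t : ℝ => x + t • v) v t := by
      simpa using ((hasDerivAt_id t).smul_const v).const_add x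
    have h2 := (h.differentiable_loss i ξ (x + t • v)).hasFDerivAt.comp_hasDerivAt t h1
    have h3 := (h.differentiable_localObj i (x + t • v)).hasFDerivAt.comp_hasDerivAt t h1
    rw [← inner_gradient_left] at h2 h3
    have h4 := h2.sub h3
    rw [← inner_sub_left, real_inner_comm] at h4
    exact h4
  · have h1 : Measurable (fun z : ℝ × Ξ => (x + z.1 • v, z.2)) := by fun_prop
    have h2 : Measurable (fun z : ℝ × Ξ => p.stochGrad i (x + z.1 • v) z.2
        - gradient (p.localObj i) (x + z.1 • v)) :=
      hmg.comp (g := fun z : Vec d × Ξ => p.stochGrad i z.1 z.2 - gradient (p.localObj i) z.1)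
        (f := fun z : ℝ × Ξ => (x + z.1 • v, z.2)) h1
    exact h2.const_inner
  · intro t
    exact (h.integrable_loss i _).sub (integrable_const _)
  · intro t
    rw [integral_sub (h.integrable_loss i _) (integrable_const _)]
    simp [Problem.localObj]
  · intro t
    calc _ ≤ ∫⁻ ξ, ‖v‖ₑ ^ 2 *
          ‖p.stochGrad i (x + t • v) ξ - gradient (p.localObj i) (x + t • v)‖ₑ ^ 2 ∂(p.D i) := by
          refine lintegral_mono fun ξ => ?_
          dsimp only
          rw [← mul_pow]
          gcongr
          rw [← ofReal_norm, ← ofReal_norm, ← ofReal_norm, ← ENNReal.ofReal_mul (norm_nonneg _)]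
          exact ENNReal.ofReal_le_ofReal (norm_inner_le_norm _ _)
      _ = ‖v‖ₑ ^ 2 * ∫⁻ ξ,
          ‖p.stochGrad i (x + t • v) ξ - gradient (p.localObj i) (x + t • v)‖ₑ ^ 2 ∂(p.D i) :=
          lintegral_const_mul' _ _ (by simp)
      _ ≤ ‖v‖ₑ ^ 2 * ENNReal.ofReal (σ ^ 2) := by
          gcongr; exact h.variance_le i _
      _ = _ := by
          rw [ENNReal.coe_mul, ENNReal.coe_pow]; rfl

end Unbiased

/-! ### Fresh samples -/

section Fresh

variable {Ω Ξ : Type*} [MeasurableSpace Ξ] {𝓖 mΩ : MeasurableSpace Ω} {d : ℕ}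

/-- Independence of the sample from 𝓖 turns the joint law into a product. Conditioning on the past
thus becomes Fubini: the past is frozen while the sample is integrated. -/
theorem map_prodMk_eq_prod {β : Type*} [MeasurableSpace β] {μ : Measure Ω}
    [IsProbabilityMeasure μ] (h𝓖 : 𝓖 ≤ mΩ) {ξ : Ω → Ξ}
    (hξ : Measurable ξ) (hind : Indep 𝓖 (MeasurableSpace.comap ξ inferInstance) μ)
    {y : Ω → β} (hy : Measurable[𝓖] y) :
    μ.map (fun ω => (y ω, ξ ω)) = (μ.map y).prod (μ.map ξ) := by
  have hi : IndepFun y ξ μ := by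
    rw [IndepFun_iff_Indep]
    exact indep_of_indep_of_le_left hind hy.comap_le
  exact (indepFun_iff_map_prod_eq_prod_map_map (hy.mono h𝓖 le_rfl).aemeasurable
    hξ.aemeasurable).1 hi

/-- The noise of a fresh sample at a point determined by the past has conditional second moment at
most `V`. -/
theorem lintegral_fresh_le {μ : Measure Ω} [IsProbabilityMeasure μ]
    (h𝓖 : 𝓖 ≤ mΩ) {ξ : Ω → Ξ}
    (hξ : Measurable ξ) (hind : Indep 𝓖 (MeasurableSpace.comap ξ inferInstance) μ)
    {g : Vec d → Ξ → Vec d} (hg : Measurable (fun z : Vec d × Ξ => g z.1 z.2)) {V : ℝ≥0∞}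
    (hV : ∀ x, ∫⁻ z, ‖g x z‖ₑ ^ 2 ∂(μ.map ξ) ≤ V)
    {y : Ω → Vec d} (hy : Measurable[𝓖] y) {c : Ω → ℝ} (hc : Measurable[𝓖] c) :
    ∫⁻ ω, ‖c ω • g (y ω) (ξ ω)‖ₑ ^ 2 ∂μ ≤ V * ∫⁻ ω, ‖c ω‖ₑ ^ 2 ∂μ := by
  have hmap := map_prodMk_eq_prod h𝓖 hξ hind (hc.prodMk hy)
  have := Measure.isProbabilityMeasure_map (μ := μ) hξ.aemeasurable
  have hF : Measurable (fun z : (ℝ × Vec d) × Ξ => ‖z.1.1 • g z.1.2 z.2‖ₑ ^ 2) := by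
    have : Measurable (fun z : (ℝ × Vec d) × Ξ => g z.1.2 z.2) :=
      hg.comp (g := fun z : Vec d × Ξ => g z.1 z.2) (f := fun z : (ℝ × Vec d) × Ξ => (z.1.2, z.2))
        (by fun_prop)
    exact ((measurable_fst.comp measurable_fst).smul this).enorm.pow_const 2
  have hcy : Measurable (fun ω => (c ω, y ω)) :=
    (hc.mono h𝓖 le_rfl).prodMk (hy.mono h𝓖 le_rfl)
  calc ∫⁻ ω, ‖c ω • g (y ω) (ξ ω)‖ₑ ^ 2 ∂μ
      = ∫⁻ z, ‖z.1.1 • g z.1.2 z.2‖ₑ ^ 2 ∂(μ.map (fun ω => ((c ω, y ω), ξ ω))) :=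
        (lintegral_map hF (hcy.prodMk hξ)).symm
    _ = ∫⁻ w, ∫⁻ z, ‖w.1 • g w.2 z‖ₑ ^ 2 ∂(μ.map ξ) ∂(μ.map (fun ω => (c ω, y ω))) := by
        rw [hmap, lintegral_prod _ hF.aemeasurable]
    _ = ∫⁻ ω, ∫⁻ z, ‖c ω • g (y ω) z‖ₑ ^ 2 ∂(μ.map ξ) ∂μ :=
        lintegral_map hF.lintegral_prod_right' hcy
    _ ≤ ∫⁻ ω, V * ‖c ω‖ₑ ^ 2 ∂μ := by
        refine lintegral_mono fun ω => ?_
        simp only [enorm_smul, mul_pow]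
        rw [lintegral_const_mul' _ _ (by simp), mul_comm]
        gcongr
        exact hV _
    _ = V * ∫⁻ ω, ‖c ω‖ₑ ^ 2 ∂μ :=
        lintegral_const_mul _ ((hc.mono h𝓖 le_rfl).enorm.pow_const 2)

/-- The noise of a fresh sample is orthogonal to the past. -/
theorem integral_inner_fresh_eq_zero {μ : Measure Ω} [IsProbabilityMeasure μ]
    (h𝓖 : 𝓖 ≤ mΩ) {ξ : Ω → Ξ}
    (hξ : Measurable ξ) (hind : Indep 𝓖 (MeasurableSpace.comap ξ inferInstance) μ)
    {g : Vec d → Ξ → Vec d} (hg : Measurable (fun z : Vec d × Ξ => g z.1 z.2))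
    (hint : ∀ x, Integrable (g x) (μ.map ξ)) (hg0 : ∀ x, ∫ z, g x z ∂(μ.map ξ) = 0)
    {y : Ω → Vec d} (hy : Measurable[𝓖] y) {b : Ω → Vec d} (hb : Measurable[𝓖] b)
    (hb2 : MemLp b 2 μ) (hn2 : MemLp (fun ω => g (y ω) (ξ ω)) 2 μ) :
    ∫ ω, ⟪b ω, g (y ω) (ξ ω)⟫ ∂μ = 0 := by
  have hmap := map_prodMk_eq_prod h𝓖 hξ hind (hb.prodMk hy)
  have := Measure.isProbabilityMeasure_map (μ := μ) hξ.aemeasurable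
  have hby : Measurable (fun ω => (b ω, y ω)) :=
    (hb.mono h𝓖 le_rfl).prodMk (hy.mono h𝓖 le_rfl)
  have hF : Measurable (fun z : (Vec d × Vec d) × Ξ => ⟪z.1.1, g z.1.2 z.2⟫) := by
    have : Measurable (fun z : (Vec d × Vec d) × Ξ => g z.1.2 z.2) :=
      hg.comp (g := fun z : Vec d × Ξ => g z.1 z.2)
        (f := fun z : (Vec d × Vec d) × Ξ => (z.1.2, z.2)) (by fun_prop)
    exact (measurable_fst.comp measurable_fst).inner this
  have hI : Integrable (fun z : (Vec d × Vec d) × Ξ => ⟪z.1.1, g z.1.2 z.2⟫)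
      (μ.map (fun ω => ((b ω, y ω), ξ ω))) := by
    rw [integrable_map_measure hF.aestronglyMeasurable (hby.prodMk hξ).aemeasurable]
    exact integrable_inner_of_memLp hb2 hn2
  have h1 : ∫ ω, ⟪b ω, g (y ω) (ξ ω)⟫ ∂μ
      = ∫ z, ⟪z.1.1, g z.1.2 z.2⟫ ∂(μ.map (fun ω => ((b ω, y ω), ξ ω))) :=
    (integral_map (hby.prodMk hξ).aemeasurable hF.aestronglyMeasurable).symm
  rw [hmap] at hI
  rw [h1, hmap, integral_prod _ hI]
  have h2 : ∀ w : Vec d × Vec d, ∫ z, ⟪w.1, g w.2 z⟫ ∂(μ.map ξ) = 0 := by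
    intro w
    rw [integral_inner (hint w.2), hg0, inner_zero_right]
  simp [h2]

end Fresh

/-! ### Cyclic participation -/

theorem integral_mul_of_indep {Ω : Type*} {m₁ m₂ mΩ : MeasurableSpace Ω} {μ : Measure Ω}
    (h₁ : m₁ ≤ mΩ) (h₂ : m₂ ≤ mΩ) (h : Indep m₁ m₂ μ) {f g : Ω → ℝ}
    (hf : Measurable[m₁] f) (hg : Measurable[m₂] g) :
    ∫ ω, f ω * g ω ∂μ = (∫ ω, f ω ∂μ) * ∫ ω, g ω ∂μ := by
  have hi : IndepFun f g μ := by
    rw [IndepFun_iff_Indep]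
    exact indep_of_indep_of_le_left (indep_of_indep_of_le_right h hg.comap_le) hf.comap_le
  exact hi.integral_fun_mul_eq_mul_integral (hf.mono h₁ le_rfl).aestronglyMeasurable
    (hg.mono h₂ le_rfl).aestronglyMeasurable

section Cyclic

variable {N K S R : ℕ} {group : Fin N → Fin K}

theorem IsEqualPartition.card_available_mul (hg : IsEqualPartition group) (hK : 0 < K) (r : ℕ) :
    (available group r).card * K = N := by
  have h := hg ⟨r % K, Nat.mod_lt _ hK⟩
  simpa only [available, Fin.ext_iff] using h

theorem IsEqualPartition.le_card_available (hg : IsEqualPartition group) (hK : 0 < K)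
    (hS : S * K ≤ N) (r : ℕ) : S ≤ (available group r).card :=
  Nat.le_of_mul_le_mul_right (hS.trans_eq (hg.card_available_mul hK r).symm) hK

theorem mem_available_iff {i : Fin N} {m s : ℕ} (hs : s < K) :
    i ∈ available group (m * K + s) ↔ (group i : ℕ) = s := by
  simp [available, Nat.mod_eq_of_lt hs]

theorem mem_available_self (i : Fin N) (m : ℕ) :
    i ∈ available group (m * K + group i) :=
  (mem_available_iff (group i).2).2 rfl

theorem round_lt {m s : ℕ} (hm : m < R / K) (hs : s < K) : m * K + s < R := by
  have h1 : (m + 1) * K ≤ R := (Nat.mul_le_mul_right K hm).trans (Nat.div_mul_le_self R K)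
  rw [add_mul, one_mul] at h1
  omega

/-- `1` if client `i` is sampled in the `m`-th window, else `0`. -/
def sampled {Ω : Type*} (group : Fin N → Fin K) (A : ℕ → Ω → Finset (Fin N)) (m : ℕ) (i : Fin N)
    (ω : Ω) : ℝ :=
  if i ∈ A (m * K + group i) ω then 1 else 0

/-! ### Pathwise form of the participation quantities. -/

section Support

variable {Ω : Type*} {A : ℕ → Ω → Finset (Fin N)} {ω : Ω}

theorem sampled_nonneg (m : ℕ) (i : Fin N) : 0 ≤ sampled group A m i ω := by
  unfold sampled; split_ifs <;> norm_num

theorem sampled_sq (m : ℕ) (i : Fin N) : sampled group A m i ω ^ 2 = sampled group A m i ω := by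
  unfold sampled; split_ifs <;> norm_num

theorem sampled_le_one (m : ℕ) (i : Fin N) : sampled group A m i ω ≤ 1 := by
  unfold sampled; split_ifs <;> norm_num

/-- Within a window, a client can only be drawn in the round whose index is its group, so its
weights are determined by one indicator. The remaining pathwise formulas all follow from this. -/
theorem weight_eq_sampled (hA : ∀ r < R, A r ω ∈ (available group r).powersetCard S) {m s : ℕ}
    (hm : m < R / K) (hs : s < K) (i : Fin N) :
    weight S (A (m * K + s) ω) i =
      if (group i : ℕ) = s then sampled group A m i ω / S else 0 := by
  unfold weight sampled
  by_cases hi : (group i : ℕ) = s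
  · subst hi
    simp only [if_true]
    split_ifs <;> simp
  · rw [if_neg hi, if_neg]
    intro hmem
    exact hi ((mem_available_iff hs).1
      ((Finset.mem_powersetCard.1 (hA _ (round_lt hm hs))).1 hmem))

theorem qBar_eq_sampled (hA : ∀ r < R, A r ω ∈ (available group r).powersetCard S) {m : ℕ}
    (hm : m < R / K) (i : Fin N) :
    qBar (fun r => weight S (A r ω)) K m i = sampled group A m i ω / (S * K) := by
  unfold qBar
  rw [Finset.sum_congr rfl fun s hs => weight_eq_sampled hA hm (Finset.mem_range.1 hs) i,
    Finset.sum_ite_eq, if_pos (Finset.mem_range.2 (group i).2)]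
  ring

/-- The set drawn in round `a` of the window has S elements, all of them in group `a`. -/
theorem sum_sampled_group (hA : ∀ r < R, A r ω ∈ (available group r).powersetCard S) {m : ℕ}
    (hm : m < R / K) (a : Fin K) :
    ∑ j, (if group j = a then sampled group A m j ω else 0) = S := by
  have h1 := Finset.mem_powersetCard.1 (hA _ (round_lt hm a.2))
  have h2 : ∀ j, (if group j = a then sampled group A m j ω else 0) =
      if j ∈ A (m * K + a) ω then 1 else 0 := by
    intro j
    by_cases hj : group j = a
    · simp [hj, sampled]
    · rw [if_neg hj, if_neg]
      exact fun hmem => hj (Fin.ext ((mem_available_iff a.2).1 (h1.1 hmem)))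
  simp only [h2]
  rw [Finset.sum_ite_mem, Finset.univ_inter, ← h1.2]
  simp

/-- Only clients `j` of the group of `i` share a round with `i`. For a sampled `j` the prefactor
equals S and cancels the weight of `j`; there are S such clients, which cancels the weight 1/S of
`i`. -/
theorem wCoef_eq_sampled (hS : 0 < S) (hK : 0 < K)
    (hA : ∀ r < R, A r ω ∈ (available group r).powersetCard S) {m : ℕ}
    (hm : m < R / K) (i : Fin N) :
    wCoef (fun r => weight S (A r ω)) K m i = sampled group A m i ω / N := by
  have hS' : (0 : ℝ) < S := by exact_mod_cast hS
  have hK' : (0 : ℝ) < K := by exact_mod_cast hK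
  unfold wCoef
  have h1 : ∀ j, (if 0 < qBar (fun r => weight S (A r ω)) K m j
      then 1 / ((K : ℝ) * qBar (fun r => weight S (A r ω)) K m j) else 0) *
      ∑ s ∈ Finset.range K, weight S (A (m * K + s) ω) i * weight S (A (m * K + s) ω) j
      = sampled group A m i ω / S * if group j = group i then sampled group A m j ω else 0 := by
    intro j
    have h2 : ∑ s ∈ Finset.range K, weight S (A (m * K + s) ω) i * weight S (A (m * K + s) ω) j
        = if group j = group i
          then sampled group A m i ω / S * (sampled group A m j ω / S) else 0 := by
      rw [Finset.sum_congr rfl fun s hs => by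
        rw [weight_eq_sampled hA hm (Finset.mem_range.1 hs) i,
          weight_eq_sampled hA hm (Finset.mem_range.1 hs) j, ite_mul, zero_mul]]
      rw [Finset.sum_ite_eq, if_pos (Finset.mem_range.2 (group i).2), mul_ite, mul_zero]
      simp only [Fin.ext_iff]
    rw [h2, qBar_eq_sampled hA hm j]
    by_cases hj : j ∈ A (m * K + group j) ω
    · have h3 : sampled group A m j ω = 1 := if_pos hj
      rw [h3, if_pos (by positivity)]
      split_ifs
      · field_simp
      · simp
    · have h3 : sampled group A m j ω = 0 := if_neg hj
      simp [h3]
  rw [Finset.sum_congr rfl fun j _ => h1 j, ← Finset.mul_sum, sum_sampled_group hA hm]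
  field_simp

/-- Every participation of a client has the same profile, 1/S in the round of its group, and `zInit`
has it too. It is thus irrelevant which window was the last. -/
theorem zWindow_eq (hS : 0 < S) (hA : ∀ r < R, A r ω ∈ (available group r).powersetCard S) {m : ℕ}
    (hm : m ≤ R / K) (i : Fin N) {s : ℕ} (hs : s < K) :
    zWindow (fun r => weight S (A r ω)) K (zInit group S) m i s =
      if (group i : ℕ) = s then 1 / (S : ℝ) else 0 := by
  have hS' : (0 : ℝ) < S := by exact_mod_cast hS
  induction m with
  | zero => rfl
  | succ m ih =>
    rw [zWindow]
    by_cases h : 0 < qBar (fun r => weight S (A r ω)) K m i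
    · rw [if_pos h, weight_eq_sampled hA hm hs]
      rw [qBar_eq_sampled hA hm] at h
      have h1 : sampled group A m i ω = 1 := by
        by_cases hi : i ∈ A (m * K + group i) ω
        · exact if_pos hi
        · have h3 : sampled group A m i ω = 0 := if_neg hi
          simp [h3] at h
      rw [h1]
    · rw [if_neg h]
      exact ih (Nat.le_of_succ_le hm)

/-- A profile with a single nonzero entry among K has mean square equal to K times its squared mean.
-/
theorem lamCoef_eq (hS : 0 < S) (hK : 0 < K)
    (hA : ∀ r < R, A r ω ∈ (available group r).powersetCard S) {m : ℕ}
    (hm : m ≤ R / K) (i : Fin N) :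
    lamCoef (fun r => weight S (A r ω)) K (zInit group S) m i = K := by
  have hS' : (0 : ℝ) < S := by exact_mod_cast hS
  have hK' : (0 : ℝ) < K := by exact_mod_cast hK
  unfold lamCoef
  rw [Finset.sum_congr rfl fun s hs => by
      rw [zWindow_eq hS hA hm i (Finset.mem_range.1 hs), ite_pow, zero_pow two_ne_zero],
    Finset.sum_congr rfl fun s hs => zWindow_eq hS hA hm i (Finset.mem_range.1 hs),
    Finset.sum_ite_eq, Finset.sum_ite_eq, if_pos (Finset.mem_range.2 (group i).2),
    if_pos (Finset.mem_range.2 (group i).2)]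
  field_simp

/-- The target σ-algebra is left free: it is used with the ambient one, with that of the single
draw, and with those generated by sets of draws. -/
theorem measurable_sampled_of_comap_le {mΩ : MeasurableSpace Ω} (m : ℕ) (i : Fin N)
    (h : MeasurableSpace.comap (A (m * K + group i)) ⊤ ≤ mΩ) :
    Measurable (sampled group A m i) := by
  refine Measurable.ite (h _ ⟨{T | i ∈ T}, trivial, rfl⟩) measurable_const measurable_const

end Support

/-! ### Probabilities and moments of the draws. -/

variable {Ω : Type*} [MeasurableSpace Ω] {μ : Measure Ω}
  {A : ℕ → Ω → Finset (Fin N)}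

theorem IsCyclic.comap_le (h : IsCyclic μ group S R A) {r : ℕ} (hr : r < R) :
    MeasurableSpace.comap (A r) ⊤ ≤ ‹MeasurableSpace Ω› := by
  rintro _ ⟨𝒯, -, rfl⟩
  rw [← Set.biUnion_of_singleton 𝒯, Set.preimage_iUnion₂]
  exact MeasurableSet.biUnion (Set.to_countable 𝒯) fun T _ => h.measurable r hr T

theorem IsCyclic.real_mem [IsProbabilityMeasure μ] (h : IsCyclic μ group S R A) {r : ℕ} (hr : r < R)
    {𝒯 : Finset (Finset (Fin N))} (h𝒯 : 𝒯 ⊆ (available group r).powersetCard S) :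
    μ.real {ω | A r ω ∈ 𝒯} = 𝒯.card / ((available group r).powersetCard S).card := by
  have h1 : {ω | A r ω ∈ 𝒯} = ⋃ T ∈ 𝒯, A r ⁻¹' {T} := by ext ω; simp
  rw [h1, measureReal_biUnion_finset ?_ fun T _ => h.measurable r hr T]
  · rw [Finset.sum_congr rfl fun T hT => h.law r hr T (h𝒯 hT)]
    simp [div_eq_mul_inv]
  · intro T _ T' _ hne
    exact Disjoint.preimage _ (by simpa using hne)

theorem IsCyclic.measurable_sampled (h : IsCyclic μ group S R A) {m : ℕ} (hm : m < R / K)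
    (i : Fin N) : Measurable (sampled group A m i) :=
  measurable_sampled_of_comap_le m i (h.comap_le (round_lt hm (group i).2))

theorem IsCyclic.indep_pastQ (h : IsCyclic μ group S R A) {m : ℕ} (hm : m < R / K) (a : Fin K) :
    Indep (MeasurableSpace.comap (A (m * K + a)) ⊤)
      (pastQ (fun ω r => weight S (A r ω)) (m * K)) μ := by
  have hr := round_lt hm a.2
  have h1 := indep_iSup_of_disjoint (m := fun r : Fin R => MeasurableSpace.comap (A r) ⊤)
    (fun r => h.comap_le r.2) h.indep
    (S := {⟨m * K + a, hr⟩}) (T := {r | (r : ℕ) < m * K})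
    (Set.disjoint_singleton_left.2 (by simp))
  rw [iSup_singleton] at h1
  refine indep_of_indep_of_le_right h1 (iSup_le fun s => ?_)
  have hs : (s : ℕ) < R := by omega
  refine le_trans ?_ (le_iSup₂_of_le (⟨s, hs⟩ : Fin R) s.2 le_rfl)
  rintro _ ⟨B, -, rfl⟩
  exact ⟨{T | weight S T ∈ B}, trivial, rfl⟩

theorem IsCyclic.pastQ_le (h : IsCyclic μ group S R A) {m : ℕ} (hm : m < R / K) :
    pastQ (fun ω r => weight S (A r ω)) (m * K) ≤ ‹MeasurableSpace Ω› := by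
  refine iSup_le fun s => ?_
  have h1 : m * K ≤ R := (Nat.mul_le_mul_right K hm.le).trans (Nat.div_mul_le_self R K)
  refine le_trans ?_ (h.comap_le (s.2.trans_le h1))
  rintro _ ⟨B, -, rfl⟩
  exact ⟨{T | weight S T ∈ B}, trivial, rfl⟩

variable [IsProbabilityMeasure μ]

/-- The prescribed probabilities of the S-subsets of the available group add up to 1, so no other
set is drawn. There is at least one such subset because S ≤ N/K. -/
theorem IsCyclic.ae_mem (h : IsCyclic μ group S R A) (hg : IsEqualPartition group) (hK : 0 < K)
    (hS : S * K ≤ N) : ∀ᵐ ω ∂μ, ∀ r < R, A r ω ∈ (available group r).powersetCard S := by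
  rw [ae_all_iff]
  intro r
  by_cases hr : r < R
  · have h1 := h.real_mem hr subset_rfl
    have h2 : (((available group r).powersetCard S).card : ℝ) ≠ 0 := by
      rw [Finset.card_powersetCard]
      exact_mod_cast (Nat.choose_pos (hg.le_card_available hK hS r)).ne'
    rw [div_self h2] at h1
    have hms : MeasurableSet {ω | A r ω ∈ (available group r).powersetCard S} :=
      h.comap_le hr _ ⟨{T | T ∈ (available group r).powersetCard S}, trivial, rfl⟩
    have h3 : μ {ω | A r ω ∈ (available group r).powersetCard S} = 1 := by
      rw [measureReal_def] at h1
      rwa [← ENNReal.toReal_eq_one_iff]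
    filter_upwards [(mem_ae_iff_prob_eq_one hms).2 h3] with ω hω _ using hω
  · exact .of_forall fun ω h' => absurd h' hr

/-- Under the uniform law this is a count: an S-set containing `U` is `U` together with S − |U| of
the remaining available clients. It is applied to one and to two clients. -/
theorem IsCyclic.real_subset (h : IsCyclic μ group S R A) (hg : IsEqualPartition group)
    (hK : 0 < K) (hS : S * K ≤ N) {r : ℕ} (hr : r < R) {U : Finset (Fin N)}
    (hU : U ⊆ available group r) (hUS : U.card ≤ S) :
    μ.real {ω | U ⊆ A r ω} = (((available group r).card - U.card).choose (S - U.card) : ℕ) /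
      (((available group r).card).choose S : ℕ) := by
  have h1 : {ω | U ⊆ A r ω} =ᵐ[μ]
      {ω | A r ω ∈ ((available group r).powersetCard S).filter (U ⊆ ·)} := by
    filter_upwards [h.ae_mem hg hK hS] with ω hω
    refine propext ?_
    change U ⊆ A r ω ↔ A r ω ∈ Finset.filter (U ⊆ ·) _
    rw [Finset.mem_filter]
    exact ⟨fun hs => ⟨hω r hr, hs⟩, fun hs => hs.2⟩
  rw [measureReal_congr h1, h.real_mem hr (Finset.filter_subset _ _),
    Finset.card_filter_powersetCard_subset _ _ _ hU hUS, Finset.card_powersetCard]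

theorem IsCyclic.integral_sampled (h : IsCyclic μ group S R A) (hg : IsEqualPartition group)
    (hK : 0 < K) (hS0 : 0 < S) (hS : S * K ≤ N) {m : ℕ} (hm : m < R / K) (i : Fin N) :
    ∫ ω, sampled group A m i ω ∂μ = S * K / N := by
  have hr := round_lt hm (group i).2
  have h1 : sampled group A m i = Set.indicator {ω | {i} ⊆ A (m * K + group i) ω} 1 := by
    ext ω; simp [sampled, Set.indicator]
  have hms : MeasurableSet {ω | {i} ⊆ A (m * K + group i) ω} :=
    h.comap_le hr _ ⟨{T | {i} ⊆ T}, trivial, rfl⟩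
  rw [h1, integral_indicator_one hms, h.real_subset hg hK hS hr
    (Finset.singleton_subset_iff.2 (mem_available_self i m)) (by simpa using Nat.succ_le_of_lt hS0),
    Finset.card_singleton]
  have h2 := hg.card_available_mul hK (m * K + group i)
  have h3 := hg.le_card_available hK hS (m * K + group i)
  set n := (available group (m * K + group i)).card
  -- The absorption identity n·C(n−1, S−1) = S·C(n, S) turns the quotient of binomials into S/n, and
  -- n = N/K.
  have h4 := Nat.add_one_mul_choose_eq (n - 1) (S - 1)
  rw [Nat.sub_add_cancel (hS0.trans_le h3), Nat.sub_add_cancel hS0] at h4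
  have h5 : (0 : ℝ) < n.choose S := by exact_mod_cast Nat.choose_pos h3
  have hN : (0 : ℝ) < N := by exact_mod_cast (Nat.mul_pos hS0 hK).trans_le hS
  have h2' : (n : ℝ) * K = N := by exact_mod_cast h2
  have h4' : (n : ℝ) * (n - 1).choose (S - 1) = n.choose S * S := by exact_mod_cast h4
  rw [div_eq_div_iff h5.ne' hN.ne', ← h2']
  linear_combination (K : ℝ) * h4'

theorem IsCyclic.integral_sampled_mul_of_ne (h : IsCyclic μ group S R A)
    (hg : IsEqualPartition group)
    (hK : 0 < K) (hS0 : 0 < S) (hS : S * K ≤ N) {m : ℕ} (hm : m < R / K) {i j : Fin N}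
    (hij : group i ≠ group j) :
    ∫ ω, sampled group A m i ω * sampled group A m j ω ∂μ = ((S * K : ℝ) / N) ^ 2 := by
  have hr := round_lt hm (group i).2
  have hr' := round_lt hm (group j).2
  have hne : (⟨_, hr⟩ : Fin R) ≠ ⟨_, hr'⟩ := by
    intro he
    exact hij (Fin.ext (Nat.add_left_cancel (Fin.mk.inj_iff.1 he)))
  rw [integral_mul_of_indep (h.comap_le hr) (h.comap_le hr') (h.indep.indep hne)
    (measurable_sampled_of_comap_le m i le_rfl) (measurable_sampled_of_comap_le m j le_rfl),
    h.integral_sampled hg hK hS0 hS hm, h.integral_sampled hg hK hS0 hS hm, sq]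

/-- Two clients of the same group are sampled together with the probability for draws without
replacement. -/
theorem IsCyclic.integral_sampled_mul (h : IsCyclic μ group S R A)
    (hg : IsEqualPartition group)
    (hK : 0 < K) (hS0 : 0 < S) (hS : S * K ≤ N) {m : ℕ} (hm : m < R / K) {i j : Fin N}
    (hij : i ≠ j) (hgij : group i = group j) :
    ∫ ω, sampled group A m i ω * sampled group A m j ω ∂μ =
      (S * K : ℝ) / N * ((S - 1) / (N / K - 1)) := by
  have hr := round_lt hm (group i).2
  have h1 : (fun ω => sampled group A m i ω * sampled group A m j ω) =
      Set.indicator {ω | {i, j} ⊆ A (m * K + group i) ω} 1 := by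
    ext ω
    simp only [sampled, Set.indicator, Finset.insert_subset_iff, Finset.singleton_subset_iff,
      ← hgij, Pi.one_apply]
    by_cases hi : i ∈ A (m * K + group i) ω <;> by_cases hj : j ∈ A (m * K + group i) ω <;>
      simp [hi, hj]
  have hms : MeasurableSet {ω | {i, j} ⊆ A (m * K + group i) ω} :=
    h.comap_le hr _ ⟨{T | {i, j} ⊆ T}, trivial, rfl⟩
  rw [h1, integral_indicator_one hms]
  -- For S = 1 two clients are never drawn together, in agreement with the factor S − 1. For S ≥ 2
  -- the absorption identity is used twice.
  rcases Nat.lt_or_ge S 2 with hS2 | hS2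
  · have h2 : μ.real {ω | {i, j} ⊆ A (m * K + group i) ω} = 0 := by
      rw [measureReal_def]
      refine (ENNReal.toReal_eq_zero_iff _).2 (.inl (measure_eq_zero_iff_ae_notMem.2 ?_))
      filter_upwards [h.ae_mem hg hK hS] with ω hω hsub
      have h3 := Finset.card_le_card hsub
      rw [Finset.card_pair hij, (Finset.mem_powersetCard.1 (hω _ hr)).2] at h3
      omega
    have hS1 : S = 1 := by omega
    rw [h2, hS1]; simp
  · have hU : {i, j} ⊆ available group (m * K + group i) := by
      intro k hk
      rcases Finset.mem_insert.1 hk with rfl | hk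
      · exact mem_available_self k m
      · rw [Finset.mem_singleton.1 hk, hgij]
        exact mem_available_self j m
    rw [h.real_subset hg hK hS hr hU (by rwa [Finset.card_pair hij]), Finset.card_pair hij]
    have h2 := hg.card_available_mul hK (m * K + group i)
    have h3 := hg.le_card_available hK hS (m * K + group i)
    set n := (available group (m * K + group i)).card
    have h4 := Nat.add_one_mul_choose_eq (n - 1) (S - 1)
    have h6 := Nat.add_one_mul_choose_eq (n - 2) (S - 2)
    rw [Nat.sub_add_cancel (hS0.trans_le h3), Nat.sub_add_cancel hS0] at h4
    have e1 : n - 2 + 1 = n - 1 := by omega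
    have e2 : S - 2 + 1 = S - 1 := by omega
    rw [e1, e2] at h6
    have h5 : (0 : ℝ) < n.choose S := by exact_mod_cast Nat.choose_pos h3
    have h2' : (n : ℝ) * K = N := by exact_mod_cast h2
    have h4' : (n : ℝ) * (n - 1).choose (S - 1) = n.choose S * S := by exact_mod_cast h4
    have h6' : ((n : ℝ) - 1) * (n - 2).choose (S - 2) = (n - 1).choose (S - 1) * (S - 1) := by
      have := congrArg (Nat.cast (R := ℝ)) h6
      push_cast [Nat.cast_sub (hS0.trans_le h3), Nat.cast_sub hS0] at this
      exact this
    have hK' : (0 : ℝ) < K := by exact_mod_cast hK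
    have hSn : (S : ℝ) ≤ n := by exact_mod_cast h3
    have hS2' : (2 : ℝ) ≤ S := by exact_mod_cast hS2
    have hn1 : (0 : ℝ) < n - 1 := by linarith
    have hn : (0 : ℝ) < n := by linarith
    rw [← h2', mul_div_cancel_right₀ _ hK'.ne', mul_div_mul_right _ _ hK'.ne']
    field_simp
    linear_combination (n : ℝ) * h6' + ((S : ℝ) - 1) * h4'

theorem IsCyclic.integrable_sampled (h : IsCyclic μ group S R A) {m : ℕ} (hm : m < R / K)
    (i : Fin N) : Integrable (sampled group A m i) μ := by
  refine (integrable_const (1 : ℝ)).mono' (h.measurable_sampled hm i).aestronglyMeasurable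
    (.of_forall fun ω => ?_)
  rw [Real.norm_of_nonneg (sampled_nonneg m i)]
  exact sampled_le_one m i

/-- The covariances of the participation of two clients. -/
theorem IsCyclic.exists_covariance (h : IsCyclic μ group S R A) (hg : IsEqualPartition group)
    (hK : 0 < K) (hS0 : 0 < S) (hS : S * K ≤ N) {m : ℕ} (hm : m < R / K) :
    ∃ a b : ℝ, a ≤ (S * K : ℝ) / N ∧ 0 ≤ b ∧ ∀ i j,
      ∫ ω, (sampled group A m i ω - (S * K : ℝ) / N) * (sampled group A m j ω - (S * K : ℝ) / N) ∂μ
        = a * (if i = j then 1 else 0) - b * (if group i = group j then 1 else 0) := by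
  have hS' : (1 : ℝ) ≤ S := by exact_mod_cast hS0
  have hK' : (0 : ℝ) < K := by exact_mod_cast hK
  have hSN : (S * K : ℝ) ≤ N := by exact_mod_cast hS
  have hN : (0 : ℝ) < N := by nlinarith
  have hSn : (S : ℝ) ≤ N / K := by rwa [le_div_iff₀ hK']
  set p : ℝ := (S * K : ℝ) / N with hp
  have hp0 : 0 ≤ p := by positivity
  -- The conditional probability of a second client of the group given a first. Drawing without
  -- replacement makes it at most p; for groups of one client, division by zero gives e = 0 and this
  -- remains true.
  set e : ℝ := (S - 1) / (N / K - 1) with he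
  have he0 : 0 ≤ e := div_nonneg (by linarith) (by linarith)
  have hep : e ≤ p := by
    rcases (hS'.trans hSn).eq_or_lt with h1 | h1
    · rw [he, ← h1, sub_self, div_zero]; exact hp0
    · have h2 : p = S / (N / K) := by rw [hp]; field_simp
      rw [h2, he, div_le_div_iff₀ (by linarith) (by linarith)]
      linarith
  have hcov : ∀ i j, ∫ ω, (sampled group A m i ω - p) * (sampled group A m j ω - p) ∂μ
      = ∫ ω, sampled group A m i ω * sampled group A m j ω ∂μ - p ^ 2 := by
    intro i j
    have hI : Integrable (fun ω => sampled group A m i ω * sampled group A m j ω) μ := by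
      refine (integrable_const (1 : ℝ)).mono' ((h.measurable_sampled hm i).mul
        (h.measurable_sampled hm j)).aestronglyMeasurable (.of_forall fun ω => ?_)
      rw [Real.norm_of_nonneg (mul_nonneg (sampled_nonneg m i) (sampled_nonneg m j))]
      exact mul_le_one₀ (sampled_le_one m i) (sampled_nonneg m j) (sampled_le_one m j)
    have h1 : ∀ ω, (sampled group A m i ω - p) * (sampled group A m j ω - p)
        = sampled group A m i ω * sampled group A m j ω
          - (p * sampled group A m i ω + (p * sampled group A m j ω - p ^ 2)) := by
      intro ω; ring
    have hI1 := (h.integrable_sampled hm i).const_mul p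
    have hI2 := (h.integrable_sampled hm j).const_mul p
    have hI3 : Integrable (fun ω => p * sampled group A m j ω - p ^ 2) μ :=
      hI2.sub (integrable_const _)
    have hI4 : Integrable (fun ω => p * sampled group A m i ω
        + (p * sampled group A m j ω - p ^ 2)) μ := hI1.add hI3
    simp only [h1]
    rw [integral_sub hI hI4, integral_add hI1 hI3, integral_sub hI2 (integrable_const _),
      integral_const_mul, integral_const_mul, h.integral_sampled hg hK hS0 hS hm,
      h.integral_sampled hg hK hS0 hS hm]
    simp only [integral_const, probReal_univ, one_smul]
    ring
  -- Forced by the three cases: a − b = p − p² on the diagonal, −b = pe − p² within a group, and 0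
  -- across groups. The sign b ≥ 0 is the negative correlation.
  refine ⟨p - p * e, p ^ 2 - p * e, ?_, ?_, fun i j => ?_⟩
  · have := mul_nonneg hp0 he0
    linarith
  · have := mul_le_mul_of_nonneg_left hep hp0
    linarith
  · rw [hcov]
    by_cases hij : i = j
    · subst hij
      have h1 : ∀ ω, sampled group A m i ω * sampled group A m i ω = sampled group A m i ω :=
        fun ω => by rw [← sq, sampled_sq]
      simp only [h1, h.integral_sampled hg hK hS0 hS hm, if_true]
      rw [← hp]; ring
    · by_cases hgij : group i = group j
      · rw [h.integral_sampled_mul hg hK hS0 hS hm hij hgij, if_neg hij, if_pos hgij]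
        ring
      · rw [h.integral_sampled_mul_of_ne hg hK hS0 hS hm hgij, if_neg hij, if_neg hgij]
        ring

theorem IsCyclic.integral_sampled_sub_sq (h : IsCyclic μ group S R A) (hg : IsEqualPartition group)
    (hK : 0 < K) (hS0 : 0 < S) (hS : S * K ≤ N) {m : ℕ} (hm : m < R / K) (i : Fin N) :
    ∫ ω, (sampled group A m i ω / (S * K) - 1 / N) ^ 2 ∂μ
      = 1 / (S * N * K : ℝ) * (1 - (S * K : ℝ) / N) := by
  have hS' : (0 : ℝ) < S := by exact_mod_cast hS0
  have hK' : (0 : ℝ) < K := by exact_mod_cast hK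
  have hN : (0 : ℝ) < N := by exact_mod_cast (Nat.mul_pos hS0 hK).trans_le hS
  have h1 : ∀ ω, (sampled group A m i ω / (S * K) - 1 / N) ^ 2
      = (1 / (S * K) ^ 2 - 2 / (S * K * N)) * sampled group A m i ω + 1 / (N : ℝ) ^ 2 := by
    intro ω
    have h2 := sampled_sq (group := group) (A := A) (ω := ω) m i
    have h3 : (sampled group A m i ω / (S * K) - 1 / N) ^ 2
      = 1 / (S * K) ^ 2 * sampled group A m i ω ^ 2 - 2 / (S * K * N) * sampled group A m i ω
        + 1 / (N : ℝ) ^ 2 := by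
      field_simp; ring
    rw [h3, h2]; ring
  simp only [h1]
  rw [integral_add ((h.integrable_sampled hm i).const_mul _) (integrable_const _),
    integral_const_mul, h.integral_sampled hg hK hS0 hS hm]
  simp only [integral_const, probReal_univ, one_smul]
  field_simp
  ring

/-- The participation conditions under cyclic participation. -/
theorem IsCyclic.participation_conditions (h : IsCyclic μ group S R A)
    (hg : IsEqualPartition group) (hK : 0 < K) (hS0 : 0 < S) (hS : S * K ≤ N)
    {q : Ω → ℕ → Fin N → ℝ} (hq : q = fun ω r => weight S (A r ω)) {m : ℕ} (hm : m < R / K) :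
    (∀ i : Fin N,
      (μ[fun ω => wCoef (q ω) K m i | pastQ q (m * K)]
          =ᵐ[μ] fun _ => (S * K : ℝ) / (N : ℝ) ^ 2) ∧
      ∫ ω, wCoef (q ω) K m i ∂μ = (S * K : ℝ) / (N : ℝ) ^ 2 ∧
      (S * K : ℝ) / (N : ℝ) ^ 2 ≤ (K : ℝ) ^ 2 / N ∧
      ∫ ω, qBar (q ω) K m i ∂μ = 1 / (N : ℝ) ∧
      Var[fun ω => qBar (q ω) K m i; μ]
        = 1 / (S * N * K : ℝ) * (1 - (S * K : ℝ) / N)) ∧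
    ∫ ω, ∑ i, (qBar (q ω) K m i - 1 / (N : ℝ)) ^ 2 * lamCoef (q ω) K (zInit group S) m i ∂μ
      = 1 / (S : ℝ) * (1 - (S * K : ℝ) / N) ∧
    1 / (S : ℝ) * (1 - (S * K : ℝ) / N) ≤ 1 / (S : ℝ) := by
  subst hq
  have hS' : (1 : ℝ) ≤ S := by exact_mod_cast hS0
  have hK' : (1 : ℝ) ≤ K := by exact_mod_cast hK
  have hSN : (S * K : ℝ) ≤ N := by exact_mod_cast hS
  have hN : (0 : ℝ) < N := by nlinarith
  have hae := h.ae_mem hg hK hS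
  have hw : ∀ i, (fun ω => wCoef (fun r => weight S (A r ω)) K m i) =ᵐ[μ]
      fun ω => sampled group A m i ω / N := fun i => by
    filter_upwards [hae] with ω hω using wCoef_eq_sampled hS0 hK hω hm i
  have hqb : ∀ i, (fun ω => qBar (fun r => weight S (A r ω)) K m i) =ᵐ[μ]
      fun ω => sampled group A m i ω / (S * K) := fun i => by
    filter_upwards [hae] with ω hω using qBar_eq_sampled hω hm i
  have hEw : ∀ i, ∫ ω, sampled group A m i ω / N ∂μ = (S * K : ℝ) / (N : ℝ) ^ 2 := fun i => by
    rw [integral_div, h.integral_sampled hg hK hS0 hS hm]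
    field_simp
  have hEq : ∀ i, ∫ ω, sampled group A m i ω / (S * K) ∂μ = 1 / (N : ℝ) := fun i => by
    rw [integral_div, h.integral_sampled hg hK hS0 hS hm]
    field_simp
  refine ⟨fun i => ⟨?_, ?_, ?_, ?_, ?_⟩, ?_, ?_⟩
  · refine (condExp_congr_ae (hw i)).trans ?_
    have h1 := condExp_indep_eq (m₁ := MeasurableSpace.comap (A (m * K + group i)) ⊤)
      (f := fun ω => sampled group A m i ω / N) (h.comap_le (round_lt hm (group i).2))
      (h.pastQ_le hm)
      ((measurable_sampled_of_comap_le m i le_rfl).div_const _).stronglyMeasurable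
      (h.indep_pastQ hm (group i))
    rwa [hEw] at h1
  · rw [integral_congr_ae (hw i), hEw]
  · rw [div_le_div_iff₀ (by positivity) hN]
    have h1 : (S * K : ℝ) * N ≤ N * N := mul_le_mul_of_nonneg_right hSN hN.le
    have h2 : (N : ℝ) * N ≤ (K : ℝ) ^ 2 * (N : ℝ) ^ 2 := by
      rw [← sq]
      exact le_mul_of_one_le_left (sq_nonneg _) (one_le_pow₀ hK')
    linarith
  · rw [integral_congr_ae (hqb i), hEq]
  · rw [variance_congr (hqb i), variance_eq_integral, hEq,
      h.integral_sampled_sub_sq hg hK hS0 hS hm]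
    exact ((h.measurable_sampled hm i).div_const _).aemeasurable
  · have h1 : (fun ω => ∑ i, (qBar (fun r => weight S (A r ω)) K m i - 1 / (N : ℝ)) ^ 2 *
          lamCoef (fun r => weight S (A r ω)) K (zInit group S) m i) =ᵐ[μ]
        fun ω => ∑ i : Fin N, (sampled group A m i ω / (S * K) - 1 / N) ^ 2 * K := by
      filter_upwards [hae] with ω hω
      exact Finset.sum_congr rfl fun i _ => by
        rw [qBar_eq_sampled hω hm i, lamCoef_eq hS0 hK hω hm.le i]
    rw [integral_congr_ae h1, integral_finsetSum]
    · simp only [integral_mul_const, h.integral_sampled_sub_sq hg hK hS0 hS hm, Finset.sum_const,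
        Finset.card_univ, Fintype.card_fin, nsmul_eq_mul]
      field_simp
    · intro i _
      refine Integrable.mul_const ?_ _
      refine (integrable_const (1 : ℝ)).mono' ((((h.measurable_sampled hm i).div_const _).sub_const
        _).pow_const 2).aestronglyMeasurable (.of_forall fun ω => ?_)
      have h2 : |sampled group A m i ω / (S * K) - 1 / N| ≤ 1 := by
        have hSK : (1 : ℝ) ≤ S * K := one_le_mul_of_one_le_of_one_le hS' hK'
        have h3 := sampled_nonneg (group := group) (A := A) (ω := ω) m i
        have h4 := sampled_le_one (group := group) (A := A) (ω := ω) m i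
        have h5 : sampled group A m i ω / (S * K) ≤ 1 := by
          rw [div_le_one (by positivity)]; linarith
        have h6 : (1 : ℝ) / N ≤ 1 := by rw [div_le_one hN]; linarith
        have h7 : 0 ≤ sampled group A m i ω / (S * K) := by positivity
        have h8 : (0 : ℝ) ≤ 1 / N := by positivity
        rw [abs_le]; constructor <;> linarith
      rw [Real.norm_of_nonneg (sq_nonneg _), ← sq_abs]
      exact pow_le_one₀ (abs_nonneg _) h2
  · refine mul_le_of_le_one_right (by positivity) ?_
    have : 0 ≤ (S * K : ℝ) / N := by positivity
    linarith

end Cyclic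

/-! ### One window of the algorithm -/

section Pathwise

variable {N d K I : ℕ} {Ξ : Type*} {g : Fin N → Vec d → Ξ → Vec d} {η γ : ℝ}

theorem localIterate_eq (g : Vec d → Ξ → Vec d) (η : ℝ) (c x : Vec d) (ξ : ℕ → Ξ) (k : ℕ) :
    localIterate g η c x ξ k =
      x - η • ∑ l ∈ Finset.range k, (g (localIterate g η c x ξ l) (ξ l) + c) := by
  induction k with
  | zero => simp [localIterate]
  | succ k ih =>
    rw [Finset.sum_range_succ, localIterate, smul_add]
    nth_rw 1 [ih]
    simp only [sub_sub, smul_add]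

theorem clientIterate_eq (s : State N d) (ξ : ℕ → Fin N → Ξ) (i : Fin N) (k : ℕ) :
    clientIterate g η s ξ i k = s.x - η • ∑ l ∈ Finset.range k,
      (g i (clientIterate g η s ξ i l) (ξ l i) + (s.meanG - s.G i)) :=
  localIterate_eq _ _ _ _ _ _

/-- The state is that at the start of a window. -/
structure State.IsFresh (s : State N d) : Prop where
  anchor : s.anchor = s.x
  u : s.u = 0
  qSum : s.qSum = 0
  gSum : s.gSum = 0

theorem State.IsFresh.windowUpdate (s : State N d) : (windowUpdate γ s).IsFresh :=
  ⟨rfl, rfl, rfl, rfl⟩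

theorem isFresh_amplifiedScaffold (hK : 0 < K) (x₀ : Vec d) (q : ℕ → Fin N → ℝ)
    (ξ₀ : ℕ → Fin N → Ξ) (ξ : ℕ → ℕ → Fin N → Ξ) (m : ℕ) :
    (amplifiedScaffold g η γ K I x₀ q ξ₀ ξ (m * K)).IsFresh := by
  rcases Nat.eq_zero_or_pos m with rfl | hm
  · rw [zero_mul]; exact ⟨rfl, rfl, rfl, rfl⟩
  · obtain ⟨r, hr⟩ : ∃ r, m * K = r + 1 := ⟨m * K - 1, by have := Nat.mul_pos hm hK; omega⟩
    rw [hr, amplifiedScaffold, if_pos (by rw [← hr]; exact Nat.dvd_mul_left K m)]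
    exact State.IsFresh.windowUpdate _

/-- The states within a window that starts in state `st 0`. -/
structure IsWindow (g : Fin N → Vec d → Ξ → Vec d) (η : ℝ) (K I : ℕ) (q : ℕ → Fin N → ℝ)
    (ξ : ℕ → ℕ → Fin N → Ξ) (st : ℕ → State N d) : Prop where
  fresh : (st 0).IsFresh
  succ : ∀ s, s + 1 < K → st (s + 1) = roundUpdate g η I (q s) (ξ s) (st s)

/-- For 0 < s + 1 < K the number mK + s + 1 is not a multiple of K, so no end-of-window operation
intervenes. The last round, which does trigger one, is left to `amplifiedScaffold_window_end`. -/
theorem isWindow_amplifiedScaffold (hK : 0 < K) (x₀ : Vec d) (q : ℕ → Fin N → ℝ)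
    (ξ₀ : ℕ → Fin N → Ξ) (ξ : ℕ → ℕ → Fin N → Ξ) (m : ℕ) :
    IsWindow g η K I (fun s => q (m * K + s)) (fun s => ξ (m * K + s))
      (fun s => amplifiedScaffold g η γ K I x₀ q ξ₀ ξ (m * K + s)) where
  fresh := isFresh_amplifiedScaffold hK x₀ q ξ₀ ξ m
  succ s hs := by
    rw [← add_assoc, amplifiedScaffold, if_neg]
    rw [add_assoc, Nat.dvd_add_right (Nat.dvd_mul_left K m)]
    exact Nat.not_dvd_of_pos_of_lt s.succ_pos hs

theorem amplifiedScaffold_window_end (hK : 0 < K) (x₀ : Vec d) (q : ℕ → Fin N → ℝ)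
    (ξ₀ : ℕ → Fin N → Ξ) (ξ : ℕ → ℕ → Fin N → Ξ) (m : ℕ) :
    amplifiedScaffold g η γ K I x₀ q ξ₀ ξ ((m + 1) * K) =
      windowUpdate γ (roundUpdate g η I (q (m * K + (K - 1))) (ξ (m * K + (K - 1)))
        (amplifiedScaffold g η γ K I x₀ q ξ₀ ξ (m * K + (K - 1)))) := by
  have h : (m + 1) * K = m * K + (K - 1) + 1 := by rw [add_mul]; omega
  rw [h, amplifiedScaffold, if_pos (by rw [← h]; exact Nat.dvd_mul_left K _)]

/-! ### Quantities accumulated over one window. -/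

namespace IsWindow

variable {q : ℕ → Fin N → ℝ} {ξ : ℕ → ℕ → Fin N → Ξ} {st : ℕ → State N d}

theorem G_eq (h : IsWindow g η K I q ξ st) {s : ℕ} (hs : s < K) : (st s).G = (st 0).G := by
  induction s with
  | zero => rfl
  | succ s ih => rw [h.succ s hs]; exact ih (Nat.lt_of_succ_lt hs)

theorem anchor_eq (h : IsWindow g η K I q ξ st) {s : ℕ} (hs : s < K) :
    (st s).anchor = (st 0).x := by
  induction s with
  | zero => exact h.fresh.anchor
  | succ s ih => rw [h.succ s hs]; exact ih (Nat.lt_of_succ_lt hs)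

theorem u_eq (h : IsWindow g η K I q ξ st) {s : ℕ} (hs : s < K) :
    (st s).u = ∑ t ∈ Finset.range s,
      ∑ i, q t i • (clientIterate g η (st t) (ξ t) i I - (st t).x) := by
  induction s with
  | zero => simpa using h.fresh.u
  | succ s ih =>
    rw [h.succ s hs, Finset.sum_range_succ, ← ih (Nat.lt_of_succ_lt hs)]; rfl

theorem qSum_eq (h : IsWindow g η K I q ξ st) {s : ℕ} (hs : s < K) (i : Fin N) :
    (st s).qSum i = ∑ t ∈ Finset.range s, q t i := by
  induction s with
  | zero => simp [h.fresh.qSum]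
  | succ s ih =>
    rw [h.succ s hs, Finset.sum_range_succ, ← ih (Nat.lt_of_succ_lt hs)]; rfl

theorem gSum_eq (h : IsWindow g η K I q ξ st) {s : ℕ} (hs : s < K) (i : Fin N) :
    (st s).gSum i = ∑ t ∈ Finset.range s, q t i • ((1 / (I : ℝ)) • ∑ k ∈ Finset.range I,
      g i (clientIterate g η (st t) (ξ t) i k) (ξ t k i)) := by
  induction s with
  | zero => simp [h.fresh.gSum]
  | succ s ih =>
    rw [h.succ s hs, Finset.sum_range_succ, ← ih (Nat.lt_of_succ_lt hs)]; rfl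

/-- The average stochastic gradient of client `i` in the round of its group. -/
def avgGrad (g : Fin N → Vec d → Ξ → Vec d) (η : ℝ) (I : ℕ) (group : Fin N → Fin K)
    (ξ : ℕ → ℕ → Fin N → Ξ) (st : ℕ → State N d) (i : Fin N) : Vec d :=
  (1 / (I : ℝ)) • ∑ k ∈ Finset.range I,
    g i (clientIterate g η (st (group i)) (ξ (group i)) i k) (ξ (group i) k i)

variable {group : Fin N → Fin K} {S : ℕ} {χ : Fin N → ℝ}

theorem sum_cyclic_smul {E : Type*} [AddCommGroup E] [Module ℝ E]
    (hq : ∀ s < K, ∀ i, q s i = if (group i : ℕ) = s then χ i / S else 0) (i : Fin N) (v : ℕ → E) :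
    ∑ s ∈ Finset.range K, q s i • v s = (χ i / S) • v (group i) := by
  rw [Finset.sum_congr rfl fun s hs => by rw [hq s (Finset.mem_range.1 hs) i, ite_smul, zero_smul],
    Finset.sum_ite_eq, if_pos (Finset.mem_range.2 (group i).2)]

/-- The model after a window with cyclic participation. -/
theorem x_windowUpdate (h : IsWindow g η K I q ξ st) (hK : 0 < K) (hI : 0 < I) (hS : 0 < S)
    (hq : ∀ s < K, ∀ i, q s i = if (group i : ℕ) = s then χ i / S else 0) :
    (windowUpdate γ (roundUpdate g η I (q (K - 1)) (ξ (K - 1)) (st (K - 1)))).x =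
      (st 0).x - (γ * η * K * I) • ∑ i, (χ i / (S * K)) •
        (avgGrad g η I group ξ st i - (st 0).G i + (st 0).meanG) := by
  have hK' : (0 : ℝ) < K := by exact_mod_cast hK
  have hI' : (0 : ℝ) < I := by exact_mod_cast hI
  have hS' : (0 : ℝ) < S := by exact_mod_cast hS
  have hK1 : K - 1 < K := by omega
  change (st (K - 1)).anchor + γ • ((st (K - 1)).u +
    ∑ i, q (K - 1) i • (clientIterate g η (st (K - 1)) (ξ (K - 1)) i I - (st (K - 1)).x)) = _
  -- The last round is joined to the accumulated ones; exchanging the sums then leaves each client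
  -- with the single round of its group.
  rw [h.anchor_eq hK1, h.u_eq hK1, ← Finset.sum_range_succ (fun t =>
    ∑ i, q t i • (clientIterate g η (st t) (ξ t) i I - (st t).x)), Nat.sub_add_cancel hK,
    Finset.sum_comm, sub_eq_add_neg, ← smul_neg, Finset.smul_sum, ← Finset.sum_neg_distrib,
    Finset.smul_sum]
  congr 1
  refine Finset.sum_congr rfl fun i _ => ?_
  rw [sum_cyclic_smul hq i (fun t => clientIterate g η (st t) (ξ t) i I - (st t).x),
    clientIterate_eq]
  have hG : (st (group i)).meanG = (st 0).meanG := by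
    unfold State.meanG; rw [h.G_eq (group i).2]
  rw [hG, h.G_eq (group i).2, Finset.sum_add_distrib, Finset.sum_const, Finset.card_range]
  have h1 : ∑ k ∈ Finset.range I,
      g i (clientIterate g η (st (group i)) (ξ (group i)) i k) (ξ (group i) k i)
      = (I : ℝ) • avgGrad g η I group ξ st i := by
    rw [avgGrad, smul_smul, mul_one_div_cancel hI'.ne', one_smul]
  rw [h1, ← Nat.cast_smul_eq_nsmul ℝ]
  match_scalars <;> field_simp
  ring

/-- The control variates after a window with cyclic participation. -/
theorem G_windowUpdate (h : IsWindow g η K I q ξ st) (hK : 0 < K) (hS : 0 < S)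
    (hχ : ∀ i, χ i = 0 ∨ χ i = 1)
    (hq : ∀ s < K, ∀ i, q s i = if (group i : ℕ) = s then χ i / S else 0) (i : Fin N) :
    (windowUpdate γ (roundUpdate g η I (q (K - 1)) (ξ (K - 1)) (st (K - 1)))).G i =
      χ i • avgGrad g η I group ξ st i + (1 - χ i) • (st 0).G i := by
  have hS' : (0 : ℝ) < S := by exact_mod_cast hS
  have hK1 : K - 1 < K := by omega
  change (if 0 < (st (K - 1)).qSum i + q (K - 1) i then
    (1 / ((st (K - 1)).qSum i + q (K - 1) i)) • ((st (K - 1)).gSum i + q (K - 1) i •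
      ((1 / (I : ℝ)) • ∑ k ∈ Finset.range I,
      g i (clientIterate g η (st (K - 1)) (ξ (K - 1)) i k) (ξ (K - 1) k i)))
    else (st (K - 1)).G i) = _
  rw [h.qSum_eq hK1, h.gSum_eq hK1, ← Finset.sum_range_succ (fun t => q t i),
    ← Finset.sum_range_succ (fun t => q t i • ((1 / (I : ℝ)) • ∑ k ∈ Finset.range I,
      g i (clientIterate g η (st t) (ξ t) i k) (ξ t k i))), Nat.sub_add_cancel hK,
    sum_cyclic_smul hq i (fun t => (1 / (I : ℝ)) • ∑ k ∈ Finset.range I,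
      g i (clientIterate g η (st t) (ξ t) i k) (ξ t k i)), h.G_eq hK1]
  have h1 : ∑ s ∈ Finset.range K, q s i = χ i / S := by
    simpa using sum_cyclic_smul hq i (fun _ => (1 : ℝ))
  rw [h1]
  rcases hχ i with h0 | h1
  · simp [h0]
  · rw [h1, if_pos (by positivity), smul_smul, one_div_one_div, mul_one_div_cancel hS'.ne']
    simp [avgGrad]

/-- The local iterates of a window stay close to its first model when the local step is small. -/
theorem norm_clientIterate_sub_le (h : IsWindow g η K I q ξ st) (hη : 0 ≤ η)
    (hq0 : ∀ s < K, ∀ i, 0 ≤ q s i) (hq1 : ∀ s < K, ∑ i, q s i = 1)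
    {f : Fin N → Vec d → Vec d} {L B Z : ℝ} (hL : 0 ≤ L) (hB0 : 0 ≤ B)
    (hf : ∀ i x y, ‖f i x - f i y‖ ≤ L * ‖x - y‖)
    (hηL : 2 * (η * (K * I) * L) ≤ 1)
    (hB : ∀ i, ‖f i (st 0).x + ((st 0).meanG - (st 0).G i)‖ ≤ B)
    (hZ : ∑ s ∈ Finset.range K, ∑ k ∈ Finset.range I, ∑ i,
      ‖g i (clientIterate g η (st s) (ξ s) i k) (ξ s k i)
        - f i (clientIterate g η (st s) (ξ s) i k)‖ ≤ Z)
    {s : ℕ} (hs : s < K) {k : ℕ} (hk : k ≤ I) (i : Fin N) :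
    ‖clientIterate g η (st s) (ξ s) i k - (st 0).x‖ ≤ 2 * η * (K * I * B + Z) := by
  set nn : ℕ → ℕ → Fin N → ℝ := fun s k i => ‖g i (clientIterate g η (st s) (ξ s) i k) (ξ s k i)
        - f i (clientIterate g η (st s) (ξ s) i k)‖ with hnn
  have hnn0 : ∀ s k i, 0 ≤ nn s k i := fun s k i => norm_nonneg _
  set D := 2 * η * (K * I * B + Z) with hD
  have hZ0 : 0 ≤ Z := le_trans (Finset.sum_nonneg fun s _ => Finset.sum_nonneg fun k _ =>
    Finset.sum_nonneg fun i _ => hnn0 s k i) hZ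
  have hD0 : 0 ≤ D := by positivity
  have hLB : 0 ≤ L * D + B := by positivity
  -- The bootstrap closes here: η(KIB + Z) is half of D, and 2ηKIL ≤ 1 makes the feedback ηKI·LD at
  -- most the other half.
  have hroom : ∀ {a b : ℝ}, a ≤ K * I → b ≤ Z → η * (a * (L * D + B) + b) ≤ D := by
    intro a b ha hb
    have h1 : η * (a * (L * D + B) + b) ≤ η * (K * I * (L * D + B) + Z) := by gcongr
    have h2 : 2 * (η * (K * I) * L) * D ≤ 1 * D := mul_le_mul_of_nonneg_right hηL hD0
    have h3 : D = 2 * (η * (K * I * B + Z)) := by rw [hD]; ring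
    nlinarith
  -- Reaching step k of round s takes s full rounds and k further steps, at most KI steps in all.
  -- The noise of every client is charged for full rounds, only that of the client itself for the
  -- current one.
  have hpart : ∀ s < K, ∀ k ≤ I, ∀ i, (s * I + k : ℝ) ≤ K * I ∧
      ∑ t ∈ Finset.range s, ∑ l ∈ Finset.range I, ∑ j, nn t l j
        + ∑ l ∈ Finset.range k, nn s l i ≤ Z := by
    intro s hs k hk i
    constructor
    · have h1 : s * I + k ≤ K * I := by
        have := Nat.mul_le_mul_right I (Nat.succ_le_of_lt hs)
        rw [Nat.succ_mul] at this
        omega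
      exact_mod_cast h1
    · calc ∑ t ∈ Finset.range s, ∑ l ∈ Finset.range I, ∑ j, nn t l j
          + ∑ l ∈ Finset.range k, nn s l i
          ≤ ∑ t ∈ Finset.range s, ∑ l ∈ Finset.range I, ∑ j, nn t l j
            + ∑ l ∈ Finset.range I, ∑ j, nn s l j := by
            gcongr
            refine (Finset.sum_le_sum fun l _ => Finset.single_le_sum (f := nn s l)
              (fun j _ => hnn0 s l j) (Finset.mem_univ i)).trans ?_
            exact Finset.sum_le_sum_of_subset_of_nonneg (Finset.range_mono hk)
              fun l _ _ => Finset.sum_nonneg fun j _ => hnn0 s l j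
        _ = ∑ t ∈ Finset.range (s + 1), ∑ l ∈ Finset.range I, ∑ j, nn t l j := by
            rw [Finset.sum_range_succ]
        _ ≤ _ := (Finset.sum_le_sum_of_subset_of_nonneg (Finset.range_mono hs)
              fun t _ _ => Finset.sum_nonneg fun l _ =>
                Finset.sum_nonneg fun j _ => hnn0 t l j).trans hZ
  -- Inner induction over the local steps, given the bound on the server model. While the iterate is
  -- within D of the first model, each direction has norm at most LD + B plus its noise.
  have hlocal : ∀ s < K, ‖(st s).x - (st 0).x‖ ≤ η * (s * I * (L * D + B)
      + ∑ t ∈ Finset.range s, ∑ l ∈ Finset.range I, ∑ j, nn t l j) → ∀ i, ∀ k ≤ I,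
      ‖clientIterate g η (st s) (ξ s) i k - (st s).x‖ ≤
        η * (k * (L * D + B) + ∑ l ∈ Finset.range k, nn s l i) := by
    intro s hs hxs i k
    induction k with
    | zero => intro _; simp [clientIterate, localIterate]
    | succ k ih =>
      intro hk
      have ihk := ih (Nat.le_of_succ_le hk)
      set y := clientIterate g η (st s) (ξ s) i k with hy
      have hyD : ‖y - (st 0).x‖ ≤ D := by
        obtain ⟨h1, h2⟩ := hpart s hs k (Nat.le_of_succ_le hk) i
        calc ‖y - (st 0).x‖ ≤ ‖y - (st s).x‖ + ‖(st s).x - (st 0).x‖ :=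
              norm_sub_le_norm_sub_add_norm_sub _ _ _
          _ ≤ η * ((s * I + k) * (L * D + B) + (∑ t ∈ Finset.range s, ∑ l ∈ Finset.range I,
              ∑ j, nn t l j + ∑ l ∈ Finset.range k, nn s l i)) := by linarith
          _ ≤ D := hroom h1 h2
      have hstep : clientIterate g η (st s) (ξ s) i (k + 1) =
          y - η • (g i y (ξ s k i) + ((st 0).meanG - (st 0).G i)) := by
        have hG : (st s).meanG = (st 0).meanG := by unfold State.meanG; rw [h.G_eq hs]
        rw [← hG, ← h.G_eq hs]; rfl
      have hdir : ‖g i y (ξ s k i) + ((st 0).meanG - (st 0).G i)‖ ≤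
          nn s k i + (L * D + B) := by
        have h1 : g i y (ξ s k i) + ((st 0).meanG - (st 0).G i) = (g i y (ξ s k i) - f i y)
          + ((f i y - f i (st 0).x) + (f i (st 0).x + ((st 0).meanG - (st 0).G i))) := by abel
        rw [h1]
        refine (norm_add_le _ _).trans (add_le_add le_rfl ((norm_add_le _ _).trans
          (add_le_add ((hf i _ _).trans ?_) (hB i))))
        gcongr
      rw [hstep, Finset.sum_range_succ]
      calc _ = ‖(y - (st s).x) - η • (g i y (ξ s k i) + ((st 0).meanG - (st 0).G i))‖ := by
            congr 1; abel
        _ ≤ ‖y - (st s).x‖ + η * ‖g i y (ξ s k i) + ((st 0).meanG - (st 0).G i)‖ := by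
            refine (norm_sub_le _ _).trans_eq ?_
            rw [norm_smul, Real.norm_of_nonneg hη]
        _ ≤ η * (k * (L * D + B) + ∑ l ∈ Finset.range k, nn s l i)
            + η * (nn s k i + (L * D + B)) := by gcongr
        _ = _ := by push_cast; ring
  -- Outer induction over the rounds: the weights are nonnegative and sum to one, so the uniform
  -- bound on the clients' moves also bounds the server's move.
  have hglobal : ∀ s < K, ‖(st s).x - (st 0).x‖ ≤ η * (s * I * (L * D + B)
      + ∑ t ∈ Finset.range s, ∑ l ∈ Finset.range I, ∑ j, nn t l j) := by
    intro s
    induction s with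
    | zero => intro _; simp
    | succ s ih =>
      intro hs
      have hs' := Nat.lt_of_succ_lt hs
      have ihs := ih hs'
      have hstep : (st (s + 1)).x = (st s).x +
          ∑ i, q s i • (clientIterate g η (st s) (ξ s) i I - (st s).x) := by
        rw [h.succ s hs]; rfl
      have hsum : ‖∑ i, q s i • (clientIterate g η (st s) (ξ s) i I - (st s).x)‖ ≤
          η * (I * (L * D + B) + ∑ l ∈ Finset.range I, ∑ j, nn s l j) := by
        calc _ ≤ ∑ i, ‖q s i • (clientIterate g η (st s) (ξ s) i I - (st s).x)‖ :=
              norm_sum_le _ _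
          _ ≤ ∑ i, q s i * (η * (I * (L * D + B) + ∑ l ∈ Finset.range I, ∑ j, nn s l j)) := by
              refine Finset.sum_le_sum fun i _ => ?_
              rw [norm_smul, Real.norm_of_nonneg (hq0 s hs' i)]
              refine mul_le_mul_of_nonneg_left ((hlocal s hs' ihs i I le_rfl).trans ?_)
                (hq0 s hs' i)
              gcongr with l _
              exact Finset.single_le_sum (f := nn s l) (fun j _ => hnn0 s l j) (Finset.mem_univ i)
          _ = _ := by rw [← Finset.sum_mul, hq1 s hs', one_mul]
      rw [hstep, Finset.sum_range_succ, add_sub_right_comm]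
      refine (norm_add_le _ _).trans ((add_le_add ihs hsum).trans_eq ?_)
      push_cast; ring
  obtain ⟨h1, h2⟩ := hpart s hs k hk i
  calc _ ≤ ‖clientIterate g η (st s) (ξ s) i k - (st s).x‖ + ‖(st s).x - (st 0).x‖ :=
        norm_sub_le_norm_sub_add_norm_sub _ _ _
    _ ≤ η * ((s * I + k) * (L * D + B) + (∑ t ∈ Finset.range s, ∑ l ∈ Finset.range I,
              ∑ j, nn t l j + ∑ l ∈ Finset.range k, nn s l i)) := by
        have h3 := hlocal s hs (hglobal s hs) i k hk
        have h4 := hglobal s hs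
        linarith
    _ ≤ D := hroom h1 h2

end IsWindow

end Pathwise

/-! ### Measurability of the algorithm -/

section Measurability

variable {Ω Ξ : Type*} [MeasurableSpace Ω] [MeasurableSpace Ξ] {N d : ℕ}

/-- Measurability of a random state. -/
structure MeasurableState (s : Ω → State N d) : Prop where
  x : Measurable fun ω => (s ω).x
  anchor : Measurable fun ω => (s ω).anchor
  u : Measurable fun ω => (s ω).u
  G : ∀ i, Measurable fun ω => (s ω).G i
  qSum : ∀ i, Measurable fun ω => (s ω).qSum i
  gSum : ∀ i, Measurable fun ω => (s ω).gSum i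

variable {g : Fin N → Vec d → Ξ → Vec d} {η γ : ℝ} {K I : ℕ}

theorem MeasurableState.meanG {s : Ω → State N d} (hs : MeasurableState s) :
    Measurable fun ω => (s ω).meanG :=
  (Finset.measurable_fun_sum _ fun i _ => hs.G i).const_smul (1 / (N : ℝ))

theorem measurable_stochGrad_comp {g : Vec d → Ξ → Vec d}
    (hg : Measurable fun z : Vec d × Ξ => g z.1 z.2) {y : Ω → Vec d} {ξ : Ω → Ξ}
    (hy : Measurable y) (hξ : Measurable ξ) : Measurable fun ω => g (y ω) (ξ ω) :=
  hg.comp (g := fun z : Vec d × Ξ => g z.1 z.2) (f := fun ω => (y ω, ξ ω)) (hy.prodMk hξ)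

theorem MeasurableState.clientIterate
    (hg : ∀ i, Measurable fun z : Vec d × Ξ => g i z.1 z.2)
    {s : Ω → State N d} (hs : MeasurableState s) {ξ : ℕ → Fin N → Ω → Ξ} (i : Fin N) (k : ℕ)
    (hξ : ∀ l < k, Measurable (ξ l i)) :
    Measurable fun ω => clientIterate g η (s ω) (fun k i => ξ k i ω) i k := by
  induction k with
  | zero => exact hs.x
  | succ k ih =>
    have h1 := ih fun l hl => hξ l (Nat.lt_succ_of_lt hl)
    exact h1.sub (((measurable_stochGrad_comp (hg i) h1 (hξ k k.lt_succ_self)).add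
      (hs.meanG.sub (hs.G i))).const_smul η)

theorem MeasurableState.roundUpdate
    (hg : ∀ i, Measurable fun z : Vec d × Ξ => g i z.1 z.2)
    {s : Ω → State N d} (hs : MeasurableState s) {ξ : ℕ → Fin N → Ω → Ξ}
    (hξ : ∀ k < I, ∀ i, Measurable (ξ k i)) {q : Ω → Fin N → ℝ}
    (hq : ∀ i, Measurable fun ω => q ω i) :
    MeasurableState fun ω => roundUpdate g η I (q ω) (fun k i => ξ k i ω) (s ω) := by
  have hc : ∀ k ≤ I, ∀ i, Measurable fun ω =>
      FedPeriodic.clientIterate g η (s ω) (fun k i => ξ k i ω) i k := fun k hk i =>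
    hs.clientIterate hg i k fun l hl => hξ l (hl.trans_le hk) i
  have hu : Measurable fun ω => ∑ i, q ω i •
      (FedPeriodic.clientIterate g η (s ω) (fun k i => ξ k i ω) i I - (s ω).x) :=
    Finset.measurable_fun_sum _ fun i _ => (hq i).smul ((hc I le_rfl i).sub hs.x)
  exact
  { x := hs.x.add hu
    anchor := hs.anchor
    u := hs.u.add hu
    G := hs.G
    qSum := fun i => (hs.qSum i).add (hq i)
    gSum := fun i => (hs.gSum i).add ((hq i).smul ((Finset.measurable_fun_sum _ fun k hk =>
      measurable_stochGrad_comp (hg i) (hc k (Finset.mem_range.1 hk).le i)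
        (hξ k (Finset.mem_range.1 hk) i)).const_smul (1 / (I : ℝ)))) }

theorem MeasurableState.windowUpdate {s : Ω → State N d} (hs : MeasurableState s) :
    MeasurableState fun ω => windowUpdate γ (s ω) where
  x := hs.anchor.add (hs.u.const_smul γ)
  anchor := hs.anchor.add (hs.u.const_smul γ)
  u := measurable_const
  G i := by
    refine Measurable.ite (measurableSet_lt measurable_const (hs.qSum i))
      (((measurable_const.div (hs.qSum i))).smul (hs.gSum i)) (hs.G i)
  qSum _ := measurable_const
  gSum _ := measurable_const

theorem measurableState_amplifiedScaffold
    (hg : ∀ i, Measurable fun z : Vec d × Ξ => g i z.1 z.2) (x₀ : Vec d)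
    {q : Ω → ℕ → Fin N → ℝ} {ξ₀ : ℕ → Fin N → Ω → Ξ} {ξ : ℕ → ℕ → Fin N → Ω → Ξ} (r : ℕ)
    (hq : ∀ s < r, ∀ i, Measurable fun ω => q ω s i)
    (hξ₀ : ∀ k < I, ∀ i, Measurable (ξ₀ k i)) (hξ : ∀ s < r, ∀ k < I, ∀ i, Measurable (ξ s k i)) :
    MeasurableState fun ω => amplifiedScaffold g η γ K I x₀ (q ω) (fun k i => ξ₀ k i ω)
      (fun r k i => ξ r k i ω) r := by
  induction r with
  | zero =>
    exact
    { x := measurable_const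
      anchor := measurable_const
      u := measurable_const
      G := fun i => (Finset.measurable_fun_sum _ fun k hk => measurable_stochGrad_comp (hg i)
        measurable_const (hξ₀ k (Finset.mem_range.1 hk) i)).const_smul (1 / (I : ℝ))
      qSum := fun _ => measurable_const
      gSum := fun _ => measurable_const }
  | succ r ih =>
    have h1 := (ih (fun s hs => hq s (Nat.lt_succ_of_lt hs))
      (fun s hs => hξ s (Nat.lt_succ_of_lt hs))).roundUpdate (η := η) hg (hξ r r.lt_succ_self)
      (hq r r.lt_succ_self)
    by_cases hr : K ∣ r + 1
    · simpa only [amplifiedScaffold, if_pos hr] using h1.windowUpdate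
    · simpa only [amplifiedScaffold, if_neg hr] using h1

end Measurability

/-! ### Independence of the draws -/

section Draws

variable {Ω Ξ : Type*} [MeasurableSpace Ξ] {N : ℕ}

/-- The σ-algebras of the individual draws of a run. -/
abbrev Draws.drawAlg (X : Draws Ω Ξ N) (R I : ℕ) :
    Unit ⊕ Fin R ⊕ (Fin I × Fin N) ⊕ (Fin R × Fin I × Fin N) → MeasurableSpace Ω :=
  Sum.elim (fun _ : Unit => MeasurableSpace.comap X.index inferInstance)
      (Sum.elim (fun r : Fin R => MeasurableSpace.comap (X.clients r) ⊤)
        (Sum.elim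
          (fun j : Fin I × Fin N => MeasurableSpace.comap (X.initSample j.1 j.2) inferInstance)
          (fun j : Fin R × Fin I × Fin N =>
            MeasurableSpace.comap (X.sample j.1 j.2.1 j.2.2) inferInstance)))

/-- The σ-algebra of a set of draws. -/
abbrev Draws.alg (X : Draws Ω Ξ N) {R I : ℕ}
    (T : Set (Unit ⊕ Fin R ⊕ (Fin I × Fin N) ⊕ (Fin R × Fin I × Fin N))) : MeasurableSpace Ω :=
  ⨆ j ∈ T, X.drawAlg R I j

/-- The draws made before round `r`. -/
def drawsBefore (N R I r : ℕ) : Set (Unit ⊕ Fin R ⊕ (Fin I × Fin N) ⊕ (Fin R × Fin I × Fin N)) :=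
  {j | Sum.elim (fun _ => False) (Sum.elim (fun s : Fin R => (s : ℕ) < r)
    (Sum.elim (fun _ => True) (fun j => (j.1 : ℕ) < r))) j}

/-- The draws that do not depend on the sample of client `i` at step `k` of round `r`: all those
except the samples of later rounds and the samples of the same client in later steps. -/
def drawsWithout {N : ℕ} (R I r k : ℕ) (i : Fin N) :
    Set (Unit ⊕ Fin R ⊕ (Fin I × Fin N) ⊕ (Fin R × Fin I × Fin N)) :=
  {j | Sum.elim (fun _ => True) (Sum.elim (fun _ => True) (Sum.elim (fun _ => True)
    (fun j => (j.1 : ℕ) < r ∨ (j.1 : ℕ) = r ∧ (j.2.2 ≠ i ∨ (j.2.1 : ℕ) < k)))) j}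

variable {X : Draws Ω Ξ N} {R I : ℕ}
  {T : Set (Unit ⊕ Fin R ⊕ (Fin I × Fin N) ⊕ (Fin R × Fin I × Fin N))}

theorem Draws.drawAlg_le_alg {j : Unit ⊕ Fin R ⊕ (Fin I × Fin N) ⊕ (Fin R × Fin I × Fin N)}
    (hj : j ∈ T) : X.drawAlg R I j ≤ X.alg T :=
  le_iSup₂_of_le j hj le_rfl

theorem Draws.comap_clients_le {r : ℕ} (hr : r < R) (h : .inr (.inl ⟨r, hr⟩) ∈ T) :
    MeasurableSpace.comap (X.clients r) ⊤ ≤ X.alg T :=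
  Draws.drawAlg_le_alg (j := .inr (.inl ⟨r, hr⟩)) h

theorem Draws.measurable_initSample {k : ℕ} (hk : k < I) {i : Fin N}
    (h : .inr (.inr (.inl (⟨k, hk⟩, i))) ∈ T) : Measurable[X.alg T] (X.initSample k i) :=
  measurable_iff_comap_le.2 (Draws.drawAlg_le_alg (j := .inr (.inr (.inl (⟨k, hk⟩, i)))) h)

theorem Draws.measurable_sample {r k : ℕ} (hr : r < R) (hk : k < I) {i : Fin N}
    (h : .inr (.inr (.inr (⟨r, hr⟩, ⟨k, hk⟩, i))) ∈ T) : Measurable[X.alg T] (X.sample r k i) :=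
  measurable_iff_comap_le.2
    (Draws.drawAlg_le_alg (j := .inr (.inr (.inr (⟨r, hr⟩, ⟨k, hk⟩, i)))) h)

theorem Draws.measurable_index (h : .inl () ∈ T) : Measurable[X.alg T] X.index :=
  measurable_iff_comap_le.2 (Draws.drawAlg_le_alg (j := .inl ()) h)

variable {mΩ : MeasurableSpace Ω} {μ : Measure Ω} {D : Fin N → Measure Ξ} {K S P : ℕ}
  {group : Fin N → Fin K}

theorem Draws.IsRun.drawAlg_le (h : X.IsRun μ D group S P I R)
    (j : Unit ⊕ Fin R ⊕ (Fin I × Fin N) ⊕ (Fin R × Fin I × Fin N)) : X.drawAlg R I j ≤ mΩ := by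
  rcases j with _ | r | j | j
  · exact h.measurable_index.comap_le
  · exact h.cyclic.comap_le r.2
  · exact (h.measurable_initSample _ j.1.2 j.2).comap_le
  · exact (h.measurable_sample _ j.1.2 _ j.2.1.2 j.2.2).comap_le

theorem Draws.IsRun.alg_le (h : X.IsRun μ D group S P I R) : X.alg T ≤ mΩ :=
  iSup₂_le fun j _ => h.drawAlg_le j

theorem Draws.IsRun.indep_alg (h : X.IsRun μ D group S P I R)
    {T' : Set (Unit ⊕ Fin R ⊕ (Fin I × Fin N) ⊕ (Fin R × Fin I × Fin N))} (hT : Disjoint T T') :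
    Indep (X.alg T) (X.alg T') μ :=
  indep_iSup_of_disjoint h.drawAlg_le h.indep hT

theorem Draws.IsRun.indep_sample (h : X.IsRun μ D group S P I R) {r k : ℕ} (hr : r < R)
    (hk : k < I) (i : Fin N) :
    Indep (X.alg (drawsWithout R I r k i))
      (MeasurableSpace.comap (X.sample r k i) inferInstance) μ := by
  have h1 := h.indep_alg (T := drawsWithout R I r k i)
    (T' := {.inr (.inr (.inr (⟨r, hr⟩, ⟨k, hk⟩, i)))})
    (Set.disjoint_singleton_right.2 (by simp [drawsWithout]))
  refine indep_of_indep_of_le_right h1 ?_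
  exact Draws.drawAlg_le_alg (j := .inr (.inr (.inr (⟨r, hr⟩, ⟨k, hk⟩, i))))
    (Set.mem_singleton _)

end Draws

/-! ### Runs of the algorithm -/

/-- The data of a run. -/
structure Setup (Ω Ξ : Type*) [MeasurableSpace Ξ] (N K d : ℕ) where
  p : Problem N d Ξ
  x₀ : Vec d
  X : Draws Ω Ξ N
  group : Fin N → Fin K
  S : ℕ
  I : ℕ
  η : ℝ
  γ : ℝ

namespace Setup

variable {Ω Ξ : Type*} [MeasurableSpace Ξ] {N K d : ℕ}

/-- The server state at the start of round `r`. -/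
def state (c : Setup Ω Ξ N K d) (r : ℕ) (ω : Ω) : State N d :=
  amplifiedScaffold c.p.stochGrad c.η c.γ K c.I c.x₀ (fun r => weight c.S (c.X.clients r ω))
    (fun k i => c.X.initSample k i ω) (fun r k i => c.X.sample r k i ω) r

/-- The gradient of the objective of client `i`. -/
def grad (c : Setup Ω Ξ N K d) (i : Fin N) (x : Vec d) : Vec d := gradient (c.p.localObj i) x

/-- The error of a stochastic gradient. -/
def gradError (c : Setup Ω Ξ N K d) (i : Fin N) (x : Vec d) (ξ : Ξ) : Vec d :=
  c.p.stochGrad i x ξ - c.grad i x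

/-- The local iterates `x_{r,k}^i`. -/
def iter (c : Setup Ω Ξ N K d) (r k : ℕ) (i : Fin N) (ω : Ω) : Vec d :=
  clientIterate c.p.stochGrad c.η (c.state r ω) (fun k i => c.X.sample r k i ω) i k

/-- The gradient noise of the local step `k` of client `i` in round `r`. -/
def noise (c : Setup Ω Ξ N K d) (r k : ℕ) (i : Fin N) (ω : Ω) : Vec d :=
  c.gradError i (c.iter r k i ω) (c.X.sample r k i ω)

/-- The model at the start of the `m`-th window. -/
def model (c : Setup Ω Ξ N K d) (m : ℕ) (ω : Ω) : Vec d := (c.state (m * K) ω).x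

/-- The gradient of the global objective. -/
def meanGrad (c : Setup Ω Ξ N K d) (x : Vec d) : Vec d := (1 / (N : ℝ)) • ∑ i, c.grad i x

/-- The error of the control variate of client `i` at the start of the `m`-th window. -/
def err (c : Setup Ω Ξ N K d) (m : ℕ) (i : Fin N) (ω : Ω) : Vec d :=
  c.grad i (c.model m ω) - (c.state (m * K) ω).G i

/-- Whether client `i` is sampled in the `m`-th window. -/
def ind (c : Setup Ω Ξ N K d) (m : ℕ) (i : Fin N) (ω : Ω) : ℝ := sampled c.group c.X.clients m i ω

/-- The assumptions on a run. -/
structure IsValid [MeasurableSpace Ω] (c : Setup Ω Ξ N K d) (μ : Measure Ω) (Δ L σ : ℝ) (R : ℕ) :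
    Prop where
  adm : c.p.Admissible c.x₀ Δ L σ
  part : IsEqualPartition c.group
  run : c.X.IsRun μ c.p.D c.group c.S K c.I R
  hK : 0 < K
  hS : 0 < c.S
  hSK : c.S * K ≤ N
  hI : 0 < c.I
  hL : 0 ≤ L

theorem measurable_ind {R : ℕ} {c : Setup Ω Ξ N K d}
    {T : Set (Unit ⊕ Fin R ⊕ (Fin c.I × Fin N) ⊕ (Fin R × Fin c.I × Fin N))}
    {m : ℕ} (hm : m < R / K) {i : Fin N}
    (hT : .inr (.inl ⟨m * K + c.group i, round_lt hm (c.group i).2⟩) ∈ T) :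
    Measurable[c.X.alg T] (c.ind m i) :=
  measurable_sampled_of_comap_le m i (Draws.comap_clients_le _ hT)

/-! ### What the iterates depend on, and moments of the gradient noise. -/

namespace IsValid

variable [mΩ : MeasurableSpace Ω] {μ : Measure Ω} {Δ L σ : ℝ} {R : ℕ}
  {c : Setup Ω Ξ N K d}

theorem measurable_grad (h : c.IsValid μ Δ L σ R) (i : Fin N) : Measurable (c.grad i) :=
  (continuous_of_norm_sub_le (h.adm.smooth i)).measurable

theorem measurable_gradError (h : c.IsValid μ Δ L σ R) (i : Fin N) :
    Measurable fun z : Vec d × Ξ => c.gradError i z.1 z.2 :=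
  (h.adm.measurable_stochGrad i).sub ((h.measurable_grad i).comp measurable_fst)

theorem measurableState {T : Set (Unit ⊕ Fin R ⊕ (Fin c.I × Fin N) ⊕ (Fin R × Fin c.I × Fin N))}
    (h : c.IsValid μ Δ L σ R) {r : ℕ} (hr : r ≤ R) (hT : drawsBefore N R c.I r ⊆ T) :
    @MeasurableState Ω (c.X.alg T) N d (c.state r) := by
  refine @measurableState_amplifiedScaffold Ω Ξ (c.X.alg T) _ N d c.p.stochGrad c.η c.γ K c.I
    h.adm.measurable_stochGrad c.x₀ (fun ω r => weight c.S (c.X.clients r ω)) c.X.initSample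
    c.X.sample r (fun s hs i => ?_) (fun k hk i => ?_) (fun s hs k hk i => ?_)
  · refine measurable_iff_comap_le.2 (le_trans ?_
      (Draws.comap_clients_le (hs.trans_le hr) (hT (by simpa [drawsBefore] using hs))))
    rintro _ ⟨B, -, rfl⟩
    exact ⟨{T | weight c.S T i ∈ B}, trivial, rfl⟩
  · exact Draws.measurable_initSample hk (hT (by simp [drawsBefore]))
  · exact Draws.measurable_sample (hs.trans_le hr) hk (hT (by simpa [drawsBefore] using hs))

theorem measurable_model {T : Set (Unit ⊕ Fin R ⊕ (Fin c.I × Fin N) ⊕ (Fin R × Fin c.I × Fin N))}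
    (h : c.IsValid μ Δ L σ R) {m : ℕ} (hm : m ≤ R / K) (hT : drawsBefore N R c.I (m * K) ⊆ T) :
    Measurable[c.X.alg T] (c.model m) :=
  @MeasurableState.x Ω (c.X.alg T) N d _
    (h.measurableState ((Nat.mul_le_mul_right K hm).trans (Nat.div_mul_le_self R K)) hT)

theorem measurable_err {T : Set (Unit ⊕ Fin R ⊕ (Fin c.I × Fin N) ⊕ (Fin R × Fin c.I × Fin N))}
    (h : c.IsValid μ Δ L σ R) {m : ℕ} (hm : m ≤ R / K) (hT : drawsBefore N R c.I (m * K) ⊆ T)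
    (i : Fin N) : Measurable[c.X.alg T] (c.err m i) :=
  ((h.measurable_grad i).comp (h.measurable_model hm hT)).sub
    (@MeasurableState.G Ω (c.X.alg T) N d _
      (h.measurableState ((Nat.mul_le_mul_right K hm).trans (Nat.div_mul_le_self R K)) hT) i)

/-- Besides the earlier rounds, a local iterate depends only on its own client's samples at earlier
steps. It does not depend on the draw of clients of its round, since iterates are defined for all
clients. -/
theorem measurable_iter {T : Set (Unit ⊕ Fin R ⊕ (Fin c.I × Fin N) ⊕ (Fin R × Fin c.I × Fin N))}
    (h : c.IsValid μ Δ L σ R) {r k : ℕ} (hr : r < R) (hk : k ≤ c.I) {i : Fin N}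
    (hT : drawsBefore N R c.I r ⊆ T)
    (hT' : ∀ l (hl : l < k),
      .inr (.inr (.inr (⟨r, hr⟩, ⟨l, hl.trans_le hk⟩, i))) ∈ T) :
    Measurable[c.X.alg T] (c.iter r k i) :=
  @MeasurableState.clientIterate Ω Ξ (c.X.alg T) _ N d c.p.stochGrad c.η h.adm.measurable_stochGrad
    _ (h.measurableState hr.le hT) (c.X.sample r) i k
    fun l hl => Draws.measurable_sample hr (hl.trans_le hk) (hT' l hl)

theorem drawsBefore_subset_drawsWithout {r s k : ℕ} {i : Fin N} {I : ℕ} (h : r ≤ s) :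
    drawsBefore N R I r ⊆ drawsWithout R I s k i := by
  rintro (_ | _ | _ | j) hj
  · trivial
  · trivial
  · trivial
  · exact .inl (lt_of_lt_of_le hj h)

theorem measurable_iter_drawsWithout (h : c.IsValid μ Δ L σ R) {r k : ℕ} (hr : r < R)
    (hk : k < c.I) (i : Fin N) :
    Measurable[c.X.alg (drawsWithout R c.I r k i)] (c.iter r k i) :=
  h.measurable_iter hr hk.le (drawsBefore_subset_drawsWithout le_rfl)
    fun _ hl => .inr ⟨rfl, .inr hl⟩

/-- Of two different samples, the noise of one does not depend on the other. -/
theorem measurable_noise_drawsWithout (h : c.IsValid μ Δ L σ R) {r k r' k' : ℕ}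
    (hr' : r' < R) (hk' : k' < c.I) {i i' : Fin N}
    (hlt : r' < r ∨ r' = r ∧ (i' ≠ i ∨ k' < k)) :
    Measurable[c.X.alg (drawsWithout R c.I r k i)] (c.noise r' k' i') := by
  have h1 : Measurable[c.X.alg (drawsWithout R c.I r k i)] (c.iter r' k' i') := by
    refine h.measurable_iter hr' hk'.le (drawsBefore_subset_drawsWithout ?_) fun _ hl => ?_
    · rcases hlt with h1 | h1
      · exact h1.le
      · exact h1.1.le
    · rcases hlt with h1 | ⟨h1, h2 | h2⟩
      · exact .inl h1
      · exact .inr ⟨h1, .inl h2⟩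
      · exact .inr ⟨h1, .inr (hl.trans h2)⟩
  have h2 : Measurable[c.X.alg (drawsWithout R c.I r k i)] (c.X.sample r' k' i') :=
    Draws.measurable_sample hr' hk' hlt
  exact @measurable_stochGrad_comp Ω Ξ (c.X.alg (drawsWithout R c.I r k i)) _ d _
    (h.measurable_gradError i') _ _ h1 h2

theorem measurable_noise (h : c.IsValid μ Δ L σ R) {r k : ℕ} (hr : r < R)
    (hk : k < c.I) (i : Fin N) : Measurable (c.noise r k i) :=
  measurable_stochGrad_comp (h.measurable_gradError i)
    ((h.measurable_iter_drawsWithout hr hk i).mono h.run.alg_le le_rfl)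
    (h.run.measurable_sample r hr k hk i)

variable [IsProbabilityMeasure μ]

/-- The coefficient may depend on all client draws, so participation indicators are allowed. This is
what yields the factor p for noises that are only used when the client is sampled. -/
theorem lintegral_smul_noise_le (h : c.IsValid μ Δ L σ R) {r k : ℕ} (hr : r < R)
    (hk : k < c.I) (i : Fin N) {a : Ω → ℝ}
    (ha : Measurable[c.X.alg (drawsWithout R c.I r k i)] a) :
    ∫⁻ ω, ‖a ω • c.noise r k i ω‖ₑ ^ 2 ∂μ ≤ ENNReal.ofReal (σ ^ 2) * ∫⁻ ω, ‖a ω‖ₑ ^ 2 ∂μ :=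
  lintegral_fresh_le h.run.alg_le (h.run.measurable_sample r hr k hk i)
    (h.run.indep_sample hr hk i) (h.measurable_gradError i)
    (fun x => by rw [h.run.law_sample r hr k hk i]; exact h.adm.variance_le i x)
    (h.measurable_iter_drawsWithout hr hk i) ha

theorem memLp_noise (h : c.IsValid μ Δ L σ R) {r k : ℕ} (hr : r < R)
    (hk : k < c.I) (i : Fin N) : MemLp (c.noise r k i) 2 μ := by
  refine ⟨(h.measurable_noise hr hk i).aestronglyMeasurable, ?_⟩
  rw [eLpNorm_lt_top_iff_lintegral_rpow_enorm_lt_top two_ne_zero ENNReal.ofNat_ne_top]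
  have h1 := h.lintegral_smul_noise_le hr hk i (a := fun _ => 1) measurable_const
  simp only [one_smul, enorm_one, one_pow, lintegral_const, measure_univ, mul_one] at h1
  simpa using h1.trans_lt ENNReal.ofReal_lt_top

theorem integral_inner_noise (h : c.IsValid μ Δ L σ R) {r k : ℕ} (hr : r < R)
    (hk : k < c.I) (i : Fin N) {b : Ω → Vec d}
    (hb : Measurable[c.X.alg (drawsWithout R c.I r k i)] b) (hb2 : MemLp b 2 μ) :
    ∫ ω, ⟪b ω, c.noise r k i ω⟫ ∂μ = 0 :=
  integral_inner_fresh_eq_zero h.run.alg_le (h.run.measurable_sample r hr k hk i)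
    (h.run.indep_sample hr hk i) (h.measurable_gradError i)
    (fun x => by rw [h.run.law_sample r hr k hk i]; exact (h.adm.integral_stochGrad_sub i x).1)
    (fun x => by rw [h.run.law_sample r hr k hk i]; exact (h.adm.integral_stochGrad_sub i x).2)
    (h.measurable_iter_drawsWithout hr hk i) hb hb2 (h.memLp_noise hr hk i)

theorem integral_smul_noise_sq_le (h : c.IsValid μ Δ L σ R) {r k : ℕ} (hr : r < R)
    (hk : k < c.I) (i : Fin N) {a : Ω → ℝ}
    (ha : Measurable[c.X.alg (drawsWithout R c.I r k i)] a) (ha2 : MemLp a 2 μ) :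
    ∫ ω, ‖a ω • c.noise r k i ω‖ ^ 2 ∂μ ≤ σ ^ 2 * ∫ ω, a ω ^ 2 ∂μ := by
  have h1 := h.lintegral_smul_noise_le hr hk i ha
  have hm : AEStronglyMeasurable (fun ω => ‖a ω • c.noise r k i ω‖ ^ 2) μ :=
    ((ha2.1.smul (h.measurable_noise hr hk i).aestronglyMeasurable).norm.pow 2)
  rw [integral_eq_lintegral_of_nonneg_ae (.of_forall fun ω => sq_nonneg _) hm]
  have h2 : ∫⁻ ω, ‖a ω‖ₑ ^ 2 ∂μ = ENNReal.ofReal (∫ ω, a ω ^ 2 ∂μ) := by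
    rw [ofReal_integral_eq_lintegral_ofReal ha2.integrable_sq (.of_forall fun ω => sq_nonneg _)]
    refine lintegral_congr fun ω => ?_
    rw [Real.enorm_eq_ofReal_abs, ← ENNReal.ofReal_pow (abs_nonneg _), sq_abs]
  have h3 : ∫⁻ ω, ENNReal.ofReal (‖a ω • c.noise r k i ω‖ ^ 2) ∂μ
      = ∫⁻ ω, ‖a ω • c.noise r k i ω‖ₑ ^ 2 ∂μ := by
    refine lintegral_congr fun ω => ?_
    rw [← ofReal_norm, ENNReal.ofReal_pow (norm_nonneg _)]
  rw [h3]
  refine ENNReal.toReal_le_of_le_ofReal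
    (mul_nonneg (sq_nonneg _) (integral_nonneg fun ω => sq_nonneg _)) ?_
  rwa [ENNReal.ofReal_mul (sq_nonneg _), ← h2]

end IsValid

end Setup

/-! ### Square-integrable random vectors -/

section SquareIntegrable

variable {Ω E : Type*} [MeasurableSpace Ω] [NormedAddCommGroup E] {μ : Measure Ω}

theorem integrable_norm_sq {u : Ω → E} (hu : MemLp u 2 μ) : Integrable (fun ω => ‖u ω‖ ^ 2) μ :=
  hu.norm.integrable_sq

theorem memLp_comp_of_norm_sub_le {E' : Type*} [NormedAddCommGroup E'] [IsFiniteMeasure μ]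
    {G : E → E'} {L : ℝ} (hG : ∀ x y, ‖G x - G y‖ ≤ L * ‖x - y‖) {u : Ω → E} (hu : MemLp u 2 μ) :
    MemLp (fun ω => G (u ω)) 2 μ := by
  refine MemLp.of_le ((memLp_const ‖G 0‖).add (hu.norm.const_mul L))
    ((continuous_of_norm_sub_le hG).comp_aestronglyMeasurable hu.1) (.of_forall fun ω => ?_)
  have h1 := norm_le_norm_add_norm_sub (G (u ω)) (G 0)
  have h2 := hG (u ω) 0
  rw [sub_zero] at h2
  refine le_trans ?_ (le_abs_self _)
  simp only [Pi.add_apply]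
  have h3 : ‖G (u ω)‖ ≤ ‖G 0‖ + ‖G (u ω) - G 0‖ := by
    have := norm_add_le (G 0) (G (u ω) - G 0)
    rwa [add_sub_cancel] at this
  linarith

theorem memLp_smul_of_abs_le_one [NormedSpace ℝ E] {a : Ω → ℝ} (ha : AEStronglyMeasurable a μ)
    (ha1 : ∀ ω, |a ω| ≤ 1) {u : Ω → E} (hu : MemLp u 2 μ) : MemLp (fun ω => a ω • u ω) 2 μ := by
  refine hu.of_le (ha.smul hu.1) (.of_forall fun ω => ?_)
  rw [norm_smul]
  exact mul_le_of_le_one_left (norm_nonneg _) (ha1 ω)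

/-- Pythagoras in L². -/
theorem integral_norm_sum_sq [InnerProductSpace ℝ E] {ι : Type*} (s : Finset ι) {u : ι → Ω → E}
    (hu : ∀ i ∈ s, MemLp (u i) 2 μ)
    (h0 : ∀ i ∈ s, ∀ j ∈ s, i ≠ j → ∫ ω, ⟪u i ω, u j ω⟫ ∂μ = 0) :
    ∫ ω, ‖∑ i ∈ s, u i ω‖ ^ 2 ∂μ = ∑ i ∈ s, ∫ ω, ‖u i ω‖ ^ 2 ∂μ := by
  simp only [← real_inner_self_eq_norm_sq, sum_inner, inner_sum]
  rw [integral_finsetSum _ fun i hi => integrable_finsetSum _ fun j hj =>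
    integrable_inner_of_memLp (hu j hj) (hu i hi)]
  refine Finset.sum_congr rfl fun i hi => ?_
  rw [integral_finsetSum _ fun j hj => integrable_inner_of_memLp (hu j hj) (hu i hi)]
  exact Finset.sum_eq_single_of_mem i hi fun j hj hji => h0 j hj i hi hji

end SquareIntegrable

/-! ### Decomposition of the update of a window. -/

namespace Setup

variable {Ω Ξ : Type*} [MeasurableSpace Ξ] {N K d : ℕ}

/-- The average noise of client `i` in the `m`-th window. -/
def avgNoise (c : Setup Ω Ξ N K d) (m : ℕ) (i : Fin N) (ω : Ω) : Vec d :=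
  (1 / (c.I : ℝ)) • ∑ k ∈ Finset.range c.I, c.noise (m * K + c.group i) k i ω

/-- The average effect on the gradient of client `i` of the drift of its local iterates. -/
def drift (c : Setup Ω Ξ N K d) (m : ℕ) (i : Fin N) (ω : Ω) : Vec d :=
  (1 / (c.I : ℝ)) • ∑ k ∈ Finset.range c.I,
    (c.grad i (c.iter (m * K + c.group i) k i ω) - c.grad i (c.model m ω))

/-- The noise in the update of the `m`-th window. -/
def noisePart (c : Setup Ω Ξ N K d) (m : ℕ) (ω : Ω) : Vec d :=
  ∑ i, (c.ind m i ω / (c.S * K)) • c.avgNoise m i ω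

/-- The drift in the update of the `m`-th window. -/
def driftPart (c : Setup Ω Ξ N K d) (m : ℕ) (ω : Ω) : Vec d :=
  ∑ i, (c.ind m i ω / (c.S * K)) • c.drift m i ω

/-- The contribution of the errors of the control variates to the update of the `m`-th window. -/
def errPart (c : Setup Ω Ξ N K d) (m : ℕ) (ω : Ω) : Vec d :=
  ∑ i, (c.ind m i ω / (c.S * K) - 1 / N) • c.err m i ω

/-- The update direction of the `m`-th window. -/
def dir (c : Setup Ω Ξ N K d) (m : ℕ) (ω : Ω) : Vec d :=
  c.meanGrad (c.model m ω) + c.errPart m ω + c.noisePart m ω + c.driftPart m ω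

/-- A bound for the distance of the local iterates of the `m`-th window to its first model. -/
def radius (c : Setup Ω Ξ N K d) (m : ℕ) (ω : Ω) : ℝ :=
  2 * c.η * (K * c.I * (‖c.meanGrad (c.model m ω)‖ + 2 * ∑ i, ‖c.err m i ω‖)
    + ∑ s ∈ Finset.range K, ∑ k ∈ Finset.range c.I, ∑ i, ‖c.noise (m * K + s) k i ω‖)

/-- The total effective step size of a window. -/
def step (c : Setup Ω Ξ N K d) : ℝ := c.γ * c.η * K * c.I

theorem ind_nonneg (c : Setup Ω Ξ N K d) (m : ℕ) (i : Fin N) (ω : Ω) : 0 ≤ c.ind m i ω :=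
  sampled_nonneg m i

theorem ind_le_one (c : Setup Ω Ξ N K d) (m : ℕ) (i : Fin N) (ω : Ω) : c.ind m i ω ≤ 1 :=
  sampled_le_one m i

theorem ind_sq (c : Setup Ω Ξ N K d) (m : ℕ) (i : Fin N) (ω : Ω) :
    c.ind m i ω ^ 2 = c.ind m i ω :=
  sampled_sq m i

theorem ind_eq_zero_or_one (c : Setup Ω Ξ N K d) (m : ℕ) (i : Fin N) (ω : Ω) :
    c.ind m i ω = 0 ∨ c.ind m i ω = 1 := by
  unfold ind sampled; split_ifs <;> simp

namespace IsValid

variable [mΩ : MeasurableSpace Ω] {μ : Measure Ω} {Δ L σ : ℝ} {R : ℕ}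
  {c : Setup Ω Ξ N K d}

theorem norm_meanGrad_sub_le (h : c.IsValid μ Δ L σ R) (x y : Vec d) :
    ‖c.meanGrad x - c.meanGrad y‖ ≤ L * ‖x - y‖ := by
  have hN : (0 : ℝ) < N := by exact_mod_cast (Nat.mul_pos h.hS h.hK).trans_le h.hSK
  rw [meanGrad, meanGrad, ← smul_sub, ← Finset.sum_sub_distrib, norm_smul,
    Real.norm_of_nonneg (by positivity)]
  calc _ ≤ 1 / (N : ℝ) * ∑ _i : Fin N, L * ‖x - y‖ := by
        gcongr
        exact norm_sum_le_of_le _ fun i _ => h.adm.smooth i x y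
    _ = L * ‖x - y‖ := by
        rw [Finset.sum_const, Finset.card_univ, Fintype.card_fin, nsmul_eq_mul]
        field_simp

/-- The event on which the sampled clients belong to the available groups. -/
def Good (c : Setup Ω Ξ N K d) (R : ℕ) (ω : Ω) : Prop :=
  ∀ r < R, c.X.clients r ω ∈ (available c.group r).powersetCard c.S

theorem ae_good [IsProbabilityMeasure μ] (h : c.IsValid μ Δ L σ R) : ∀ᵐ ω ∂μ, Good c R ω :=
  h.run.cyclic.ae_mem h.part h.hK h.hSK

/-- Each of the K groups contributes S sampled clients. This normalization lets the full gradient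
appear with coefficient one in the update. -/
theorem sum_ind (h : c.IsValid μ Δ L σ R) {m : ℕ} (hm : m < R / K) {ω : Ω} (hω : Good c R ω) :
    ∑ i, c.ind m i ω / (c.S * K) = 1 := by
  have hS : (0 : ℝ) < c.S := by exact_mod_cast h.hS
  have hK : (0 : ℝ) < K := by exact_mod_cast h.hK
  have h1 : ∑ i, c.ind m i ω = ∑ a : Fin K, (c.S : ℝ) := by
    rw [Finset.sum_congr rfl fun a _ => (sum_sampled_group hω hm a).symm, Finset.sum_comm]
    simp [ind]
  rw [← Finset.sum_div, h1]
  simp only [Finset.sum_const, Finset.card_univ, Fintype.card_fin, nsmul_eq_mul]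
  field_simp

theorem isWindow (h : c.IsValid μ Δ L σ R) (m : ℕ) (ω : Ω) :
    IsWindow c.p.stochGrad c.η K c.I (fun s => weight c.S (c.X.clients (m * K + s) ω))
      (fun s k i => c.X.sample (m * K + s) k i ω) (fun s => c.state (m * K + s) ω) :=
  isWindow_amplifiedScaffold (q := fun r => weight c.S (c.X.clients r ω))
    (ξ := fun r k i => c.X.sample r k i ω) h.hK c.x₀ _ m

theorem avgGrad_eq (h : c.IsValid μ Δ L σ R) (m : ℕ) (i : Fin N) (ω : Ω) :
    IsWindow.avgGrad c.p.stochGrad c.η c.I c.group (fun s k i => c.X.sample (m * K + s) k i ω)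
      (fun s => c.state (m * K + s) ω) i =
      c.grad i (c.model m ω) + c.avgNoise m i ω + c.drift m i ω := by
  have hI : (c.I : ℝ) ≠ 0 := by exact_mod_cast h.hI.ne'
  have h1 : c.grad i (c.model m ω)
      = (1 / (c.I : ℝ)) • ∑ _k ∈ Finset.range c.I, c.grad i (c.model m ω) := by
    rw [Finset.sum_const, Finset.card_range, ← Nat.cast_smul_eq_nsmul ℝ, smul_smul,
      one_div_mul_cancel hI, one_smul]
  rw [h1, IsWindow.avgGrad, avgNoise, drift, ← smul_add, ← smul_add, ← Finset.sum_add_distrib,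
    ← Finset.sum_add_distrib]
  congr 1
  refine Finset.sum_congr rfl fun k _ => ?_
  simp only [noise, gradError, iter]
  abel

/-- Since the weights sum to one, the mean control variate enters with coefficient one, and it
equals the full gradient minus the mean error. The errors thus carry the centred coefficients q̄ −
1/N. -/
theorem model_succ (h : c.IsValid μ Δ L σ R) {m : ℕ} (hm : m < R / K) {ω : Ω}
    (hω : Good c R ω) : c.model (m + 1) ω = c.model m ω - c.step • c.dir m ω := by
  have h1 := (h.isWindow m ω).x_windowUpdate (γ := c.γ) (χ := fun i => c.ind m i ω) h.hK h.hI h.hS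
    (fun s hs i => weight_eq_sampled hω hm hs i)
  have h2 : (c.state ((m + 1) * K) ω) = _ := amplifiedScaffold_window_end (g := c.p.stochGrad)
    (η := c.η) (γ := c.γ) (I := c.I) h.hK c.x₀ (fun r => weight c.S (c.X.clients r ω))
    (fun k i => c.X.initSample k i ω) (fun r k i => c.X.sample r k i ω) m
  have h3 : c.model (m + 1) ω = c.model m ω - c.step • ∑ i, (c.ind m i ω / (c.S * K)) •
      (IsWindow.avgGrad c.p.stochGrad c.η c.I c.group (fun s k i => c.X.sample (m * K + s) k i ω)
      (fun s => c.state (m * K + s) ω) i - (c.state (m * K) ω).G i + (c.state (m * K) ω).meanG) := by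
    rw [model, h2]
    exact h1
  rw [h3]
  congr 2
  have h4 : (c.state (m * K) ω).meanG =
      c.meanGrad (c.model m ω) - (1 / (N : ℝ)) • ∑ i, c.err m i ω := by
    rw [meanGrad, ← smul_sub, ← Finset.sum_sub_distrib, State.meanG]
    simp [err]
  rw [Finset.sum_congr rfl fun i _ => by
    rw [h.avgGrad_eq, show c.grad i (c.model m ω) + c.avgNoise m i ω + c.drift m i ω
      - (c.state (m * K) ω).G i + (c.state (m * K) ω).meanG = c.err m i ω + c.avgNoise m i ω
        + c.drift m i ω + (c.state (m * K) ω).meanG by rw [err]; abel, smul_add, smul_add, smul_add]]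
  rw [Finset.sum_add_distrib, ← Finset.sum_smul, h.sum_ind hm hω, one_smul, h4,
    Finset.sum_add_distrib, Finset.sum_add_distrib, dir, errPart, noisePart, driftPart]
  simp only [sub_smul, Finset.sum_sub_distrib, Finset.smul_sum]
  abel

/-- A sampled client discards its old error and takes on the noise and drift of its new average; any
other client keeps its error. In both cases the reference gradient moves with the model. -/
theorem err_succ (h : c.IsValid μ Δ L σ R) {m : ℕ} (hm : m < R / K) {ω : Ω}
    (hω : Good c R ω) (i : Fin N) : c.err (m + 1) i ω =
      (c.grad i (c.model (m + 1) ω) - c.grad i (c.model m ω)) +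
      ((1 - c.ind m i ω) • c.err m i ω - c.ind m i ω • (c.avgNoise m i ω + c.drift m i ω)) := by
  have h1 := (h.isWindow m ω).G_windowUpdate (γ := c.γ) (χ := fun i => c.ind m i ω) h.hK h.hS
    (fun i => c.ind_eq_zero_or_one m i ω) (fun s hs i => weight_eq_sampled hω hm hs i) i
  have h2 : (c.state ((m + 1) * K) ω) = _ := amplifiedScaffold_window_end (g := c.p.stochGrad)
    (η := c.η) (γ := c.γ) (I := c.I) h.hK c.x₀ (fun r => weight c.S (c.X.clients r ω))
    (fun k i => c.X.initSample k i ω) (fun r k i => c.X.sample r k i ω) m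
  have h3 : (c.state ((m + 1) * K) ω).G i = c.ind m i ω •
      (c.grad i (c.model m ω) + c.avgNoise m i ω + c.drift m i ω)
        + (1 - c.ind m i ω) • (c.state (m * K) ω).G i := by
    rw [h2, ← h.avgGrad_eq]
    exact h1
  rw [err, h3, err]
  module

/-- The local iterates stay within the radius. -/
theorem norm_iter_sub_le (h : c.IsValid μ Δ L σ R) (hη : 0 ≤ c.η)
    (hηL : 2 * (c.η * (K * c.I) * L) ≤ 1) {m : ℕ} (hm : m < R / K) {ω : Ω}
    (hω : Good c R ω) {s k : ℕ} (hs : s < K) (hk : k ≤ c.I) (i : Fin N) :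
    ‖c.iter (m * K + s) k i ω - c.model m ω‖ ≤ c.radius m ω := by
  have hS : (0 : ℝ) < c.S := by exact_mod_cast h.hS
  have hN : (0 : ℝ) < N := by exact_mod_cast (Nat.mul_pos h.hS h.hK).trans_le h.hSK
  have hN1 : (1 : ℝ) ≤ N := by exact_mod_cast (Nat.mul_pos h.hS h.hK).trans_le h.hSK
  refine (h.isWindow m ω).norm_clientIterate_sub_le (f := c.grad) (L := L) hη (fun s _ i => ?_)
    (fun s hs => ?_) h.hL (by positivity) h.adm.smooth hηL (fun i => ?_) le_rfl hs hk i
  · unfold weight; split_ifs <;> positivity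
  · have h1 := Finset.mem_powersetCard.1 (hω _ (round_lt hm hs))
    unfold weight
    rw [Finset.sum_ite_mem, Finset.univ_inter, Finset.sum_const, h1.2, nsmul_eq_mul]
    field_simp
  · have h4 : (c.state (m * K) ω).meanG =
        c.meanGrad (c.model m ω) - (1 / (N : ℝ)) • ∑ i, c.err m i ω := by
      rw [meanGrad, ← smul_sub, ← Finset.sum_sub_distrib, State.meanG]
      simp [err]
    -- In terms of errors, the corrected direction at the first model is the full gradient plus the
    -- client's error minus the mean error. The gap between ∇f_i and ∇f cancels.
    have h5 : c.grad i (c.model m ω) + ((c.state (m * K) ω).meanG - (c.state (m * K) ω).G i)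
        = c.meanGrad (c.model m ω) + (c.err m i ω - (1 / (N : ℝ)) • ∑ i, c.err m i ω) := by
      rw [h4, err]; abel
    change ‖c.grad i (c.model m ω) + ((c.state (m * K) ω).meanG - (c.state (m * K) ω).G i)‖ ≤ _
    rw [h5]
    refine (norm_add_le _ _).trans (add_le_add le_rfl ((norm_sub_le _ _).trans ?_))
    rw [two_mul, norm_smul, Real.norm_of_nonneg (by positivity)]
    refine add_le_add (Finset.single_le_sum (f := fun i => ‖c.err m i ω‖)
      (fun j _ => norm_nonneg _) (Finset.mem_univ i)) ?_
    have h6 : 1 / (N : ℝ) ≤ 1 := by rw [div_le_one hN]; exact hN1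
    calc _ ≤ 1 * ∑ i, ‖c.err m i ω‖ := by gcongr; exact norm_sum_le _ _
      _ = _ := one_mul _

theorem norm_drift_le (h : c.IsValid μ Δ L σ R) (hη : 0 ≤ c.η)
    (hηL : 2 * (c.η * (K * c.I) * L) ≤ 1) {m : ℕ} (hm : m < R / K) {ω : Ω}
    (hω : Good c R ω) (i : Fin N) : ‖c.drift m i ω‖ ≤ L * c.radius m ω := by
  have hI : (0 : ℝ) < c.I := by exact_mod_cast h.hI
  have hL := h.hL
  rw [drift, norm_smul, Real.norm_of_nonneg (by positivity)]
  calc _ ≤ 1 / (c.I : ℝ) * ∑ _k ∈ Finset.range c.I, L * c.radius m ω := by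
        gcongr
        refine norm_sum_le_of_le _ fun k hk => (h.adm.smooth i _ _).trans ?_
        gcongr
        exact h.norm_iter_sub_le hη hηL hm hω (c.group i).2 (Finset.mem_range.1 hk).le i
    _ = _ := by
        rw [Finset.sum_const, Finset.card_range, nsmul_eq_mul]
        field_simp

theorem norm_driftPart_le (h : c.IsValid μ Δ L σ R) (hη : 0 ≤ c.η)
    (hηL : 2 * (c.η * (K * c.I) * L) ≤ 1) {m : ℕ} (hm : m < R / K) {ω : Ω}
    (hω : Good c R ω) : ‖c.driftPart m ω‖ ≤ L * c.radius m ω := by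
  calc _ ≤ ∑ i, (c.ind m i ω / (c.S * K)) * (L * c.radius m ω) := by
        refine norm_sum_le_of_le _ fun i _ => ?_
        have h0 : 0 ≤ c.ind m i ω / (c.S * K) := div_nonneg (c.ind_nonneg m i ω) (by positivity)
        rw [norm_smul, Real.norm_of_nonneg h0]
        exact mul_le_mul_of_nonneg_left (h.norm_drift_le hη hηL hm hω i) h0
    _ = _ := by rw [← Finset.sum_mul, h.sum_ind hm hω, one_mul]

end IsValid

end Setup

/-! ### Second moments in a window -/

namespace Setup

variable {Ω Ξ : Type*} [MeasurableSpace Ξ] {N K d : ℕ}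

/-- The probability that a client is sampled in a window. -/
def prob (c : Setup Ω Ξ N K d) : ℝ := c.S * K / N

/-- Expected squared gradient at the start of the `m`-th window. -/
def gradSq [MeasurableSpace Ω] (c : Setup Ω Ξ N K d) (μ : Measure Ω) (m : ℕ) : ℝ :=
  ∫ ω, ‖c.meanGrad (c.model m ω)‖ ^ 2 ∂μ

/-- Average expected squared error of the control variates at the start of the `m`-th window. -/
def errSq [MeasurableSpace Ω] (c : Setup Ω Ξ N K d) (μ : Measure Ω) (m : ℕ) : ℝ :=
  (1 / (N : ℝ)) * ∑ i, ∫ ω, ‖c.err m i ω‖ ^ 2 ∂μ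

theorem abs_ind_le_one (c : Setup Ω Ξ N K d) (m : ℕ) (i : Fin N) (ω : Ω) :
    |c.ind m i ω| ≤ 1 := by
  rw [abs_of_nonneg (c.ind_nonneg m i ω)]; exact c.ind_le_one m i ω

/-- A flat sum over pairs of client and step, ready for the orthogonality of the individual noises.
-/
theorem noisePart_eq (c : Setup Ω Ξ N K d) (m : ℕ) (ω : Ω) : c.noisePart m ω =
    (1 / (c.S * K * c.I : ℝ)) • ∑ j ∈ Finset.univ ×ˢ Finset.range c.I,
        c.ind m j.1 ω • c.noise (m * K + c.group j.1) j.2 j.1 ω := by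
  rw [Finset.sum_product, Finset.smul_sum, noisePart]
  refine Finset.sum_congr rfl fun i _ => ?_
  dsimp only
  rw [avgNoise, smul_smul, ← Finset.smul_sum, smul_smul]
  congr 1
  rw [mul_one_div, div_div, one_div_mul_eq_div]

namespace IsValid

variable [mΩ : MeasurableSpace Ω] {μ : Measure Ω} {Δ L σ : ℝ} {R : ℕ}
  {c : Setup Ω Ξ N K d}

theorem one_le_S (h : c.IsValid μ Δ L σ R) : (1 : ℝ) ≤ c.S := by exact_mod_cast h.hS
theorem one_le_K (h : c.IsValid μ Δ L σ R) : (1 : ℝ) ≤ K := by exact_mod_cast h.hK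
theorem one_le_I (h : c.IsValid μ Δ L σ R) : (1 : ℝ) ≤ c.I := by exact_mod_cast h.hI
theorem S_mul_K_le (h : c.IsValid μ Δ L σ R) : (c.S * K : ℝ) ≤ N := by exact_mod_cast h.hSK
theorem one_le_N (h : c.IsValid μ Δ L σ R) : (1 : ℝ) ≤ N := by
  exact_mod_cast (Nat.mul_pos h.hS h.hK).trans_le h.hSK

theorem prob_pos (h : c.IsValid μ Δ L σ R) : 0 < c.prob := by
  have h1 := h.one_le_S; have h2 := h.one_le_K; have h3 := h.one_le_N
  unfold prob; positivity

theorem prob_le_one (h : c.IsValid μ Δ L σ R) : c.prob ≤ 1 := by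
  have h3 := h.one_le_N
  unfold prob
  rw [div_le_one (by positivity)]
  exact h.S_mul_K_le

theorem measurable_ind' (h : c.IsValid μ Δ L σ R) {m : ℕ} (hm : m < R / K) (i : Fin N) :
    Measurable (c.ind m i) :=
  h.run.cyclic.measurable_sampled hm i

theorem measurable_model' (h : c.IsValid μ Δ L σ R) {m : ℕ} (hm : m ≤ R / K) :
    Measurable (c.model m) :=
  (h.measurable_model hm (Set.subset_univ _)).mono h.run.alg_le le_rfl

theorem measurable_meanGrad (h : c.IsValid μ Δ L σ R) : Measurable c.meanGrad :=
  (continuous_of_norm_sub_le h.norm_meanGrad_sub_le).measurable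

theorem memLp_ind_smul (h : c.IsValid μ Δ L σ R) {m : ℕ} (hm : m < R / K) (i : Fin N)
    {u : Ω → Vec d} (hu : MemLp u 2 μ) : MemLp (fun ω => c.ind m i ω • u ω) 2 μ :=
  memLp_smul_of_abs_le_one (h.measurable_ind' hm i).aestronglyMeasurable (c.abs_ind_le_one m i) hu

theorem memLp_ind_div_smul (h : c.IsValid μ Δ L σ R) {m : ℕ} (hm : m < R / K) (i : Fin N)
    {u : Ω → Vec d} (hu : MemLp u 2 μ) :
    MemLp (fun ω => (c.ind m i ω / (c.S * K)) • u ω) 2 μ := by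
  have hSK := one_le_mul_of_one_le_of_one_le h.one_le_S h.one_le_K
  refine memLp_smul_of_abs_le_one ((h.measurable_ind' hm i).div_const _).aestronglyMeasurable
    (fun ω => ?_) hu
  rw [abs_div, abs_of_pos (zero_lt_one.trans_le hSK), div_le_one (zero_lt_one.trans_le hSK)]
  exact (c.abs_ind_le_one m i ω).trans hSK

variable [IsProbabilityMeasure μ]

theorem integral_ind (h : c.IsValid μ Δ L σ R) {m : ℕ} (hm : m < R / K) (i : Fin N) :
    ∫ ω, c.ind m i ω ∂μ = c.prob :=
  h.run.cyclic.integral_sampled h.part h.hK h.hS h.hSK hm i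

theorem memLp_ind (h : c.IsValid μ Δ L σ R) {m : ℕ} (hm : m < R / K) (i : Fin N) :
    MemLp (c.ind m i) 2 μ :=
  MemLp.of_bound (h.measurable_ind' hm i).aestronglyMeasurable 1
    (.of_forall fun ω => c.abs_ind_le_one m i ω)

theorem memLp_meanGrad (h : c.IsValid μ Δ L σ R) {m : ℕ} (hx : MemLp (c.model m) 2 μ) :
    MemLp (fun ω => c.meanGrad (c.model m ω)) 2 μ :=
  memLp_comp_of_norm_sub_le h.norm_meanGrad_sub_le hx

/-! #### Noise -/

/-- Both indicators are moved to the side of the noise with index `i'`. That side does not involve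
the sample of client `i` at step `k`, so the other noise is fresh and centred. -/
theorem integral_inner_ind_noise (h : c.IsValid μ Δ L σ R) {m : ℕ} (hm : m < R / K) {i i' : Fin N}
    {k k' : ℕ} (hk : k < c.I) (hk' : k' < c.I)
    (hlt : m * K + c.group i' < m * K + c.group i ∨
      (m * K + c.group i' : ℕ) = m * K + c.group i ∧ (i' ≠ i ∨ k' < k)) :
    ∫ ω, ⟪c.ind m i' ω • c.noise (m * K + c.group i') k' i' ω,
      c.ind m i ω • c.noise (m * K + c.group i) k i ω⟫ ∂μ = 0 := by
  have hr := round_lt hm (c.group i).2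
  have hr' := round_lt hm (c.group i').2
  have h1 : ∀ ω, ⟪c.ind m i' ω • c.noise (m * K + c.group i') k' i' ω,
      c.ind m i ω • c.noise (m * K + c.group i) k i ω⟫ =
      ⟪c.ind m i ω • c.ind m i' ω • c.noise (m * K + c.group i') k' i' ω,
        c.noise (m * K + c.group i) k i ω⟫ := by
    intro ω
    rw [inner_smul_right, inner_smul_left (r := c.ind m i ω)]
    rfl
  simp only [h1]
  refine h.integral_inner_noise hr hk i ?_
    (h.memLp_ind_smul hm i (h.memLp_ind_smul hm i' (h.memLp_noise hr' hk' i')))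
  have h2 := h.measurable_noise_drawsWithout (r := m * K + c.group i) (k := k) (i := i) hr' hk' hlt
  have h3 : Measurable[c.X.alg (drawsWithout R c.I (m * K + c.group i) k i)] (c.ind m i) :=
    measurable_ind hm trivial
  have h4 : Measurable[c.X.alg (drawsWithout R c.I (m * K + c.group i) k i)] (c.ind m i') :=
    measurable_ind hm trivial
  exact h3.smul (h4.smul h2)

theorem integral_norm_sum_noise_sq (h : c.IsValid μ Δ L σ R) {m : ℕ} (hm : m < R / K)
    (s : Finset (Fin N × ℕ)) (hs : ∀ j ∈ s, j.2 < c.I) :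
    ∫ ω, ‖∑ j ∈ s, c.ind m j.1 ω • c.noise (m * K + c.group j.1) j.2 j.1 ω‖ ^ 2 ∂μ
      ≤ s.card * (σ ^ 2 * c.prob) := by
  rw [integral_norm_sum_sq s fun j hj =>
    h.memLp_ind_smul hm j.1 (h.memLp_noise (round_lt hm (c.group j.1).2) (hs j hj) j.1)]
  · rw [← nsmul_eq_mul]
    refine Finset.sum_le_card_nsmul _ _ _ fun j hj => ?_
    have h1 := h.integral_smul_noise_sq_le (round_lt hm (c.group j.1).2) (hs j hj) j.1
      (a := c.ind m j.1) (measurable_ind hm trivial) (h.memLp_ind hm j.1)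
    simpa only [ind_sq, h.integral_ind hm] using h1
  · rintro ⟨i', k'⟩ hj' ⟨i, k⟩ hj hne
    have hk := hs _ hj
    have hk' := hs _ hj'
    -- Of two distinct noises, one always does not involve the other's sample: order by rounds, then
    -- by steps for one client. For two clients in the same round either order works.
    rcases lt_trichotomy (m * K + (c.group i' : ℕ)) (m * K + c.group i) with hlt | heq | hgt
    · exact h.integral_inner_ind_noise hm hk hk' (.inl hlt)
    · by_cases hi : i' = i
      · subst hi
        have hkk : k' ≠ k := fun hk => hne (by rw [hk])
        rcases hkk.lt_or_gt with hlt | hgt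
        · exact h.integral_inner_ind_noise hm hk hk' (.inr ⟨rfl, .inr hlt⟩)
        · have h1 := h.integral_inner_ind_noise hm (i := i') (i' := i') hk' hk
            (.inr ⟨rfl, .inr hgt⟩)
          simpa only [real_inner_comm] using h1
      · exact h.integral_inner_ind_noise hm hk hk' (.inr ⟨heq, .inl hi⟩)
    · have h1 := h.integral_inner_ind_noise hm (i := i') (i' := i) hk' hk (.inl hgt)
      simpa only [real_inner_comm] using h1

theorem memLp_avgNoise (h : c.IsValid μ Δ L σ R) {m : ℕ} (hm : m < R / K) (i : Fin N) :
    MemLp (c.avgNoise m i) 2 μ :=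
  (memLp_finsetSum (f := fun k => c.noise (m * K + c.group i) k i) _ fun _ hk =>
    h.memLp_noise (round_lt hm (c.group i).2) (Finset.mem_range.1 hk) i).const_smul (1 / (c.I : ℝ))

theorem integral_ind_avgNoise_sq_le (h : c.IsValid μ Δ L σ R) {m : ℕ} (hm : m < R / K)
    (i : Fin N) :
    ∫ ω, ‖c.ind m i ω • c.avgNoise m i ω‖ ^ 2 ∂μ ≤ c.prob * (σ ^ 2 / c.I) := by
  have hI := h.one_le_I
  have h1 := h.integral_norm_sum_noise_sq hm ({i} ×ˢ Finset.range c.I)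
    fun j hj => Finset.mem_range.1 (Finset.mem_product.1 hj).2
  have h2 : ∀ ω, ‖c.ind m i ω • c.avgNoise m i ω‖ ^ 2 = (1 / (c.I : ℝ)) ^ 2 *
      ‖∑ j ∈ {i} ×ˢ Finset.range c.I,
        c.ind m j.1 ω • c.noise (m * K + c.group j.1) j.2 j.1 ω‖ ^ 2 := by
    intro ω
    rw [Finset.sum_product, Finset.sum_singleton]
    dsimp only
    rw [← Finset.smul_sum, avgNoise, smul_comm,
      norm_smul, mul_pow, Real.norm_of_nonneg (by positivity)]
  simp only [h2]
  rw [integral_const_mul]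
  calc _ ≤ (1 / (c.I : ℝ)) ^ 2 * (({i} ×ˢ Finset.range c.I : Finset (Fin N × ℕ)).card
        * (σ ^ 2 * c.prob)) := by gcongr
    _ = _ := by
      rw [Finset.card_product, Finset.card_singleton, Finset.card_range, one_mul]
      field_simp

theorem memLp_noisePart (h : c.IsValid μ Δ L σ R) {m : ℕ} (hm : m < R / K) :
    MemLp (c.noisePart m) 2 μ := by
  exact memLp_finsetSum (f := fun i ω => (c.ind m i ω / (c.S * K)) • c.avgNoise m i ω) _
    fun i _ => h.memLp_ind_div_smul hm i (h.memLp_avgNoise hm i)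

/-- There are NI orthogonal terms, each active with probability SK/N, and a prefactor 1/(SKI)². This
is the source of the linear speedup in S. -/
theorem integral_noisePart_sq_le (h : c.IsValid μ Δ L σ R) {m : ℕ} (hm : m < R / K) :
    ∫ ω, ‖c.noisePart m ω‖ ^ 2 ∂μ ≤ σ ^ 2 / (c.S * K * c.I) := by
  have hI := h.one_le_I
  have hS := h.one_le_S
  have hK := h.one_le_K
  have hN := h.one_le_N
  have h1 := h.integral_norm_sum_noise_sq hm (Finset.univ ×ˢ Finset.range c.I)
    fun j hj => Finset.mem_range.1 (Finset.mem_product.1 hj).2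
  simp only [noisePart_eq, norm_smul, mul_pow]
  rw [integral_const_mul]
  calc _ ≤ ‖1 / (c.S * K * c.I : ℝ)‖ ^ 2 *
        ((Finset.univ ×ˢ Finset.range c.I : Finset (Fin N × ℕ)).card * (σ ^ 2 * c.prob)) := by
        gcongr
    _ = _ := by
      rw [Finset.card_product, Finset.card_univ, Fintype.card_fin, Finset.card_range,
        Real.norm_of_nonneg (by positivity), prob]
      push_cast
      field_simp

theorem integral_inner_noisePart (h : c.IsValid μ Δ L σ R) {m : ℕ} (hm : m < R / K)
    (hx : MemLp (c.model m) 2 μ) :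
    ∫ ω, ⟪c.meanGrad (c.model m ω), c.noisePart m ω⟫ ∂μ = 0 := by
  have hn : ∀ j ∈ (Finset.univ ×ˢ Finset.range c.I : Finset (Fin N × ℕ)),
      MemLp (c.noise (m * K + c.group j.1) j.2 j.1) 2 μ := fun j hj =>
    h.memLp_noise (round_lt hm (c.group j.1).2)
      (Finset.mem_range.1 (Finset.mem_product.1 hj).2) j.1
  simp only [noisePart_eq, inner_smul_right, inner_sum]
  rw [integral_const_mul, integral_finsetSum]
  · rw [Finset.sum_eq_zero, mul_zero]
    intro j hj
    have h1 : ∀ ω, c.ind m j.1 ω * ⟪c.meanGrad (c.model m ω),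
        c.noise (m * K + c.group j.1) j.2 j.1 ω⟫ =
        ⟪c.ind m j.1 ω • c.meanGrad (c.model m ω), c.noise (m * K + c.group j.1) j.2 j.1 ω⟫ :=
      fun ω => by rw [inner_smul_left]; rfl
    simp only [h1]
    refine h.integral_inner_noise (round_lt hm (c.group j.1).2)
      (Finset.mem_range.1 (Finset.mem_product.1 hj).2) j.1 ?_
      (h.memLp_ind_smul hm j.1 (h.memLp_meanGrad hx))
    have h3 : Measurable[c.X.alg (drawsWithout R c.I (m * K + c.group j.1) j.2 j.1)]
      (c.ind m j.1) := measurable_ind hm trivial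
    exact h3.smul (h.measurable_meanGrad.comp (h.measurable_model hm.le
      (drawsBefore_subset_drawsWithout (Nat.le_add_right _ _))))
  · intro j hj
    have h1 := integrable_inner_of_memLp (h.memLp_meanGrad hx) (h.memLp_ind_smul hm j.1 (hn j hj))
    simpa only [inner_smul_right] using h1

end IsValid

end Setup

/-- Collecting the vectors by the value of `g` turns the double sum into a sum of squared norms. It
allows the within-group correlation of the draws to be dropped. -/
theorem sum_inner_same_nonneg {ι κ E : Type*} [Fintype ι] [Fintype κ] [DecidableEq κ]
    [NormedAddCommGroup E] [InnerProductSpace ℝ E] (g : ι → κ) (a : ι → E) :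
    0 ≤ ∑ j, ∑ i, (if g i = g j then (1 : ℝ) else 0) * ⟪a i, a j⟫ := by
  have h : ∑ j, ∑ i, (if g i = g j then (1 : ℝ) else 0) * ⟪a i, a j⟫ =
      ∑ t, ‖∑ i, (if g i = t then (1 : ℝ) else 0) • a i‖ ^ 2 := by
    simp only [← real_inner_self_eq_norm_sq, sum_inner, inner_sum, inner_smul_left,
      inner_smul_right, conj_trivial]
    refine Eq.symm ?_
    rw [Finset.sum_comm]
    refine Finset.sum_congr rfl fun j _ => ?_
    simp only [ite_mul, one_mul, zero_mul, Finset.sum_ite_eq, Finset.mem_univ, if_true]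
  rw [h]
  positivity

/-! ### Moments of the control-variate errors and of the drift. -/

namespace Setup

variable {Ω Ξ : Type*} [MeasurableSpace Ξ] {N K d : ℕ}

/-- The draws of clients from round `r` on. -/
def clientsFrom (N R I r : ℕ) : Set (Unit ⊕ Fin R ⊕ (Fin I × Fin N) ⊕ (Fin R × Fin I × Fin N)) :=
  {j | Sum.elim (fun _ => False) (Sum.elim (fun s : Fin R => r ≤ (s : ℕ))
    (Sum.elim (fun _ => False) (fun _ => False))) j}

theorem disjoint_clientsFrom (N R I r : ℕ) :
    Disjoint (clientsFrom N R I r) (drawsBefore N R I r) := by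
  rw [Set.disjoint_left]
  rintro (_ | s | _ | _) h1 h2
  · exact h1
  · exact not_lt.2 (show r ≤ (s : ℕ) from h1) h2
  · exact h1
  · exact h1

theorem measurable_ind_clientsFrom {R : ℕ} {c : Setup Ω Ξ N K d} {m : ℕ} (hm : m < R / K)
    (i : Fin N) : Measurable[c.X.alg (clientsFrom N R c.I (m * K))] (c.ind m i) :=
  measurable_ind hm (Nat.le_add_right _ _)

namespace IsValid

variable [mΩ : MeasurableSpace Ω] {μ : Measure Ω} {Δ L σ : ℝ} {R : ℕ}
  {c : Setup Ω Ξ N K d}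

/-! #### Errors of the control variates -/

/-- The clients drawn in a window are independent of everything before it, hence of its first model
and control variates. -/
theorem integral_clients_mul (h : c.IsValid μ Δ L σ R) {m : ℕ}
    {f g : Ω → ℝ} (hf : Measurable[c.X.alg (clientsFrom N R c.I (m * K))] f)
    (hg : Measurable[c.X.alg (drawsBefore N R c.I (m * K))] g) :
    ∫ ω, f ω * g ω ∂μ = (∫ ω, f ω ∂μ) * ∫ ω, g ω ∂μ :=
  integral_mul_of_indep h.run.alg_le h.run.alg_le
    (h.run.indep_alg (disjoint_clientsFrom N R c.I (m * K))) hf hg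

theorem ind_div_sub (h : c.IsValid μ Δ L σ R) (m : ℕ) (i : Fin N) (ω : Ω) :
    c.ind m i ω / (c.S * K) - 1 / N = (1 / (c.S * K)) * (c.ind m i ω - c.prob) := by
  have hS := h.one_le_S
  have hK := h.one_le_K
  have hN := h.one_le_N
  unfold prob
  field_simp

theorem errPart_eq (h : c.IsValid μ Δ L σ R) (m : ℕ) (ω : Ω) : c.errPart m ω =
    (1 / (c.S * K : ℝ)) • ∑ i, (c.ind m i ω - c.prob) • c.err m i ω := by
  rw [errPart, Finset.smul_sum]
  exact Finset.sum_congr rfl fun i _ => by rw [h.ind_div_sub, mul_smul]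

theorem abs_ind_sub_prob_le (h : c.IsValid μ Δ L σ R) (m : ℕ) (i : Fin N) (ω : Ω) :
    |c.ind m i ω - c.prob| ≤ 1 := by
  have h1 := c.ind_nonneg m i ω
  have h2 := c.ind_le_one m i ω
  have h3 := h.prob_pos
  have h4 := h.prob_le_one
  rw [abs_le]; constructor <;> linarith

theorem memLp_ind_sub_smul (h : c.IsValid μ Δ L σ R) {m : ℕ} (hm : m < R / K) (i : Fin N)
    {u : Ω → Vec d} (hu : MemLp u 2 μ) :
    MemLp (fun ω => (c.ind m i ω - c.prob) • u ω) 2 μ :=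
  memLp_smul_of_abs_le_one ((h.measurable_ind' hm i).sub_const _).aestronglyMeasurable
    (h.abs_ind_sub_prob_le m i) hu

theorem memLp_errPart (h : c.IsValid μ Δ L σ R) {m : ℕ} (hm : m < R / K)
    (he : ∀ i, MemLp (c.err m i) 2 μ) : MemLp (c.errPart m) 2 μ := by
  have h1 : MemLp (fun ω => ∑ i, (c.ind m i ω - c.prob) • c.err m i ω) 2 μ :=
    memLp_finsetSum (f := fun i ω => (c.ind m i ω - c.prob) • c.err m i ω) _
      fun i _ => h.memLp_ind_sub_smul hm i (he i)
  rw [funext (h.errPart_eq m)]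
  exact h1.const_smul (1 / (c.S * K : ℝ))

variable [IsProbabilityMeasure μ]

theorem integral_inner_errPart (h : c.IsValid μ Δ L σ R) {m : ℕ} (hm : m < R / K)
    (hx : MemLp (c.model m) 2 μ) (he : ∀ i, MemLp (c.err m i) 2 μ) :
    ∫ ω, ⟪c.meanGrad (c.model m ω), c.errPart m ω⟫ ∂μ = 0 := by
  simp only [h.errPart_eq, inner_smul_right (r := (1 / (c.S * K) : ℝ)), inner_sum]
  rw [integral_const_mul, integral_finsetSum]
  · rw [Finset.sum_eq_zero, mul_zero]
    intro i _
    simp only [inner_smul_right]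
    have h1 : Measurable[c.X.alg (drawsBefore N R c.I (m * K))]
        fun ω => ⟪c.meanGrad (c.model m ω), c.err m i ω⟫ :=
      Measurable.inner (h.measurable_meanGrad.comp (h.measurable_model hm.le subset_rfl))
        (h.measurable_err hm.le subset_rfl i)
    have h2 : Measurable[c.X.alg (clientsFrom N R c.I (m * K))] fun ω => c.ind m i ω - c.prob :=
      (measurable_ind_clientsFrom hm i).sub_const _
    rw [h.integral_clients_mul h2 h1, integral_sub ((h.memLp_ind hm i).integrable one_le_two)
      (integrable_const _), h.integral_ind hm]
    simp
  · intro i _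
    exact integrable_inner_of_memLp (h.memLp_meanGrad hx) (h.memLp_ind_sub_smul hm i (he i))

/-- By independence, only the covariances of the indicators and the inner products of the errors
matter. The covariance is a diagonal part at most p minus a nonnegative same-group part, which is
dropped, and p/(SK)² = 1/(SKN). -/
theorem integral_errPart_sq_le (h : c.IsValid μ Δ L σ R) {m : ℕ} (hm : m < R / K)
    (he : ∀ i, MemLp (c.err m i) 2 μ) :
    ∫ ω, ‖c.errPart m ω‖ ^ 2 ∂μ ≤ c.errSq μ m / (c.S * K) := by
  have hS := h.one_le_S
  have hK := h.one_le_K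
  have hN := h.one_le_N
  obtain ⟨a, b, ha, hb, hcov⟩ := h.run.cyclic.exists_covariance h.part h.hK h.hS h.hSK hm
  have hI : ∀ i j, Integrable (fun ω => ⟪c.err m i ω, c.err m j ω⟫) μ := fun i j =>
    integrable_inner_of_memLp (he i) (he j)
  have h1 : ∀ i j, ∫ ω, ⟪(c.ind m i ω - c.prob) • c.err m i ω,
      (c.ind m j ω - c.prob) • c.err m j ω⟫ ∂μ =
      (a * (if i = j then 1 else 0) - b * (if c.group i = c.group j then 1 else 0)) *
        ∫ ω, ⟪c.err m i ω, c.err m j ω⟫ ∂μ := by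
    intro i j
    have h2 : Measurable[c.X.alg (drawsBefore N R c.I (m * K))]
        fun ω => ⟪c.err m i ω, c.err m j ω⟫ :=
      Measurable.inner (h.measurable_err hm.le subset_rfl i) (h.measurable_err hm.le subset_rfl j)
    have h3 : Measurable[c.X.alg (clientsFrom N R c.I (m * K))]
        fun ω => (c.ind m i ω - c.prob) * (c.ind m j ω - c.prob) :=
      ((measurable_ind_clientsFrom hm i).sub_const _).mul
        ((measurable_ind_clientsFrom hm j).sub_const _)
    rw [← hcov i j]
    rw [show (∫ ω, (sampled c.group c.X.clients m i ω - (c.S * K : ℝ) / N) *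
      (sampled c.group c.X.clients m j ω - (c.S * K : ℝ) / N) ∂μ) =
      ∫ ω, (c.ind m i ω - c.prob) * (c.ind m j ω - c.prob) ∂μ from rfl,
      ← h.integral_clients_mul h3 h2]
    refine integral_congr_ae (.of_forall fun ω => ?_)
    simp only [inner_smul_left, inner_smul_right, conj_trivial]
    ring
  have h4 : ∫ ω, ‖∑ i, (c.ind m i ω - c.prob) • c.err m i ω‖ ^ 2 ∂μ =
      ∑ j, ∑ i, (a * (if i = j then 1 else 0) - b * (if c.group i = c.group j then 1 else 0)) *
        ∫ ω, ⟪c.err m i ω, c.err m j ω⟫ ∂μ := by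
    simp only [← real_inner_self_eq_norm_sq, sum_inner, inner_sum]
    have h5 : ∀ i j, Integrable (fun ω => ⟪(c.ind m i ω - c.prob) • c.err m i ω,
      (c.ind m j ω - c.prob) • c.err m j ω⟫) μ := fun i j =>
      integrable_inner_of_memLp (h.memLp_ind_sub_smul hm i (he i))
        (h.memLp_ind_sub_smul hm j (he j))
    rw [integral_finsetSum _ fun j _ => integrable_finsetSum _ fun i _ => h5 i j]
    refine Finset.sum_congr rfl fun j _ => ?_
    rw [integral_finsetSum _ fun i _ => h5 i j]
    exact Finset.sum_congr rfl fun i _ => h1 i j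
  have h6 : 0 ≤ ∑ j, ∑ i, (if c.group i = c.group j then (1 : ℝ) else 0) *
      ∫ ω, ⟪c.err m i ω, c.err m j ω⟫ ∂μ := by
    have h7 : ∑ j, ∑ i, (if c.group i = c.group j then (1 : ℝ) else 0) *
        ∫ ω, ⟪c.err m i ω, c.err m j ω⟫ ∂μ =
        ∫ ω, ∑ j, ∑ i, (if c.group i = c.group j then (1 : ℝ) else 0) *
          ⟪c.err m i ω, c.err m j ω⟫ ∂μ := by
      rw [integral_finsetSum _ fun j _ => integrable_finsetSum _ fun i _ => (hI i j).const_mul _]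
      refine Finset.sum_congr rfl fun j _ => ?_
      rw [integral_finsetSum _ fun i _ => (hI i j).const_mul _]
      exact Finset.sum_congr rfl fun i _ => (integral_const_mul _ _).symm
    rw [h7]
    refine integral_nonneg fun ω => ?_
    exact sum_inner_same_nonneg c.group fun i => c.err m i ω
  simp only [h.errPart_eq, norm_smul, mul_pow]
  rw [integral_const_mul, h4]
  have h9 : ∑ j, ∑ i, (a * (if i = j then 1 else 0) -
      b * (if c.group i = c.group j then 1 else 0)) * ∫ ω, ⟪c.err m i ω, c.err m j ω⟫ ∂μ =
      a * ∑ j, ∫ ω, ‖c.err m j ω‖ ^ 2 ∂μ -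
      b * ∑ j, ∑ i, (if c.group i = c.group j then (1 : ℝ) else 0) *
      ∫ ω, ⟪c.err m i ω, c.err m j ω⟫ ∂μ := by
    simp only [sub_mul, Finset.sum_sub_distrib, mul_assoc, Finset.mul_sum, ite_mul, one_mul,
      zero_mul, mul_ite, mul_zero, Finset.sum_ite_eq', Finset.mem_univ, if_true,
      real_inner_self_eq_norm_sq]
  rw [h9, errSq]
  have h10 : 0 ≤ ∑ j, ∫ ω, ‖c.err m j ω‖ ^ 2 ∂μ :=
    Finset.sum_nonneg fun j _ => integral_nonneg fun ω => sq_nonneg _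
  calc _ ≤ ‖1 / (c.S * K : ℝ)‖ ^ 2 * ((c.S * K : ℝ) / N * ∑ j, ∫ ω, ‖c.err m j ω‖ ^ 2 ∂μ) := by
        refine mul_le_mul_of_nonneg_left ?_ (sq_nonneg _)
        have h11 := mul_le_mul_of_nonneg_right ha h10
        have h12 := mul_nonneg hb h6
        linarith
    _ = _ := by
        rw [Real.norm_of_nonneg (by positivity)]
        field_simp

/-- An old error survives with probability 1 − p, independently of its size: this is the contraction
of the control-variate errors. -/
theorem integral_one_sub_ind_err_sq (h : c.IsValid μ Δ L σ R) {m : ℕ} (hm : m < R / K)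
    (i : Fin N) :
    ∫ ω, ‖(1 - c.ind m i ω) • c.err m i ω‖ ^ 2 ∂μ =
      (1 - c.prob) * ∫ ω, ‖c.err m i ω‖ ^ 2 ∂μ := by
  have h1 : ∀ ω, ‖(1 - c.ind m i ω) • c.err m i ω‖ ^ 2 =
      (1 - c.ind m i ω) * ‖c.err m i ω‖ ^ 2 := by
    intro ω
    rcases c.ind_eq_zero_or_one m i ω with h0 | h0 <;> simp [h0]
  have h2 : Measurable[c.X.alg (drawsBefore N R c.I (m * K))] fun ω => ‖c.err m i ω‖ ^ 2 :=
    (continuous_norm.measurable.comp (h.measurable_err hm.le subset_rfl i)).pow_const 2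
  have h3 : Measurable[c.X.alg (clientsFrom N R c.I (m * K))] fun ω => 1 - c.ind m i ω :=
    (measurable_ind_clientsFrom hm i).const_sub _
  simp only [h1]
  rw [h.integral_clients_mul h3 h2, integral_sub (integrable_const _)
    ((h.memLp_ind hm i).integrable one_le_two), h.integral_ind hm]
  simp

/-! #### Drift -/

theorem memLp_radius (h : c.IsValid μ Δ L σ R) {m : ℕ} (hm : m < R / K)
    (hx : MemLp (c.model m) 2 μ) (he : ∀ i, MemLp (c.err m i) 2 μ) :
    MemLp (c.radius m) 2 μ := by
  have h1 : MemLp (fun ω => ∑ i, ‖c.err m i ω‖) 2 μ :=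
    memLp_finsetSum (f := fun i ω => ‖c.err m i ω‖) _ fun i _ => (he i).norm
  have h2 : MemLp (fun ω => ∑ s ∈ Finset.range K, ∑ k ∈ Finset.range c.I, ∑ i,
      ‖c.noise (m * K + s) k i ω‖) 2 μ :=
    memLp_finsetSum (f := fun s ω => ∑ k ∈ Finset.range c.I, ∑ i, ‖c.noise (m * K + s) k i ω‖) _
      fun s hs => memLp_finsetSum (f := fun k ω => ∑ i, ‖c.noise (m * K + s) k i ω‖) _
      fun k hk => memLp_finsetSum (f := fun i ω => ‖c.noise (m * K + s) k i ω‖) _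
      fun i _ => (h.memLp_noise (round_lt hm (Finset.mem_range.1 hs))
        (Finset.mem_range.1 hk) i).norm
  exact ((((h.memLp_meanGrad hx).norm.add (h1.const_mul 2)).const_mul _).add h2).const_mul _

/-- Only Cauchy–Schwarz, summing all noises with no use of orthogonality. The powers of N cost
nothing, because the bound carries η² and η is chosen last. -/
theorem integral_radius_sq_le (h : c.IsValid μ Δ L σ R) {m : ℕ} (hm : m < R / K)
    (hx : MemLp (c.model m) 2 μ) (he : ∀ i, MemLp (c.err m i) 2 μ) :
    ∫ ω, c.radius m ω ^ 2 ∂μ ≤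
      64 * c.η ^ 2 * (K * c.I * N) ^ 2 * (c.gradSq μ m + c.errSq μ m + σ ^ 2) := by
  have hI := h.one_le_I
  have hK := h.one_le_K
  have hN := h.one_le_N
  have hn : ∀ s ∈ Finset.range K, ∀ k ∈ Finset.range c.I, ∀ i,
      Integrable (fun ω => ‖c.noise (m * K + s) k i ω‖ ^ 2) μ := fun s hs k hk i =>
    integrable_norm_sq (h.memLp_noise (round_lt hm (Finset.mem_range.1 hs))
        (Finset.mem_range.1 hk) i)
  have hpt : ∀ ω, c.radius m ω ^ 2 ≤ 8 * c.η ^ 2 * ((K * c.I) ^ 2 *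
      (2 * ‖c.meanGrad (c.model m ω)‖ ^ 2 + 8 * N * ∑ i, ‖c.err m i ω‖ ^ 2) +
      K * c.I * N * ∑ s ∈ Finset.range K, ∑ k ∈ Finset.range c.I, ∑ i,
        ‖c.noise (m * K + s) k i ω‖ ^ 2) := by
    intro ω
    have h1 : (∑ i, ‖c.err m i ω‖) ^ 2 ≤ N * ∑ i, ‖c.err m i ω‖ ^ 2 := by
      simpa using sq_sum_le_card_mul_sum_sq (s := Finset.univ) (f := fun i => ‖c.err m i ω‖)
    have h2 : (∑ s ∈ Finset.range K, ∑ k ∈ Finset.range c.I, ∑ i,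
        ‖c.noise (m * K + s) k i ω‖) ^ 2 ≤ K * c.I * N * ∑ s ∈ Finset.range K,
        ∑ k ∈ Finset.range c.I, ∑ i, ‖c.noise (m * K + s) k i ω‖ ^ 2 := by
      have h3 := sq_sum_le_card_mul_sum_sq
        (s := Finset.range K ×ˢ Finset.range c.I ×ˢ (Finset.univ : Finset (Fin N)))
        (f := fun j => ‖c.noise (m * K + j.1) j.2.1 j.2.2 ω‖)
      simpa [Finset.sum_product, mul_assoc] using h3
    unfold radius
    set a := ‖c.meanGrad (c.model m ω)‖
    set b := ∑ i, ‖c.err m i ω‖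
    set z := ∑ s ∈ Finset.range K, ∑ k ∈ Finset.range c.I, ∑ i, ‖c.noise (m * K + s) k i ω‖
    have h4 : (K * c.I * (a + 2 * b) + z) ^ 2 ≤
        2 * ((K * c.I) ^ 2 * (2 * a ^ 2 + 8 * b ^ 2) + z ^ 2) := by
      have h5 : (a + 2 * b) ^ 2 ≤ 2 * a ^ 2 + 8 * b ^ 2 := by nlinarith [sq_nonneg (a - 2 * b)]
      have h6 := mul_le_mul_of_nonneg_left h5 (sq_nonneg (K * c.I : ℝ))
      nlinarith [sq_nonneg (K * c.I * (a + 2 * b) - z)]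
    calc _ = 4 * c.η ^ 2 * (K * c.I * (a + 2 * b) + z) ^ 2 := by ring
      _ ≤ 4 * c.η ^ 2 * (2 * ((K * c.I) ^ 2 * (2 * a ^ 2 + 8 * b ^ 2) + z ^ 2)) := by gcongr
      _ = 8 * c.η ^ 2 * ((K * c.I) ^ 2 * (2 * a ^ 2 + 8 * b ^ 2) + z ^ 2) := by ring
      _ ≤ _ := by
        rw [mul_assoc (8 : ℝ) (N : ℝ)]
        gcongr
  have hIg := integrable_norm_sq (h.memLp_meanGrad hx)
  have hIe : Integrable (fun ω => ∑ i, ‖c.err m i ω‖ ^ 2) μ :=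
    integrable_finsetSum _ fun i _ => integrable_norm_sq (he i)
  have hIn : Integrable (fun ω => ∑ s ∈ Finset.range K, ∑ k ∈ Finset.range c.I, ∑ i,
      ‖c.noise (m * K + s) k i ω‖ ^ 2) μ :=
    integrable_finsetSum _ fun s hs => integrable_finsetSum _ fun k hk =>
      integrable_finsetSum _ fun i _ => hn s hs k hk i
  have hI1 : Integrable (fun ω => (K * c.I : ℝ) ^ 2 *
      (2 * ‖c.meanGrad (c.model m ω)‖ ^ 2 + 8 * N * ∑ i, ‖c.err m i ω‖ ^ 2)) μ :=
    ((hIg.const_mul 2).add (hIe.const_mul (8 * N : ℝ))).const_mul _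
  have hnoise : ∫ ω, ∑ s ∈ Finset.range K, ∑ k ∈ Finset.range c.I, ∑ i,
      ‖c.noise (m * K + s) k i ω‖ ^ 2 ∂μ ≤ K * c.I * N * σ ^ 2 := by
    rw [integral_finsetSum _ fun s hs => integrable_finsetSum _ fun k hk =>
      integrable_finsetSum _ fun i _ => hn s hs k hk i]
    calc _ ≤ ∑ _s ∈ Finset.range K, (c.I * (N * σ ^ 2) : ℝ) := by
          refine Finset.sum_le_sum fun s hs => ?_
          rw [integral_finsetSum _ fun k hk => integrable_finsetSum _ fun i _ => hn s hs k hk i]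
          calc _ ≤ ∑ _k ∈ Finset.range c.I, (N * σ ^ 2 : ℝ) := by
                refine Finset.sum_le_sum fun k hk => ?_
                rw [integral_finsetSum _ fun i _ => hn s hs k hk i]
                calc _ ≤ ∑ _i : Fin N, σ ^ 2 := by
                      refine Finset.sum_le_sum fun i _ => ?_
                      have h1 := h.integral_smul_noise_sq_le
                        (round_lt hm (Finset.mem_range.1 hs)) (Finset.mem_range.1 hk) i
                        (a := fun _ => 1) measurable_const (memLp_const 1)
                      simpa using h1
                  _ = _ := by simp
            _ = _ := by simp
      _ = _ := by simp; ring
  calc _ ≤ ∫ ω, 8 * c.η ^ 2 * ((K * c.I) ^ 2 *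
      (2 * ‖c.meanGrad (c.model m ω)‖ ^ 2 + 8 * N * ∑ i, ‖c.err m i ω‖ ^ 2) +
      K * c.I * N * ∑ s ∈ Finset.range K, ∑ k ∈ Finset.range c.I, ∑ i,
        ‖c.noise (m * K + s) k i ω‖ ^ 2) ∂μ :=
        integral_mono (h.memLp_radius hm hx he).integrable_sq
          ((hI1.add (hIn.const_mul _)).const_mul _) hpt
    _ = 8 * c.η ^ 2 * ((K * c.I) ^ 2 * (2 * c.gradSq μ m + 8 * N * (N * c.errSq μ m)) +
        K * c.I * N * ∫ ω, ∑ s ∈ Finset.range K, ∑ k ∈ Finset.range c.I, ∑ i,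
          ‖c.noise (m * K + s) k i ω‖ ^ 2 ∂μ) := by
        rw [integral_const_mul, integral_add hI1 (hIn.const_mul _), integral_const_mul,
          integral_add (hIg.const_mul 2) (hIe.const_mul (8 * N : ℝ)), integral_const_mul,
          integral_const_mul, integral_const_mul,
          integral_finsetSum _ fun i _ => integrable_norm_sq (he i), gradSq, errSq,
          ← mul_assoc (N : ℝ) (1 / (N : ℝ)), mul_one_div_cancel (by positivity), one_mul]
    _ ≤ 8 * c.η ^ 2 * ((K * c.I) ^ 2 * (8 * N ^ 2 * c.gradSq μ m + 8 * N ^ 2 * c.errSq μ m) +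
        8 * (K * c.I * N * (K * c.I * N * σ ^ 2))) := by
        have hg0 : 0 ≤ c.gradSq μ m := integral_nonneg fun ω => sq_nonneg _
        have h1 : 2 * c.gradSq μ m ≤ 8 * N ^ 2 * c.gradSq μ m := by
          gcongr
          nlinarith
        have h2 : 8 * (N : ℝ) * (N * c.errSq μ m) = 8 * N ^ 2 * c.errSq μ m := by ring
        rw [h2]
        have h3 : 0 ≤ K * c.I * N * (K * c.I * N * σ ^ 2) := by positivity
        have h4 : K * c.I * N * ∫ ω, ∑ s ∈ Finset.range K, ∑ k ∈ Finset.range c.I, ∑ i,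
          ‖c.noise (m * K + s) k i ω‖ ^ 2 ∂μ ≤ 8 * (K * c.I * N * (K * c.I * N * σ ^ 2)) := by
          have := mul_le_mul_of_nonneg_left hnoise (by positivity : (0 : ℝ) ≤ K * c.I * N)
          linarith
        gcongr
    _ = _ := by ring

end IsValid

end Setup

/-! ### Recursion over the windows -/

theorem memLp_two_of_lintegral_le {Ω E : Type*} [MeasurableSpace Ω] [NormedAddCommGroup E]
    {μ : Measure Ω} {u : Ω → E} (hu : AEStronglyMeasurable u μ) {b : ℝ} (hb : 0 ≤ b)
    (h : ∫⁻ ω, ‖u ω‖ₑ ^ 2 ∂μ ≤ ENNReal.ofReal b) :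
    MemLp u 2 μ ∧ ∫ ω, ‖u ω‖ ^ 2 ∂μ ≤ b := by
  constructor
  · refine ⟨hu, ?_⟩
    rw [eLpNorm_lt_top_iff_lintegral_rpow_enorm_lt_top two_ne_zero ENNReal.ofNat_ne_top]
    simpa using h.trans_lt ENNReal.ofReal_lt_top
  · rw [integral_eq_lintegral_of_nonneg_ae (.of_forall fun ω => sq_nonneg _) (hu.norm.pow 2)]
    refine ENNReal.toReal_le_of_le_ofReal hb (le_of_eq_of_le ?_ h)
    refine lintegral_congr fun ω => ?_
    rw [← ofReal_norm, ENNReal.ofReal_pow (norm_nonneg _)]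

theorem norm_add_sq_le_two {E : Type*} [SeminormedAddCommGroup E] (a b : E) :
    ‖a + b‖ ^ 2 ≤ 2 * (‖a‖ ^ 2 + ‖b‖ ^ 2) := by
  have h1 := norm_add_le a b
  nlinarith [norm_nonneg (a + b), sq_nonneg (‖a‖ - ‖b‖)]

/-- Young's inequality; the slack is t⁻¹ times the square of ‖a‖ − t‖b‖. -/
theorem norm_add_sq_le_weighted {E : Type*} [SeminormedAddCommGroup E] (a b : E) {t : ℝ}
    (ht : 0 < t) : ‖a + b‖ ^ 2 ≤ (1 + t⁻¹) * ‖a‖ ^ 2 + (1 + t) * ‖b‖ ^ 2 := by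
  have h1 : ‖a + b‖ ^ 2 ≤ (‖a‖ + ‖b‖) ^ 2 := by gcongr; exact norm_add_le a b
  have h2 : (1 + t⁻¹) * ‖a‖ ^ 2 + (1 + t) * ‖b‖ ^ 2 - (‖a‖ + ‖b‖) ^ 2
      = t⁻¹ * (‖a‖ - t * ‖b‖) ^ 2 := by
    field_simp
    ring
  have h3 : 0 ≤ t⁻¹ * (‖a‖ - t * ‖b‖) ^ 2 := by positivity
  linarith

theorem measurable_section {α β γ : Type*} [MeasurableSpace α] [MeasurableSpace β]
    [MeasurableSpace γ] {G : α → β → γ} (hG : Measurable fun z : α × β => G z.1 z.2) (x : α) :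
    Measurable (G x) :=
  hG.comp measurable_prodMk_left

section IntegralSum

variable {Ω : Type*} [MeasurableSpace Ω] {μ : Measure Ω} {f g u v : Ω → ℝ}

theorem integral_add_three (hf : Integrable f μ) (hg : Integrable g μ) (hu : Integrable u μ) :
    ∫ ω, (f ω + g ω + u ω) ∂μ = ∫ ω, f ω ∂μ + ∫ ω, g ω ∂μ + ∫ ω, u ω ∂μ := by
  rw [← integral_add hf hg]
  exact integral_add (hf.add hg) hu

theorem integral_add_four (hf : Integrable f μ) (hg : Integrable g μ) (hu : Integrable u μ)
    (hv : Integrable v μ) : ∫ ω, (f ω + g ω + u ω + v ω) ∂μ =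
      ∫ ω, f ω ∂μ + ∫ ω, g ω ∂μ + ∫ ω, u ω ∂μ + ∫ ω, v ω ∂μ := by
  rw [← integral_add_three hf hg hu]
  exact integral_add ((hf.add hg).add hu) hv

end IntegralSum

namespace Setup

variable {Ω Ξ : Type*} [MeasurableSpace Ξ] {N K d : ℕ}

/-- Expected squared radius of the `m`-th window. -/
def radSq [MeasurableSpace Ω] (c : Setup Ω Ξ N K d) (μ : Measure Ω) (m : ℕ) : ℝ :=
  ∫ ω, c.radius m ω ^ 2 ∂μ

/-- Expected squared update direction of the `m`-th window. -/
def dirSq [MeasurableSpace Ω] (c : Setup Ω Ξ N K d) (μ : Measure Ω) (m : ℕ) : ℝ :=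
  ∫ ω, ‖c.dir m ω‖ ^ 2 ∂μ

theorem model_zero (c : Setup Ω Ξ N K d) (ω : Ω) : c.model 0 ω = c.x₀ := by
  simp [model, state, amplifiedScaffold, initState]

namespace IsValid

variable [mΩ : MeasurableSpace Ω] {μ : Measure Ω} {Δ L σ : ℝ} {R : ℕ}
  {c : Setup Ω Ξ N K d}

/-! #### Initial control variates -/

/-- The initial control variates are sampled at the first model itself, so their error is pure noise
with no contribution from heterogeneity. -/
theorem err_zero (h : c.IsValid μ Δ L σ R) (i : Fin N) (ω : Ω) : c.err 0 i ω =
    -((1 / (c.I : ℝ)) • ∑ k ∈ Finset.range c.I, c.gradError i c.x₀ (c.X.initSample k i ω)) := by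
  have hI : (c.I : ℝ) ≠ 0 := by exact_mod_cast h.hI.ne'
  have h1 : (c.state (0 * K) ω).G i =
      (1 / (c.I : ℝ)) • ∑ k ∈ Finset.range c.I, c.p.stochGrad i c.x₀ (c.X.initSample k i ω) := by
    simp [state, amplifiedScaffold, initState]
  simp only [err, h1, model_zero, gradError]
  rw [Finset.sum_sub_distrib, Finset.sum_const, Finset.card_range, ← Nat.cast_smul_eq_nsmul ℝ,
    smul_sub, smul_smul, one_div_mul_cancel hI, one_smul]
  abel

/-- Young's inequality with weight p/2: inflating the retained error by 1 + p/2 uses up only half of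
the contraction 1 − p gained later in expectation. The movement of the model pays a factor of order
1/p. -/
theorem norm_err_succ_sq_le (h : c.IsValid μ Δ L σ R) (hη : 0 ≤ c.η)
    (hηL : 2 * (c.η * (K * c.I) * L) ≤ 1) {m : ℕ} (hm : m < R / K) {ω : Ω} (hω : Good c R ω)
    (i : Fin N) : ‖c.err (m + 1) i ω‖ ^ 2 ≤
      (1 + (c.prob / 2)⁻¹) * (L ^ 2 * c.step ^ 2 * ‖c.dir m ω‖ ^ 2) + (1 + c.prob / 2) *
        (‖(1 - c.ind m i ω) • c.err m i ω‖ ^ 2 + 2 * ‖c.ind m i ω • c.avgNoise m i ω‖ ^ 2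
          + 2 * L ^ 2 * c.radius m ω ^ 2) := by
  have hp := h.prob_pos
  rw [h.err_succ hm hω]
  refine (norm_add_sq_le_weighted _ _ (half_pos hp)).trans ?_
  have h1 : ‖c.grad i (c.model (m + 1) ω) - c.grad i (c.model m ω)‖ ^ 2 ≤
      L ^ 2 * c.step ^ 2 * ‖c.dir m ω‖ ^ 2 := by
    have h2 := h.adm.smooth i (c.model (m + 1) ω) (c.model m ω)
    have h3 : ‖c.model (m + 1) ω - c.model m ω‖ = |c.step| * ‖c.dir m ω‖ := by
      rw [h.model_succ hm hω, sub_sub_cancel_left, norm_neg, norm_smul, Real.norm_eq_abs]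
    rw [h3] at h2
    calc _ ≤ (L * (|c.step| * ‖c.dir m ω‖)) ^ 2 := pow_le_pow_left₀ (norm_nonneg _) h2 2
      _ = _ := by rw [mul_pow, mul_pow, sq_abs]; ring
  have h2 : ‖(1 - c.ind m i ω) • c.err m i ω -
      c.ind m i ω • (c.avgNoise m i ω + c.drift m i ω)‖ ^ 2 ≤
      ‖(1 - c.ind m i ω) • c.err m i ω‖ ^ 2 + 2 * ‖c.ind m i ω • c.avgNoise m i ω‖ ^ 2
          + 2 * L ^ 2 * c.radius m ω ^ 2 := by
    have h3 := pow_le_pow_left₀ (norm_nonneg _) (h.norm_drift_le hη hηL hm hω i) 2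
    rw [mul_pow] at h3
    have h4 := norm_add_sq_le_two (c.avgNoise m i ω) (c.drift m i ω)
    have h5 : 0 ≤ L ^ 2 * c.radius m ω ^ 2 := by positivity
    -- Exactly one of the old error and the renewed terms is present, so there is no cross term and
    -- the old error keeps coefficient one.
    rcases c.ind_eq_zero_or_one m i ω with h0 | h0
    · simp only [h0, sub_zero, one_smul, zero_smul, norm_zero]
      linarith
    · simp only [h0, sub_self, one_smul, zero_smul, norm_zero, zero_sub, norm_neg]
      linarith
  gcongr

theorem memLp_one_sub_ind_smul_err (h : c.IsValid μ Δ L σ R) {m : ℕ} (hm : m < R / K)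
    (he : ∀ i, MemLp (c.err m i) 2 μ) (i : Fin N) :
    MemLp (fun ω => (1 - c.ind m i ω) • c.err m i ω) 2 μ := by
  refine memLp_smul_of_abs_le_one ((h.measurable_ind' hm i).const_sub 1).aestronglyMeasurable
    (fun ω => ?_) (he i)
  rcases c.ind_eq_zero_or_one m i ω with h0 | h0 <;> simp [h0]

theorem measurable_gradError_left (h : c.IsValid μ Δ L σ R) (i : Fin N) (x : Vec d) :
    Measurable (c.gradError i x) :=
  measurable_section (h.measurable_gradError i) x

theorem memLp_init_gradError (h : c.IsValid μ Δ L σ R) {k : ℕ} (hk : k < c.I) (i : Fin N) :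
    MemLp (fun ω => c.gradError i c.x₀ (c.X.initSample k i ω)) 2 μ ∧
      ∫ ω, ‖c.gradError i c.x₀ (c.X.initSample k i ω)‖ ^ 2 ∂μ ≤ σ ^ 2 := by
  have hξ := h.run.measurable_initSample k hk i
  have hm := h.measurable_gradError_left i c.x₀
  refine memLp_two_of_lintegral_le (hm.comp hξ).aestronglyMeasurable (sq_nonneg σ) ?_
  have h1 := lintegral_map (μ := μ) (hm.enorm.pow_const 2) hξ
  rw [h.run.law_initSample k hk i] at h1
  refine h1.symm.trans_le ?_
  exact h.adm.variance_le i c.x₀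

theorem memLp_err_zero (h : c.IsValid μ Δ L σ R) (i : Fin N) : MemLp (c.err 0 i) 2 μ := by
  rw [funext (h.err_zero i)]
  exact ((memLp_finsetSum (f := fun k ω => c.gradError i c.x₀ (c.X.initSample k i ω)) _
    fun k hk => (h.memLp_init_gradError (Finset.mem_range.1 hk) i).1).const_smul
    (1 / (c.I : ℝ))).neg

variable [IsProbabilityMeasure μ]

theorem integral_inner_init_gradError (h : c.IsValid μ Δ L σ R) {k k' : ℕ} (hk : k < c.I)
    (hk' : k' < c.I) (hne : k' ≠ k) (i : Fin N) :
    ∫ ω, ⟪c.gradError i c.x₀ (c.X.initSample k' i ω),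
      c.gradError i c.x₀ (c.X.initSample k i ω)⟫ ∂μ = 0 := by
  let T : Set (Unit ⊕ Fin R ⊕ (Fin c.I × Fin N) ⊕ (Fin R × Fin c.I × Fin N)) :=
    {.inr (.inr (.inl (⟨k', hk'⟩, i)))}
  let T' : Set (Unit ⊕ Fin R ⊕ (Fin c.I × Fin N) ⊕ (Fin R × Fin c.I × Fin N)) :=
    {.inr (.inr (.inl (⟨k, hk⟩, i)))}
  have h1 : Indep (c.X.alg T) (MeasurableSpace.comap (c.X.initSample k i) inferInstance) μ := by
    refine indep_of_indep_of_le_right (h.run.indep_alg (T := T) (T' := T') ?_) ?_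
    · simp [T, T', hne]
    · exact Draws.drawAlg_le_alg (j := .inr (.inr (.inl (⟨k, hk⟩, i)))) (Set.mem_singleton _)
  have hlaw := h.run.law_initSample k hk i
  have h2 : Measurable[c.X.alg T] (c.X.initSample k' i) :=
    Draws.measurable_initSample hk' (Set.mem_singleton _)
  have h3 := h.measurable_gradError_left i c.x₀
  exact integral_inner_fresh_eq_zero h.run.alg_le (h.run.measurable_initSample k hk i) h1
    (h.measurable_gradError i) (fun x => by rw [hlaw]; exact (h.adm.integral_stochGrad_sub i x).1)
    (fun x => by rw [hlaw]; exact (h.adm.integral_stochGrad_sub i x).2)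
    (y := fun _ => c.x₀) measurable_const (h3.comp h2) (h.memLp_init_gradError hk' i).1
    (h.memLp_init_gradError hk i).1

theorem errSq_zero_le (h : c.IsValid μ Δ L σ R) : c.errSq μ 0 ≤ σ ^ 2 / c.I := by
  have hI := h.one_le_I
  have hN := h.one_le_N
  have h1 : ∀ i, ∫ ω, ‖c.err 0 i ω‖ ^ 2 ∂μ ≤ σ ^ 2 / c.I := by
    intro i
    simp only [h.err_zero, norm_neg, norm_smul, mul_pow]
    rw [integral_const_mul, integral_norm_sum_sq _
      (fun k hk => (h.memLp_init_gradError (Finset.mem_range.1 hk) i).1)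
      fun k hk k' hk' hne => h.integral_inner_init_gradError (Finset.mem_range.1 hk')
        (Finset.mem_range.1 hk) hne i]
    calc _ ≤ ‖1 / (c.I : ℝ)‖ ^ 2 * ∑ _k ∈ Finset.range c.I, σ ^ 2 := by
          gcongr with k hk
          exact (h.memLp_init_gradError (Finset.mem_range.1 hk) i).2
      _ = _ := by
          rw [Finset.sum_const, Finset.card_range, nsmul_eq_mul,
            Real.norm_of_nonneg (by positivity)]
          field_simp
  calc _ ≤ 1 / (N : ℝ) * ∑ _i : Fin N, σ ^ 2 / c.I := by
        unfold errSq
        gcongr with i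
        exact h1 i
    _ = _ := by
        rw [Finset.sum_const, Finset.card_univ, Fintype.card_fin, nsmul_eq_mul]
        field_simp

/-! #### One window -/

section Window

variable {m : ℕ}

theorem memLp_drift (h : c.IsValid μ Δ L σ R) (hη : 0 ≤ c.η)
    (hηL : 2 * (c.η * (K * c.I) * L) ≤ 1) (hm : m < R / K) (hx : MemLp (c.model m) 2 μ)
    (he : ∀ i, MemLp (c.err m i) 2 μ) (i : Fin N) : MemLp (c.drift m i) 2 μ := by
  refine ((h.memLp_radius hm hx he).const_mul L).mono' ?_ ?_
  · have h1 : Measurable fun ω => ∑ k ∈ Finset.range c.I,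
        (c.grad i (c.iter (m * K + c.group i) k i ω) - c.grad i (c.model m ω)) := by
      refine Finset.measurable_sum _ fun k hk => ?_
      refine ((h.measurable_grad i).comp ?_).sub
        ((h.measurable_grad i).comp (h.measurable_model' hm.le))
      exact (h.measurable_iter_drawsWithout (round_lt hm (c.group i).2)
        (Finset.mem_range.1 hk) i).mono h.run.alg_le le_rfl
    exact (h1.const_smul (1 / (c.I : ℝ))).aestronglyMeasurable
  · filter_upwards [h.ae_good] with ω hω
    exact h.norm_drift_le hη hηL hm hω i

theorem memLp_driftPart (h : c.IsValid μ Δ L σ R) (hη : 0 ≤ c.η)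
    (hηL : 2 * (c.η * (K * c.I) * L) ≤ 1) (hm : m < R / K) (hx : MemLp (c.model m) 2 μ)
    (he : ∀ i, MemLp (c.err m i) 2 μ) : MemLp (c.driftPart m) 2 μ :=
  memLp_finsetSum (f := fun i ω => (c.ind m i ω / (c.S * K)) • c.drift m i ω) _
    fun i _ => h.memLp_ind_div_smul hm i (h.memLp_drift hη hηL hm hx he i)

theorem memLp_dir (h : c.IsValid μ Δ L σ R) (hη : 0 ≤ c.η)
    (hηL : 2 * (c.η * (K * c.I) * L) ≤ 1) (hm : m < R / K) (hx : MemLp (c.model m) 2 μ)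
    (he : ∀ i, MemLp (c.err m i) 2 μ) : MemLp (c.dir m) 2 μ :=
  (((h.memLp_meanGrad hx).add (h.memLp_errPart hm he)).add (h.memLp_noisePart hm)).add
    (h.memLp_driftPart hη hηL hm hx he)

theorem memLp_model_succ (h : c.IsValid μ Δ L σ R) (hη : 0 ≤ c.η)
    (hηL : 2 * (c.η * (K * c.I) * L) ≤ 1) (hm : m < R / K) (hx : MemLp (c.model m) 2 μ)
    (he : ∀ i, MemLp (c.err m i) 2 μ) : MemLp (c.model (m + 1)) 2 μ := by
  refine (memLp_congr_ae ?_).2 (hx.sub ((h.memLp_dir hη hηL hm hx he).const_smul c.step))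
  filter_upwards [h.ae_good] with ω hω
  exact h.model_succ hm hω

theorem memLp_grad_model (h : c.IsValid μ Δ L σ R) (hx : MemLp (c.model m) 2 μ) (i : Fin N) :
    MemLp (fun ω => c.grad i (c.model m ω)) 2 μ :=
  memLp_comp_of_norm_sub_le (h.adm.smooth i) hx

theorem memLp_err_succ (h : c.IsValid μ Δ L σ R) (hη : 0 ≤ c.η)
    (hηL : 2 * (c.η * (K * c.I) * L) ≤ 1) (hm : m < R / K) (hx : MemLp (c.model m) 2 μ)
    (he : ∀ i, MemLp (c.err m i) 2 μ) (i : Fin N) : MemLp (c.err (m + 1) i) 2 μ := by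
  refine (memLp_congr_ae ?_).2 (((h.memLp_grad_model
    (h.memLp_model_succ hη hηL hm hx he) i).sub (h.memLp_grad_model hx i)).add
      ((h.memLp_one_sub_ind_smul_err hm he i).sub (h.memLp_ind_smul hm i
        ((h.memLp_avgNoise hm i).add (h.memLp_drift hη hηL hm hx he i)))))
  filter_upwards [h.ae_good] with ω hω
  exact h.err_succ hm hω i

/-- Square integrability is propagated from window to window: the recursions express the new model
and errors through square-integrable terms, the drift being controlled by `radius`. -/
theorem memLp_model_err (h : c.IsValid μ Δ L σ R) (hη : 0 ≤ c.η)
    (hηL : 2 * (c.η * (K * c.I) * L) ≤ 1) : ∀ m ≤ R / K,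
    MemLp (c.model m) 2 μ ∧ ∀ i, MemLp (c.err m i) 2 μ := by
  intro m
  induction m with
  | zero =>
    intro _
    rw [funext c.model_zero]
    exact ⟨memLp_const _, h.memLp_err_zero⟩
  | succ m ih =>
    intro hm
    obtain ⟨hx, he⟩ := ih (Nat.le_of_succ_le hm)
    exact ⟨h.memLp_model_succ hη hηL hm hx he, h.memLp_err_succ hη hηL hm hx he⟩

theorem integral_driftPart_sq_le (h : c.IsValid μ Δ L σ R) (hη : 0 ≤ c.η)
    (hηL : 2 * (c.η * (K * c.I) * L) ≤ 1) (hm : m < R / K) (hx : MemLp (c.model m) 2 μ)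
    (he : ∀ i, MemLp (c.err m i) 2 μ) :
    ∫ ω, ‖c.driftPart m ω‖ ^ 2 ∂μ ≤ L ^ 2 * c.radSq μ m := by
  rw [radSq, ← integral_const_mul]
  refine integral_mono_ae (integrable_norm_sq (h.memLp_driftPart hη hηL hm hx he))
    ((h.memLp_radius hm hx he).integrable_sq.const_mul _) ?_
  filter_upwards [h.ae_good] with ω hω
  rw [← mul_pow]
  exact pow_le_pow_left₀ (norm_nonneg _) (h.norm_driftPart_le hη hηL hm hω) 2

theorem dirSq_le (h : c.IsValid μ Δ L σ R) (hη : 0 ≤ c.η)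
    (hηL : 2 * (c.η * (K * c.I) * L) ≤ 1) (hm : m < R / K) (hx : MemLp (c.model m) 2 μ)
    (he : ∀ i, MemLp (c.err m i) 2 μ) :
    c.dirSq μ m ≤ 4 * (c.gradSq μ m + c.errSq μ m / (c.S * K) + σ ^ 2 / (c.S * K * c.I)
      + L ^ 2 * c.radSq μ m) := by
  have i1 := integrable_norm_sq (h.memLp_meanGrad hx)
  have i2 := integrable_norm_sq (h.memLp_errPart hm he)
  have i3 := integrable_norm_sq (h.memLp_noisePart hm)
  have i4 := integrable_norm_sq (h.memLp_driftPart hη hηL hm hx he)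
  calc _ ≤ ∫ ω, 4 * (‖c.meanGrad (c.model m ω)‖ ^ 2 + ‖c.errPart m ω‖ ^ 2
        + ‖c.noisePart m ω‖ ^ 2 + ‖c.driftPart m ω‖ ^ 2) ∂μ := by
        refine integral_mono (integrable_norm_sq (h.memLp_dir hη hηL hm hx he))
          ((((i1.add i2).add i3).add i4).const_mul 4) fun ω => ?_
        have h1 := norm_add_sq_le_two (c.meanGrad (c.model m ω)) (c.errPart m ω)
        have h2 := norm_add_sq_le_two (c.noisePart m ω) (c.driftPart m ω)
        have h3 := norm_add_sq_le_two (c.meanGrad (c.model m ω) + c.errPart m ω)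
          (c.noisePart m ω + c.driftPart m ω)
        rw [← add_assoc] at h3
        change ‖c.meanGrad (c.model m ω) + c.errPart m ω + c.noisePart m ω
          + c.driftPart m ω‖ ^ 2 ≤ _
        linarith
    _ = 4 * (c.gradSq μ m + ∫ ω, ‖c.errPart m ω‖ ^ 2 ∂μ + ∫ ω, ‖c.noisePart m ω‖ ^ 2 ∂μ
        + ∫ ω, ‖c.driftPart m ω‖ ^ 2 ∂μ) := by
        rw [integral_const_mul, integral_add_four i1 i2 i3 i4, gradSq]
    _ ≤ _ := by
        gcongr
        · exact h.integral_errPart_sq_le hm he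
        · exact h.integral_noisePart_sq_le hm
        · exact h.integral_driftPart_sq_le hη hηL hm hx he

/-- The error and noise parts are orthogonal to the gradient in expectation. The drift costs a
quarter of the squared gradient plus its own square. -/
theorem le_integral_inner_dir (h : c.IsValid μ Δ L σ R) (hη : 0 ≤ c.η)
    (hηL : 2 * (c.η * (K * c.I) * L) ≤ 1) (hm : m < R / K) (hx : MemLp (c.model m) 2 μ)
    (he : ∀ i, MemLp (c.err m i) 2 μ) :
    3 / 4 * c.gradSq μ m - L ^ 2 * c.radSq μ m ≤
      ∫ ω, ⟪c.meanGrad (c.model m ω), c.dir m ω⟫ ∂μ := by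
  have hg := h.memLp_meanGrad hx
  have hd := h.memLp_driftPart hη hηL hm hx he
  have i1 := integrable_norm_sq hg
  have i2 := integrable_inner_of_memLp hg (h.memLp_errPart hm he)
  have i3 := integrable_inner_of_memLp hg (h.memLp_noisePart hm)
  have i4 := integrable_norm_sq hd
  have h4 := h.integral_driftPart_sq_le hη hηL hm hx he
  have i5 : Integrable (fun ω => 3 / 4 * ‖c.meanGrad (c.model m ω)‖ ^ 2) μ := i1.const_mul _
  have i6 : Integrable (fun ω => -‖c.driftPart m ω‖ ^ 2) μ := i4.neg
  calc _ ≤ 3 / 4 * c.gradSq μ m + ∫ ω, ⟪c.meanGrad (c.model m ω), c.errPart m ω⟫ ∂μ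
        + ∫ ω, ⟪c.meanGrad (c.model m ω), c.noisePart m ω⟫ ∂μ
        + ∫ ω, -‖c.driftPart m ω‖ ^ 2 ∂μ := by
        rw [integral_neg]
        rw [h.integral_inner_errPart hm hx he, h.integral_inner_noisePart hm hx]
        linarith
    _ = ∫ ω, (3 / 4 * ‖c.meanGrad (c.model m ω)‖ ^ 2
        + ⟪c.meanGrad (c.model m ω), c.errPart m ω⟫ + ⟪c.meanGrad (c.model m ω), c.noisePart m ω⟫
        + -‖c.driftPart m ω‖ ^ 2) ∂μ := by
        rw [integral_add_four i5 i2 i3 i6, integral_const_mul, gradSq]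
    _ ≤ _ := by
        refine integral_mono (((i5.add i2).add i3).add i6)
          (integrable_inner_of_memLp hg (h.memLp_dir hη hηL hm hx he)) fun ω => ?_
        simp only [dir, inner_add_right, real_inner_self_eq_norm_sq]
        have h5 := neg_le_of_abs_le (abs_real_inner_le_norm (c.meanGrad (c.model m ω))
          (c.driftPart m ω))
        nlinarith [sq_nonneg (‖c.meanGrad (c.model m ω)‖ / 2 - ‖c.driftPart m ω‖)]

theorem errSq_succ_le (h : c.IsValid μ Δ L σ R) (hη : 0 ≤ c.η)
    (hηL : 2 * (c.η * (K * c.I) * L) ≤ 1) (hm : m < R / K) (hx : MemLp (c.model m) 2 μ)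
    (he : ∀ i, MemLp (c.err m i) 2 μ) :
    c.errSq μ (m + 1) ≤ (1 - c.prob / 2) * c.errSq μ m + 3 * c.prob * (σ ^ 2 / c.I)
      + 3 * (L ^ 2 * c.radSq μ m) + 3 / c.prob * (L ^ 2 * c.step ^ 2 * c.dirSq μ m) := by
  have hp := h.prob_pos
  have hp1 := h.prob_le_one
  have hN := h.one_le_N
  have hq0 : 0 ≤ L ^ 2 * c.step ^ 2 * c.dirSq μ m :=
    mul_nonneg (by positivity) (integral_nonneg fun ω => sq_nonneg _)
  have hr0 : 0 ≤ L ^ 2 * c.radSq μ m :=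
    mul_nonneg (by positivity) (integral_nonneg fun ω => sq_nonneg _)
  have hpinv : 1 + (c.prob / 2)⁻¹ ≤ 3 / c.prob := by
    rw [inv_div, le_div_iff₀ hp, add_mul, div_mul_cancel₀ _ hp.ne']
    linarith
  have h1 : ∀ i, ∫ ω, ‖c.err (m + 1) i ω‖ ^ 2 ∂μ ≤
      (1 - c.prob / 2) * ∫ ω, ‖c.err m i ω‖ ^ 2 ∂μ + (3 * c.prob * (σ ^ 2 / c.I)
      + 3 * (L ^ 2 * c.radSq μ m) + 3 / c.prob * (L ^ 2 * c.step ^ 2 * c.dirSq μ m)) := by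
    intro i
    have i1 : Integrable (fun ω => (1 + (c.prob / 2)⁻¹) *
        (L ^ 2 * c.step ^ 2 * ‖c.dir m ω‖ ^ 2)) μ :=
      ((integrable_norm_sq (h.memLp_dir hη hηL hm hx he)).const_mul _).const_mul _
    have i2 := integrable_norm_sq (h.memLp_one_sub_ind_smul_err hm he i)
    have i3 : Integrable (fun ω => 2 * ‖c.ind m i ω • c.avgNoise m i ω‖ ^ 2) μ :=
      (integrable_norm_sq (h.memLp_ind_smul hm i (h.memLp_avgNoise hm i))).const_mul 2
    have i4 : Integrable (fun ω => 2 * L ^ 2 * c.radius m ω ^ 2) μ :=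
      (h.memLp_radius hm hx he).integrable_sq.const_mul _
    have i5 : Integrable (fun ω => (1 + c.prob / 2) * (‖(1 - c.ind m i ω) • c.err m i ω‖ ^ 2
        + 2 * ‖c.ind m i ω • c.avgNoise m i ω‖ ^ 2 + 2 * L ^ 2 * c.radius m ω ^ 2)) μ :=
      ((i2.add i3).add i4).const_mul _
    have he0 : 0 ≤ ∫ ω, ‖c.err m i ω‖ ^ 2 ∂μ := integral_nonneg fun ω => sq_nonneg _
    have hn0 : 0 ≤ c.prob * (σ ^ 2 / c.I) := by positivity
    calc _ ≤ ∫ ω, ((1 + (c.prob / 2)⁻¹) * (L ^ 2 * c.step ^ 2 * ‖c.dir m ω‖ ^ 2)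
          + (1 + c.prob / 2) * (‖(1 - c.ind m i ω) • c.err m i ω‖ ^ 2
          + 2 * ‖c.ind m i ω • c.avgNoise m i ω‖ ^ 2 + 2 * L ^ 2 * c.radius m ω ^ 2)) ∂μ := by
          refine integral_mono_ae (integrable_norm_sq (h.memLp_err_succ hη hηL hm hx he i))
            (i1.add i5) ?_
          filter_upwards [h.ae_good] with ω hω
          exact h.norm_err_succ_sq_le hη hηL hm hω i
      _ = (1 + (c.prob / 2)⁻¹) * (L ^ 2 * c.step ^ 2 * c.dirSq μ m)
          + (1 + c.prob / 2) * ((1 - c.prob) * ∫ ω, ‖c.err m i ω‖ ^ 2 ∂μ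
          + 2 * ∫ ω, ‖c.ind m i ω • c.avgNoise m i ω‖ ^ 2 ∂μ + 2 * L ^ 2 * c.radSq μ m) := by
          rw [integral_add i1 i5, integral_const_mul, integral_const_mul, integral_const_mul,
            integral_add_three i2 i3 i4, integral_const_mul, integral_const_mul,
            h.integral_one_sub_ind_err_sq hm, dirSq, radSq]
      _ ≤ 3 / c.prob * (L ^ 2 * c.step ^ 2 * c.dirSq μ m)
          + (1 + c.prob / 2) * ((1 - c.prob) * ∫ ω, ‖c.err m i ω‖ ^ 2 ∂μ
          + 2 * (c.prob * (σ ^ 2 / c.I)) + 2 * L ^ 2 * c.radSq μ m) := by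
          gcongr
          exact h.integral_ind_avgNoise_sq_le hm i
      -- Uses (1 + p/2)(1 − p) ≤ 1 − p/2 and 2(1 + p/2) ≤ 3.
      _ ≤ _ := by
          nlinarith [mul_nonneg (mul_nonneg hp.le hp.le) he0,
            mul_nonneg (sub_nonneg.2 hp1) hn0, mul_nonneg (sub_nonneg.2 hp1) hr0]
  calc _ ≤ 1 / (N : ℝ) * ∑ i, ((1 - c.prob / 2) * ∫ ω, ‖c.err m i ω‖ ^ 2 ∂μ +
      (3 * c.prob * (σ ^ 2 / c.I) + 3 * (L ^ 2 * c.radSq μ m)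
        + 3 / c.prob * (L ^ 2 * c.step ^ 2 * c.dirSq μ m))) := by
        unfold errSq
        gcongr with i
        exact h1 i
    _ = _ := by
        rw [Finset.sum_add_distrib, ← Finset.mul_sum, Finset.sum_const, Finset.card_univ,
          Fintype.card_fin, nsmul_eq_mul, errSq]
        field_simp
        ring

end Window

end IsValid

end Setup

/-! ### Convergence -/

/-- Summation of the recursions for gradients and errors of the control variates. -/
theorem sum_le_of_recursion {M : ℕ} {Γ A Q D : ℕ → ℝ} {p θ k v δ T : ℝ} (hp : 0 < p) (hp1 : p ≤ 1)
    (hθ : 0 ≤ θ) (hθp : 16 * θ ≤ p) (hk : 1 ≤ k) (hv : 0 ≤ v) (hδ : δ ≤ θ / k)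
    (hΓ : ∀ m, 0 ≤ Γ m) (hA : ∀ m, 0 ≤ A m) (hA0 : A 0 ≤ v)
    (hQ : ∀ m < M, Q m ≤ 4 * (Γ m + A m / k + v / k + D m))
    (hD0 : ∀ m, 0 ≤ D m) (hD : ∀ m < M, D m ≤ δ * (Γ m + A m + v))
    (hrec : ∀ m < M, A (m + 1) ≤ (1 - p / 2) * A m + 3 * p * v + 3 * D m + 3 / p * (θ ^ 2 * Q m))
    (hsum : ∑ m ∈ Finset.range M, (3 / 4 * Γ m - D m - θ / 2 * Q m) ≤ T) :
    ∑ m ∈ Finset.range M, Γ m ≤ 4 * T + 64 * (θ * (v / k) / p) + M * (224 * (θ * (v / k))) := by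
  have hk0 : 0 < k := zero_lt_one.trans_le hk
  -- The weight of `A` in the Lyapunov function. Its contraction yields −(bp/2)A = −(8θ/k)A, enough
  -- to absorb every term of order (θ/k)A.
  set b : ℝ := 16 * θ / (p * k) with hb
  have hb0 : 0 ≤ b := by positivity
  have hb1 : b ≤ 1 := by
    rw [hb, div_le_one (by positivity)]
    nlinarith
  have hbp : b * p = 16 * (θ / k) := by rw [hb]; field_simp
  have hθk : θ / k ≤ 1 / 16 := by
    rw [div_le_iff₀ hk0]; linarith
  have hθk0 : 0 ≤ θ / k := by positivity
  -- Because θ/p ≤ 1/16, the movement of the model feeds back through the errors at most half as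
  -- strongly as the quadratic term θ/2 of the descent inequality.
  have hbQ : 3 * b * θ ^ 2 / p ≤ θ / 4 := by
    have h1 : 3 * b * θ ^ 2 / p = 48 * θ / k * (θ / p) ^ 2 := by rw [hb]; field_simp; ring
    have h2 : θ / p ≤ 1 / 16 := by rw [div_le_iff₀ hp]; linarith
    have h3 : (θ / p) ^ 2 ≤ (1 / 16) ^ 2 := pow_le_pow_left₀ (by positivity) h2 2
    have h4 : 48 * θ / k ≤ 48 * θ := div_le_self (by positivity) hk
    rw [h1]
    calc _ ≤ 48 * θ * (1 / 16) ^ 2 := by gcongr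
      _ ≤ _ := by linarith
  have htel : ∑ m ∈ Finset.range M, (b * A m - b * A (m + 1)) ≤ b * v := by
    rw [Finset.sum_range_sub']
    nlinarith [mul_nonneg hb0 (hA M), mul_le_mul_of_nonneg_left hA0 hb0]
  -- Budget: (θ/k)A occurs with 3 from `Q` and less than 5 from the drift, against 8 available. For
  -- (θ/k)v the total is 48 from renewal, 3 from `Q` and less than 5 from the drift, hence 56.
  have hstep : ∀ m ∈ Finset.range M, 1 / 4 * Γ m ≤ (3 / 4 * Γ m - D m - θ / 2 * Q m)
      + (b * A m - b * A (m + 1)) + 56 * (θ * (v / k)) := by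
    intro m hm
    have hm := Finset.mem_range.1 hm
    have h1 := mul_le_mul_of_nonneg_left (hrec m hm) hb0
    have h2 : 0 ≤ Γ m + A m / k + v / k + D m := by
      have := hΓ m; have := hA m; have := hD0 m; positivity
    have h3 : (θ / 2 + 3 * b * θ ^ 2 / p) * Q m ≤
        3 * θ * (Γ m + A m / k + v / k + D m) := by
      have h0 : 0 ≤ θ / 2 + 3 * b * θ ^ 2 / p := by positivity
      calc _ ≤ (θ / 2 + 3 * b * θ ^ 2 / p) * (4 * (Γ m + A m / k + v / k + D m)) :=
            mul_le_mul_of_nonneg_left (hQ m hm) h0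
        _ ≤ (3 / 4 * θ) * (4 * (Γ m + A m / k + v / k + D m)) := by
            gcongr; linarith
        _ = _ := by ring
    have h4 : D m ≤ θ / k * (Γ m + A m + v) := (hD m hm).trans
      (mul_le_mul_of_nonneg_right hδ (by have := hΓ m; have := hA m; positivity))
    have h5 : b * ((1 - p / 2) * A m + 3 * p * v + 3 * D m + 3 / p * (θ ^ 2 * Q m)) =
        b * A m - b * p / 2 * A m + 3 * (b * p) * v + 3 * b * D m
          + 3 * b * θ ^ 2 / p * Q m := by ring
    rw [h5, hbp] at h1
    have h6 : θ * Γ m ≤ 1 / 16 * Γ m := mul_le_mul_of_nonneg_right (by linarith) (hΓ m)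
    have h7 : θ * D m ≤ 1 / 16 * D m := mul_le_mul_of_nonneg_right (by linarith) (hD0 m)
    have h8 : b * D m ≤ 1 * D m := mul_le_mul_of_nonneg_right hb1 (hD0 m)
    have h9 : θ / k * Γ m ≤ 1 / 16 * Γ m := mul_le_mul_of_nonneg_right hθk (hΓ m)
    have h10 : θ * (A m / k) = θ / k * A m := by ring
    have h11 : θ * (v / k) = θ / k * v := by ring
    rw [h11]
    have h3' : θ / 2 * Q m + 3 * b * θ ^ 2 / p * Q m ≤
        3 * (θ * Γ m) + 3 * (θ / k * A m) + 3 * (θ / k * v) + 3 * (θ * D m) := by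
      rw [← h10, ← h11]
      linarith
    have h12 := hD0 m
    linarith
  have h := Finset.sum_le_sum hstep
  rw [← Finset.mul_sum, Finset.sum_add_distrib, Finset.sum_add_distrib, Finset.sum_const,
    Finset.card_range, nsmul_eq_mul] at h
  have hbv : b * v = 16 * (θ * (v / k) / p) := by rw [hb]; field_simp
  linarith

namespace Setup

variable {Ω Ξ : Type*} [MeasurableSpace Ξ] {N K d : ℕ}

namespace IsValid

variable [mΩ : MeasurableSpace Ω] {μ : Measure Ω} {Δ L σ : ℝ} {R : ℕ}
  {c : Setup Ω Ξ N K d}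

/-! #### The objective -/

theorem hasGradientAt_obj (h : c.IsValid μ Δ L σ R) (x : Vec d) :
    HasGradientAt c.p.obj (c.meanGrad x) x := by
  have h1 : ∀ i ∈ (Finset.univ : Finset (Fin N)), HasFDerivAt (c.p.localObj i)
      (InnerProductSpace.toDual ℝ (Vec d) (c.grad i x)) x := fun i _ =>
    ((h.adm.differentiable_localObj i x).hasGradientAt).hasFDerivAt
  have h2 := (HasFDerivAt.fun_sum h1).const_mul (1 / (N : ℝ))
  rw [hasGradientAt_iff_hasFDerivAt]
  refine h2.congr_fderiv ?_
  rw [meanGrad, map_smul, map_sum]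

theorem gradient_obj (h : c.IsValid μ Δ L σ R) : gradient c.p.obj = c.meanGrad :=
  funext fun x => (h.hasGradientAt_obj x).gradient

theorem differentiable_obj (h : c.IsValid μ Δ L σ R) : Differentiable ℝ c.p.obj :=
  fun x => (h.hasGradientAt_obj x).differentiableAt

theorem norm_gradient_obj_sub_le (h : c.IsValid μ Δ L σ R) (x y : Vec d) :
    ‖gradient c.p.obj x - gradient c.p.obj y‖ ≤ L * ‖x - y‖ := by
  rw [h.gradient_obj]
  exact h.norm_meanGrad_sub_le x y

theorem descent (h : c.IsValid μ Δ L σ R) {m : ℕ} (hm : m < R / K) {ω : Ω} (hω : Good c R ω) :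
    c.step * ⟪c.meanGrad (c.model m ω), c.dir m ω⟫ - L / 2 * c.step ^ 2 * ‖c.dir m ω‖ ^ 2 ≤
      c.p.obj (c.model m ω) - c.p.obj (c.model (m + 1) ω) := by
  have h1 := le_quadratic_of_lipschitz_gradient h.differentiable_obj h.norm_gradient_obj_sub_le
    (c.model m ω) (-(c.step • c.dir m ω))
  rw [← sub_eq_add_neg, ← h.model_succ hm hω, h.gradient_obj, inner_neg_right, inner_smul_right,
    norm_neg, norm_smul, mul_pow, Real.norm_eq_abs, sq_abs] at h1
  linarith

variable [IsProbabilityMeasure μ]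

theorem sum_descent_le (h : c.IsValid μ Δ L σ R) (hη : 0 ≤ c.η)
    (hηL : 2 * (c.η * (K * c.I) * L) ≤ 1) :
    ∑ m ∈ Finset.range (R / K), (c.step * ∫ ω, ⟪c.meanGrad (c.model m ω), c.dir m ω⟫ ∂μ
      - L / 2 * c.step ^ 2 * c.dirSq μ m) ≤ Δ := by
  have hi : ∀ m ∈ Finset.range (R / K),
      Integrable (fun ω => ⟪c.meanGrad (c.model m ω), c.dir m ω⟫) μ ∧
        Integrable (fun ω => ‖c.dir m ω‖ ^ 2) μ := by
    intro m hm
    have hm := Finset.mem_range.1 hm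
    obtain ⟨hx, he⟩ := h.memLp_model_err hη hηL m hm.le
    have hd := h.memLp_dir hη hηL hm hx he
    exact ⟨integrable_inner_of_memLp (h.memLp_meanGrad hx) hd, integrable_norm_sq hd⟩
  have hi' : ∀ m ∈ Finset.range (R / K), Integrable (fun ω =>
      c.step * ⟪c.meanGrad (c.model m ω), c.dir m ω⟫
        - L / 2 * c.step ^ 2 * ‖c.dir m ω‖ ^ 2) μ := fun m hm =>
    ((hi m hm).1.const_mul _).sub ((hi m hm).2.const_mul _)
  calc _ = ∫ ω, ∑ m ∈ Finset.range (R / K), (c.step * ⟪c.meanGrad (c.model m ω), c.dir m ω⟫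
        - L / 2 * c.step ^ 2 * ‖c.dir m ω‖ ^ 2) ∂μ := by
        rw [integral_finsetSum _ hi']
        refine Finset.sum_congr rfl fun m hm => ?_
        rw [integral_sub ((hi m hm).1.const_mul _) ((hi m hm).2.const_mul _),
          integral_const_mul, integral_const_mul, dirSq]
    _ ≤ ∫ _ω, Δ ∂μ := by
        refine integral_mono_ae (integrable_finsetSum _ hi') (integrable_const _) ?_
        filter_upwards [h.ae_good] with ω hω
        refine (Finset.sum_le_sum fun m hm => h.descent (Finset.mem_range.1 hm) hω).trans ?_
        rw [Finset.sum_range_sub' (fun m => c.p.obj (c.model m ω)), c.model_zero]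
        exact h.adm.gap _
    _ = Δ := by simp

theorem sum_gradSq_le (h : c.IsValid μ Δ L σ R) (hη : 0 < c.η) (hL : 0 < L)
    (hηL : 64 * c.η ^ 2 * L ^ 2 * (K * c.I * N) ^ 2 * c.I ≤ 1 / (16 * N * K))
    (hηL' : 2 * (c.η * (K * c.I) * L) ≤ 1) (hstep : c.step = c.S / (16 * N * L)) :
    ∑ m ∈ Finset.range (R / K), c.gradSq μ m ≤ 64 * (Δ * L * N / c.S)
      + 4 * (σ ^ 2 / (N * K * c.I) * (N / (c.S * K)))
      + (R / K : ℕ) * (14 * (σ ^ 2 / (N * K * c.I))) := by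
  have hS := h.one_le_S
  have hK := h.one_le_K
  have hI := h.one_le_I
  have hN := h.one_le_N
  have hSK := h.S_mul_K_le
  have hp := h.prob_pos
  have hg0 : ∀ m, 0 ≤ c.gradSq μ m := fun m => integral_nonneg fun ω => sq_nonneg _
  have he0 : ∀ m, 0 ≤ c.errSq μ m := fun m => mul_nonneg (by positivity)
    (Finset.sum_nonneg fun i _ => integral_nonneg fun ω => sq_nonneg _)
  have hML : ∀ m < R / K, MemLp (c.model m) 2 μ ∧ ∀ i, MemLp (c.err m i) 2 μ :=
    fun m hm => h.memLp_model_err hη.le hηL' m hm.le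
  have hstep0 : 0 < c.step := by rw [hstep]; positivity
  have hstepL : L * c.step = c.S / (16 * N) := by rw [hstep]; field_simp
  have key := sum_le_of_recursion (M := R / K) (Γ := c.gradSq μ) (A := c.errSq μ) (Q := c.dirSq μ)
    (D := fun m => L ^ 2 * c.radSq μ m) (p := c.prob) (θ := L * c.step) (k := c.S * K)
    (v := σ ^ 2 / c.I) (δ := 64 * c.η ^ 2 * L ^ 2 * (K * c.I * N) ^ 2 * c.I) (T := Δ / c.step)
    hp h.prob_le_one (by positivity)
    (by
      rw [hstepL, prob, ← mul_div_assoc, div_le_div_iff₀ (by positivity) (by positivity)]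
      have : (c.S : ℝ) * 1 ≤ c.S * K := by gcongr
      nlinarith)
    (one_le_mul_of_one_le_of_one_le hS hK) (by positivity)
    -- Here θ/k = S/(16N)/(SK) = 1/(16NK), the bound imposed on η.
    (by
      refine hηL.trans (le_of_eq ?_)
      rw [hstepL]
      field_simp)
    hg0 he0 h.errSq_zero_le
    (fun m hm => by
      have h1 := h.dirSq_le hη.le hηL' hm (hML m hm).1 (hML m hm).2
      rwa [div_div, mul_comm (c.I : ℝ)])
    (fun m => mul_nonneg (by positivity) (integral_nonneg fun ω => sq_nonneg _))
    (fun m hm => by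
      have h1 := h.integral_radius_sq_le hm (hML m hm).1 (hML m hm).2
      -- The recursion measures noise by v = σ²/I, while the radius sees the full σ². This is the
      -- source of the extra factor I in δ.
      have h2 : c.gradSq μ m + c.errSq μ m + σ ^ 2 ≤
          c.I * (c.gradSq μ m + c.errSq μ m + σ ^ 2 / c.I) := by
        rw [mul_add, mul_div_cancel₀ _ (by positivity)]
        have := hg0 m
        have := he0 m
        nlinarith
      calc L ^ 2 * c.radSq μ m ≤ L ^ 2 * (64 * c.η ^ 2 * (K * c.I * N) ^ 2 *
            (c.I * (c.gradSq μ m + c.errSq μ m + σ ^ 2 / c.I))) := by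
            refine mul_le_mul_of_nonneg_left (h1.trans ?_) (by positivity)
            gcongr
        _ = _ := by ring)
    (fun m hm => by
      have h1 := h.errSq_succ_le hη.le hηL' hm (hML m hm).1 (hML m hm).2
      rwa [mul_pow])
    (by
      rw [le_div_iff₀ hstep0, Finset.sum_mul]
      refine (Finset.sum_le_sum fun m hm => ?_).trans (h.sum_descent_le hη.le hηL')
      have hm := Finset.mem_range.1 hm
      have h1 := mul_le_mul_of_nonneg_left
        (h.le_integral_inner_dir hη.le hηL' hm (hML m hm).1 (hML m hm).2) hstep0.le
      linarith)
  rw [hstepL] at key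
  refine key.trans (le_of_eq ?_)
  rw [hstep, prob]
  field_simp
  ring

end IsValid

end Setup

/-! ### The output -/

namespace Setup

variable {Ω Ξ : Type*} [MeasurableSpace Ξ] {N K d : ℕ}

namespace IsValid

variable [mΩ : MeasurableSpace Ω] {μ : Measure Ω} {Δ L σ : ℝ} {R : ℕ}
  {c : Setup Ω Ξ N K d}

theorem gradient_output (h : c.IsValid μ Δ L σ R) (ω : Ω) :
    gradient c.p.obj (output c.p c.S c.η c.γ K c.I c.x₀ c.X ω) =
      c.meanGrad (c.model (c.X.index ω) ω) := by
  rw [h.gradient_obj]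
  rfl

variable [IsProbabilityMeasure μ]

theorem ae_index_lt (h : c.IsValid μ Δ L σ R) (hR : 0 < R / K) :
    ∀ᵐ ω ∂μ, c.X.index ω < R / K := by
  have hm : ∀ m, MeasurableSet (c.X.index ⁻¹' {m}) := fun m =>
    h.run.measurable_index (measurableSet_singleton m)
  have hset : {ω | c.X.index ω < R / K} = ⋃ m ∈ Finset.range (R / K), c.X.index ⁻¹' {m} := by
    ext ω; simp
  have h1 : μ.real {ω | c.X.index ω < R / K} = 1 := by
    rw [hset, measureReal_biUnion_finset
      (fun m _ m' _ hne => (Set.disjoint_singleton.2 hne).preimage _) fun m _ => hm m,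
      Finset.sum_congr rfl fun m hm => h.run.law_index m (Finset.mem_range.1 hm),
      Finset.sum_const, Finset.card_range, nsmul_eq_mul]
    exact mul_one_div_cancel (by exact_mod_cast hR.ne')
  have h2 : MeasurableSet {ω | c.X.index ω < R / K} := by
    rw [hset]; exact Finset.measurableSet_biUnion _ fun m _ => hm m
  rw [measureReal_def, ENNReal.toReal_eq_one_iff] at h1
  exact (prob_compl_eq_zero_iff h2).2 h1

/-- The index is a draw of its own, independent of the trajectory, and uniform; so the output
averages the squared gradients over the window starts. -/
theorem integral_output (h : c.IsValid μ Δ L σ R) (hR : 0 < R / K)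
    (hx : ∀ m < R / K, MemLp (c.model m) 2 μ) :
    Integrable (fun ω => ‖c.meanGrad (c.model (c.X.index ω) ω)‖ ^ 2) μ ∧
      ∫ ω, ‖c.meanGrad (c.model (c.X.index ω) ω)‖ ^ 2 ∂μ =
        1 / (R / K : ℕ) * ∑ m ∈ Finset.range (R / K), c.gradSq μ m := by
  have hae : (fun ω => ∑ m ∈ Finset.range (R / K), (if c.X.index ω = m then (1 : ℝ) else 0) *
      ‖c.meanGrad (c.model m ω)‖ ^ 2) =ᵐ[μ]
      fun ω => ‖c.meanGrad (c.model (c.X.index ω) ω)‖ ^ 2 := by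
    filter_upwards [h.ae_index_lt hR] with ω hω
    simp only [ite_mul, one_mul, zero_mul, Finset.sum_ite_eq, Finset.mem_range, hω, if_true]
  have hind : ∀ m, Measurable[c.X.alg (R := R) (I := c.I) {.inl ()}]
      fun ω => if c.X.index ω = m then (1 : ℝ) else 0 := fun m =>
    (measurable_of_countable fun n : ℕ => if n = m then (1 : ℝ) else 0).comp
      (Draws.measurable_index (Set.mem_singleton _))
  have hg : ∀ m ∈ Finset.range (R / K), Measurable[c.X.alg (drawsBefore N R c.I (m * K))]
      fun ω => ‖c.meanGrad (c.model m ω)‖ ^ 2 := fun m hm =>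
    (continuous_norm.measurable.comp (h.measurable_meanGrad.comp
      (h.measurable_model (Finset.mem_range.1 hm).le subset_rfl))).pow_const 2
  have hint : ∀ m ∈ Finset.range (R / K), Integrable (fun ω =>
      (if c.X.index ω = m then (1 : ℝ) else 0) * ‖c.meanGrad (c.model m ω)‖ ^ 2) μ := by
    intro m hm
    refine (integrable_norm_sq (h.memLp_meanGrad (hx m (Finset.mem_range.1 hm)))).bdd_mul
      (c := 1) ((hind m).mono h.run.alg_le le_rfl).aestronglyMeasurable (.of_forall fun ω => ?_)
    split_ifs <;> simp
  refine ⟨(integrable_finsetSum _ hint).congr hae, ?_⟩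
  rw [← integral_congr_ae hae, integral_finsetSum _ hint, Finset.mul_sum]
  refine Finset.sum_congr rfl fun m hm => ?_
  have hdisj : Disjoint ({.inl ()} : Set (Unit ⊕ Fin R ⊕ (Fin c.I × Fin N) ⊕
      (Fin R × Fin c.I × Fin N))) (drawsBefore N R c.I (m * K)) :=
    Set.disjoint_singleton_left.2 (by simp [drawsBefore])
  rw [integral_mul_of_indep h.run.alg_le h.run.alg_le (h.run.indep_alg hdisj) (hind m) (hg m hm),
    gradSq]
  congr 1
  have h1 : (fun ω => if c.X.index ω = m then (1 : ℝ) else 0) =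
      (c.X.index ⁻¹' {m}).indicator 1 := by
    funext ω
    by_cases hi : c.X.index ω = m
    · rw [if_pos hi, Set.indicator_of_mem (show ω ∈ c.X.index ⁻¹' {m} from hi), Pi.one_apply]
    · rw [if_neg hi, Set.indicator_of_notMem (show ω ∉ c.X.index ⁻¹' {m} from hi)]
  rw [h1, integral_indicator_one (h.run.measurable_index (measurableSet_singleton m)),
    h.run.law_index m (Finset.mem_range.1 hm)]

theorem gradSq_zero_le (h : c.IsValid μ Δ L σ R) : c.gradSq μ 0 ≤ 2 * (Δ * L) := by
  have h1 : c.gradSq μ 0 = ‖gradient c.p.obj c.x₀‖ ^ 2 := by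
    rw [h.gradient_obj, gradSq]
    simp [model_zero]
  rw [h1]
  exact norm_gradient_sq_le h.differentiable_obj h.hL h.norm_gradient_obj_sub_le c.x₀ h.adm.gap

/-- A single window returns the initial model. -/
theorem integral_output_le_of_single (h : c.IsValid μ Δ L σ R) (hR : R / K = 1) {ε : ℝ}
    (hε : 2 * (Δ * L) ≤ ε ^ 2) :
    Integrable (fun ω => ‖c.meanGrad (c.model (c.X.index ω) ω)‖ ^ 2) μ ∧
      ∫ ω, ‖c.meanGrad (c.model (c.X.index ω) ω)‖ ^ 2 ∂μ ≤ ε ^ 2 := by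
  obtain ⟨h1, h2⟩ := h.integral_output (hR ▸ one_pos) fun m hm => by
    obtain rfl : m = 0 := by omega
    rw [funext c.model_zero]
    exact memLp_const _
  refine ⟨h1, ?_⟩
  rw [h2, hR]
  simpa using h.gradSq_zero_le.trans hε

/-- Divided by M, the three terms of `sum_gradSq_le` are at most 4ε² by the choice of M, ε²/2 for
the initial errors and 14ε² for the noise. -/
theorem integral_output_le (h : c.IsValid μ Δ L σ R) (hη : 0 < c.η) (hL : 0 < L) (hR : 0 < R / K)
    (hηL : 64 * c.η ^ 2 * L ^ 2 * (K * c.I * N) ^ 2 * c.I ≤ 1 / (16 * N * K))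
    (hηL' : 2 * (c.η * (K * c.I) * L) ≤ 1) (hstep : c.step = c.S / (16 * N * L)) {ε : ℝ}
    (hε : ε ^ 2 < 2 * (Δ * L)) (hM : 16 * (Δ * L * N / (c.S * ε ^ 2)) ≤ (R / K : ℕ))
    (hI : σ ^ 2 / (K * N * ε ^ 2) ≤ c.I) (hε0 : 0 < ε) :
    Integrable (fun ω => ‖c.meanGrad (c.model (c.X.index ω) ω)‖ ^ 2) μ ∧
      ∫ ω, ‖c.meanGrad (c.model (c.X.index ω) ω)‖ ^ 2 ∂μ ≤ 19 * ε ^ 2 := by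
  have hS := h.one_le_S
  have hK := h.one_le_K
  have hI1 := h.one_le_I
  have hN := h.one_le_N
  obtain ⟨h1, h2⟩ := h.integral_output hR fun m hm => (h.memLp_model_err hη.le hηL' m hm.le).1
  refine ⟨h1, ?_⟩
  have hM0 : (0 : ℝ) < (R / K : ℕ) := by exact_mod_cast hR
  have h3 := h.sum_gradSq_le hη hL hηL hηL' hstep
  set M : ℝ := ((R / K : ℕ) : ℝ)
  have hv : σ ^ 2 / (N * K * c.I) ≤ ε ^ 2 := by
    rw [div_le_iff₀ (by positivity)] at hI ⊢
    linarith
  have hM' : 16 * (Δ * L * N / c.S) ≤ M * ε ^ 2 := by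
    rw [← div_div, ← mul_div_assoc, div_le_iff₀ (by positivity)] at hM
    exact hM
  -- In the regime ε² < 2ΔL, the lower bound on M exceeds 8N/S, so there are enough windows to
  -- average out the initial errors.
  have hM1 : N / (c.S * K) ≤ M / 8 := by
    have h4 : ε ^ 2 * (8 * (N / c.S)) ≤ ε ^ 2 * M := by
      have h5 : ε ^ 2 * (N / c.S) ≤ 2 * (Δ * L) * (N / c.S) := by gcongr
      have h6 : Δ * L * N / c.S = Δ * L * (N / c.S) := by ring
      rw [h6] at hM'
      linarith
    have h5 := le_of_mul_le_mul_left h4 (by positivity)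
    have h6 : N / (c.S * K) ≤ (N : ℝ) / c.S := by
      rw [← div_div]; exact div_le_self (by positivity) hK
    linarith
  rw [h2, one_div, inv_mul_le_iff₀ hM0]
  have h7 : σ ^ 2 / (N * K * c.I) * (N / (c.S * K)) ≤ ε ^ 2 * (M / 8) := by gcongr
  have h8 : M * (14 * (σ ^ 2 / (N * K * c.I))) ≤ M * (14 * ε ^ 2) := by gcongr
  nlinarith [sq_nonneg ε]

end IsValid

end Setup

/-! ### Complexity -/

/-- With B the bound for the rounds and Y = σ²/(KNε²), the iteration bound is the product BY. Hence
B(Y + 1) is at most twice the maximum of B and BY, and at most 2BY once Y ≥ 1. -/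
theorem complexity_bounds {N K S : ℕ} (hK : 0 < K) (hS : 0 < S) (hSK : S * K ≤ N)
    {Δ L σ ε : ℝ} (hε : 0 < ε) {M I : ℕ}
    (hM : (M : ℝ) ≤ 18 * (Δ * L * N / (S * ε ^ 2)))
    (hI : (I : ℝ) ≤ σ ^ 2 / (K * N * ε ^ 2) + 1) :
    ((K * M : ℕ) : ℝ) ≤ 36 * (Δ * L * K * N / (S * ε ^ 2)) ∧
      ((K * M : ℕ) * I : ℝ) ≤
        36 * max (Δ * L * K * N / (S * ε ^ 2)) (Δ * L * σ ^ 2 / (S * ε ^ 4)) ∧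
      (ε ^ 2 ≤ σ ^ 2 / (K * N) → ((K * M : ℕ) * I : ℝ) ≤ 36 * (Δ * L * σ ^ 2 / (S * ε ^ 4))) := by
  have hK0 : (0 : ℝ) < K := by exact_mod_cast hK
  have hS0 : (0 : ℝ) < S := by exact_mod_cast hS
  have hN0 : (0 : ℝ) < N := by exact_mod_cast (Nat.mul_pos hS hK).trans_le hSK
  set B := Δ * L * K * N / (S * ε ^ 2) with hB
  set Y := σ ^ 2 / (K * N * ε ^ 2) with hY
  have hY0 : 0 ≤ Y := by positivity
  have hT : Δ * L * σ ^ 2 / (S * ε ^ 4) = B * Y := by rw [hB, hY]; field_simp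
  have h1 : ((K * M : ℕ) : ℝ) ≤ 18 * B := by
    push_cast
    calc (K * M : ℝ) ≤ K * (18 * (Δ * L * N / (S * ε ^ 2))) := by gcongr
      _ = 18 * B := by rw [hB]; ring
  have hB0 : 0 ≤ B := by
    have : (0 : ℝ) ≤ (K * M : ℕ) := Nat.cast_nonneg _
    linarith
  have h2 : ((K * M : ℕ) * I : ℝ) ≤ 18 * B * (Y + 1) := by gcongr
  rw [hT]
  refine ⟨by linarith, ?_, fun hσ => ?_⟩
  · have h3 := le_max_left B (B * Y)
    have h4 := le_max_right B (B * Y)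
    linarith
  · have h3 : 1 ≤ Y := by
      rw [hY, ← div_div, le_div_iff₀ (by positivity)]
      linarith
    have h4 := mul_le_mul_of_nonneg_left h3 hB0
    linarith

theorem single_complexity_bounds {N K S : ℕ} (hK : 0 < K) (hS : 0 < S) (hSK : S * K ≤ N)
    {Δ L σ ε : ℝ} (hε : 0 < ε) (h : ε ^ 2 ≤ Δ * L * N / S) :
    (K : ℝ) ≤ Δ * L * K * N / (S * ε ^ 2) ∧
      (ε ^ 2 ≤ σ ^ 2 / (K * N) → (K : ℝ) ≤ Δ * L * σ ^ 2 / (S * ε ^ 4)) := by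
  have hK0 : (0 : ℝ) < K := by exact_mod_cast hK
  have hS0 : (0 : ℝ) < S := by exact_mod_cast hS
  have hN0 : (0 : ℝ) < N := by exact_mod_cast (Nat.mul_pos hS hK).trans_le hSK
  have h1 : (K : ℝ) ≤ Δ * L * K * N / (S * ε ^ 2) := by
    rw [le_div_iff₀ hS0] at h
    rw [le_div_iff₀ (by positivity)]
    nlinarith
  refine ⟨h1, fun hσ => h1.trans ?_⟩
  have hT : Δ * L * σ ^ 2 / (S * ε ^ 4) =
      Δ * L * K * N / (S * ε ^ 2) * (σ ^ 2 / (K * N * ε ^ 2)) := by field_simp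
  rw [hT]
  refine le_mul_of_one_le_right (hK0.le.trans h1) ?_
  rw [← div_div, le_div_iff₀ (by positivity)]
  linarith

end FedPeriodic

end

open FedPeriodic in
theorem mainTheorem4 :
    -- the two participation conditions hold with window length `K` and `ρ² = 1/S`
    (∀ (N K S R : ℕ), 0 < K → 0 < S → S * K ≤ N →
      ∀ (group : Fin N → Fin K), IsEqualPartition group →
      ∀ (Ω : Type*) [MeasurableSpace Ω] (μ : Measure Ω) [IsProbabilityMeasure μ]
        (A : ℕ → Ω → Finset (Fin N)), IsCyclic μ group S R A →
      ∀ q : Ω → ℕ → Fin N → ℝ, (q = fun ω r => weight S (A r ω)) →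
      ∀ m < R / K,
        (∀ i : Fin N,
          (μ[fun ω => wCoef (q ω) K m i | pastQ q (m * K)]
              =ᵐ[μ] fun _ => (S * K : ℝ) / (N : ℝ) ^ 2) ∧
          ∫ ω, wCoef (q ω) K m i ∂μ = (S * K : ℝ) / (N : ℝ) ^ 2 ∧
          (S * K : ℝ) / (N : ℝ) ^ 2 ≤ (K : ℝ) ^ 2 / N ∧
          ∫ ω, qBar (q ω) K m i ∂μ = 1 / (N : ℝ) ∧
          Var[fun ω => qBar (q ω) K m i; μ]
            = 1 / (S * N * K : ℝ) * (1 - (S * K : ℝ) / N)) ∧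
        ∫ ω, ∑ i, (qBar (q ω) K m i - 1 / (N : ℝ)) ^ 2 * lamCoef (q ω) K (zInit group S) m i ∂μ
          = 1 / (S : ℝ) * (1 - (S * K : ℝ) / N) ∧
        1 / (S : ℝ) * (1 - (S * K : ℝ) / N) ≤ 1 / (S : ℝ)) ∧
    -- complexity, with an absolute constant `C`
    ∃ C : ℝ, 0 < C ∧
      ∀ (N K S : ℕ), 0 < K → 0 < S → S * K ≤ N →
      ∀ (Δ L σ ε : ℝ), 0 ≤ Δ → 0 ≤ L → 0 ≤ σ → 0 < ε →
      ∃ (η γ : ℝ) (P I R : ℕ), 0 < η ∧ 0 < γ ∧ P = K ∧ 0 < I ∧ 0 < R ∧ P ∣ R ∧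
        (R : ℝ) ≤ C * max (K : ℝ) (Δ * L * K * N / (S * ε ^ 2)) ∧
        (R * I : ℝ) ≤
          C * max (max (K : ℝ) (Δ * L * K * N / (S * ε ^ 2))) (Δ * L * σ ^ 2 / (S * ε ^ 4)) ∧
        (ε ^ 2 ≤ Δ * L * N / S →
          (R : ℝ) ≤ C * (Δ * L * K * N / (S * ε ^ 2)) ∧
          (ε ^ 2 ≤ σ ^ 2 / (K * N) → (R * I : ℝ) ≤ C * (Δ * L * σ ^ 2 / (S * ε ^ 4)))) ∧
        ∀ (d : ℕ) (Ξ : Type*) [MeasurableSpace Ξ] (p : Problem N d Ξ) (x₀ : Vec d),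
          p.Admissible x₀ Δ L σ →
          ∀ (group : Fin N → Fin K), IsEqualPartition group →
          ∀ (Ω : Type*) [MeasurableSpace Ω] (μ : Measure Ω) [IsProbabilityMeasure μ]
            (X : Draws Ω Ξ N), X.IsRun μ p.D group S P I R →
            Integrable (fun ω => ‖gradient p.obj (output p S η γ P I x₀ X ω)‖ ^ 2) μ ∧
            ∫ ω, ‖gradient p.obj (output p S η γ P I x₀ X ω)‖ ^ 2 ∂μ ≤ C * ε ^ 2 := by
  refine ⟨fun N K S R hK hS hSK group hg Ω _ μ _ A hA q hq m hm =>
    hA.participation_conditions hg hK hS hSK hq hm, 100, by norm_num, ?_⟩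
  intro N K S hK hS hSK Δ L σ ε hΔ hL _ hε
  have hK0 : (0 : ℝ) < K := by exact_mod_cast hK
  have hS0 : (0 : ℝ) < S := by exact_mod_cast hS
  have hN0 : (0 : ℝ) < N := by exact_mod_cast (Nat.mul_pos hS hK).trans_le hSK
  have hK1 : (1 : ℝ) ≤ K := by exact_mod_cast hK
  have hN1 : (1 : ℝ) ≤ N := by exact_mod_cast (Nat.mul_pos hS hK).trans_le hSK
  have hB0 : 0 ≤ Δ * L * K * N / (S * ε ^ 2) := by positivity
  have hT0 : 0 ≤ Δ * L * σ ^ 2 / (S * ε ^ 4) := by positivity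
  -- In this case the gradient at the starting point already has squared norm at most ε². A single
  -- window always outputs that point, so η, γ and I can be arbitrary.
  by_cases hc : 2 * (Δ * L) ≤ ε ^ 2
  · have hb := le_max_left (K : ℝ) (Δ * L * K * N / (S * ε ^ 2))
    have hb' := le_max_left (max (K : ℝ) (Δ * L * K * N / (S * ε ^ 2)))
      (Δ * L * σ ^ 2 / (S * ε ^ 4))
    refine ⟨1, 1, K, 1, K, one_pos, one_pos, rfl, one_pos, hK, dvd_rfl, by linarith, ?_,
      fun hx => ?_, ?_⟩
    · push_cast
      linarith
    · obtain ⟨h1, h2⟩ := single_complexity_bounds (σ := σ) hK hS hSK hε hx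
      refine ⟨by linarith, fun hy => ?_⟩
      have := h2 hy
      push_cast
      linarith
    · intro d Ξ _ p x₀ hp group hg Ω _ μ _ X hX
      let c : Setup Ω Ξ N K d :=
        { p := p, x₀ := x₀, X := X, group := group, S := S, I := 1, η := 1, γ := 1 }
      have hv : c.IsValid μ Δ L σ K :=
        { adm := hp, part := hg, run := hX, hK := hK, hS := hS, hSK := hSK, hI := one_pos
          hL := hL }
      obtain ⟨h1, h2⟩ := hv.integral_output_le_of_single (Nat.div_self hK) hc
      simp only [← hv.gradient_output] at h1 h2
      exact ⟨h1, h2.trans (by nlinarith [sq_nonneg ε])⟩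
  · have hc := not_le.1 hc
    have hL0 : 0 < L := by
      refine lt_of_le_of_ne hL fun h0 => ?_
      rw [← h0] at hc
      nlinarith [sq_nonneg ε]
    set x := Δ * L * N / (S * ε ^ 2) with hx
    set M := ⌊16 * x⌋₊ + 1 with hM
    set I := ⌊σ ^ 2 / (K * N * ε ^ 2)⌋₊ + 1 with hI
    have hx0 : 0 ≤ x := by positivity
    -- This absorbs the rounding in M: 16x + 1 ≤ 18x. It holds since ε² < 2ΔL and S ≤ N.
    have hx1 : 1 ≤ 2 * x := by
      have hSN : (S : ℝ) ≤ N := by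
        exact_mod_cast (Nat.le_mul_of_pos_right S hK).trans hSK
      rw [hx, ← mul_div_assoc, le_div_iff₀ (by positivity), one_mul]
      calc (S * ε ^ 2 : ℝ) ≤ N * (2 * (Δ * L)) := by gcongr
        _ = _ := by ring
    have hMle : (M : ℝ) ≤ 18 * x := by
      have := Nat.floor_le (by positivity : 0 ≤ 16 * x)
      rw [hM]; push_cast; linarith
    have hMge : 16 * x ≤ M := by
      rw [hM]; push_cast; exact (Nat.lt_floor_add_one _).le
    have hIle : (I : ℝ) ≤ σ ^ 2 / (K * N * ε ^ 2) + 1 := by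
      have := Nat.floor_le (by positivity : 0 ≤ σ ^ 2 / (K * N * ε ^ 2))
      rw [hI]; push_cast; linarith
    have hIge : σ ^ 2 / (K * N * ε ^ 2) ≤ I := by
      rw [hI]; push_cast; exact (Nat.lt_floor_add_one _).le
    have hIpos : 0 < I := Nat.succ_pos _
    have hMpos : 0 < M := Nat.succ_pos _
    have hI1 : (1 : ℝ) ≤ I := by exact_mod_cast hIpos
    obtain ⟨hr, hri, hri'⟩ := complexity_bounds hK hS hSK hε hMle hIle
    have hm1 := le_max_right (K : ℝ) (Δ * L * K * N / (S * ε ^ 2))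
    have hm2 : max (Δ * L * K * N / (S * ε ^ 2)) (Δ * L * σ ^ 2 / (S * ε ^ 4)) ≤
        max (max (K : ℝ) (Δ * L * K * N / (S * ε ^ 2))) (Δ * L * σ ^ 2 / (S * ε ^ 4)) :=
      max_le_max_right _ hm1
    have hm3 : 0 ≤ max (Δ * L * K * N / (S * ε ^ 2)) (Δ * L * σ ^ 2 / (S * ε ^ 4)) :=
      le_max_of_le_left hB0
    -- γ is solved from γηKI = S/(16NL), whatever η is. The choice of η gives drift coefficient
    -- 1/(16K²N²I), below the required 1/(16NK), and 2ηKIL = 1/(16KIN²) ≤ 1.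
    refine ⟨1 / (32 * L * (K * I * N) ^ 2),
      S / (16 * N * L) / (1 / (32 * L * (K * I * N) ^ 2) * K * I), K, I, K * M, by positivity,
      by positivity, rfl, hIpos, Nat.mul_pos hK hMpos, Dvd.intro _ rfl, by linarith, by linarith,
      fun _ => ⟨by linarith, fun hy => (hri' hy).trans (by linarith)⟩, ?_⟩
    intro d Ξ _ p x₀ hp group hg Ω _ μ _ X hX
    let c : Setup Ω Ξ N K d :=
      { p := p, x₀ := x₀, X := X, group := group, S := S, I := I
        η := 1 / (32 * L * (K * I * N) ^ 2)
        γ := S / (16 * N * L) / (1 / (32 * L * (K * I * N) ^ 2) * K * I) }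
    have hv : c.IsValid μ Δ L σ (K * M) :=
      { adm := hp, part := hg, run := hX, hK := hK, hS := hS, hSK := hSK, hI := hIpos
        hL := hL }
    have hdiv : K * M / K = M := Nat.mul_div_cancel_left M hK
    have hη : 0 < c.η := by
      change 0 < 1 / (32 * L * (K * I * N : ℝ) ^ 2)
      positivity
    have hstep : c.step = c.S / (16 * N * L) := by
      change S / (16 * N * L) / (1 / (32 * L * (K * I * N) ^ 2) * K * I) *
        (1 / (32 * L * (K * I * N) ^ 2)) * K * I = (S / (16 * N * L) : ℝ)
      field_simp
    have hηL : 64 * c.η ^ 2 * L ^ 2 * (K * c.I * N) ^ 2 * c.I ≤ 1 / (16 * N * K) := by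
      change 64 * (1 / (32 * L * (K * I * N : ℝ) ^ 2)) ^ 2 * L ^ 2 * (K * I * N) ^ 2 * I ≤
        1 / (16 * N * K)
      have h1 : 64 * (1 / (32 * L * (K * I * N : ℝ) ^ 2)) ^ 2 * L ^ 2 * (K * I * N) ^ 2 * I =
          1 / (16 * N * K * (N * K * I)) := by field_simp; norm_num
      rw [h1]
      refine one_div_le_one_div_of_le (by positivity) (le_mul_of_one_le_right (by positivity) ?_)
      exact one_le_mul_of_one_le_of_one_le (one_le_mul_of_one_le_of_one_le hN1 hK1) hI1
    have hηL' : 2 * (c.η * (K * c.I) * L) ≤ 1 := by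
      change 2 * (1 / (32 * L * (K * I * N : ℝ) ^ 2) * (K * I) * L) ≤ 1
      have h1 : 2 * (1 / (32 * L * (K * I * N : ℝ) ^ 2) * (K * I) * L) =
          1 / (16 * (K * I * N * N)) := by field_simp; norm_num
      rw [h1, div_le_one (by positivity)]
      have h2 : (1 : ℝ) ≤ K * I * N * N := one_le_mul_of_one_le_of_one_le
        (one_le_mul_of_one_le_of_one_le (one_le_mul_of_one_le_of_one_le hK1 hI1) hN1) hN1
      linarith
    obtain ⟨h1, h2⟩ := hv.integral_output_le hη hL0 (hdiv.symm ▸ hMpos) hηL hηL' hstep hc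
      (by rw [hdiv]; exact hMge) hIge hε
    simp only [← hv.gradient_output] at h1 h2
    exact ⟨h1, h2.trans (by nlinarith [sq_nonneg ε])⟩
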